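/- Let $\alpha>0$, $\beta\in\mathbb R$, $E_1=-\beta-\alpha$, $E_2=-\beta+\alpha$, and let $N_1\ge 2$ be an integer. Put $u_0^b(x)=\alpha e^{2i\beta x}$ and let $u_0:\mathbb R\to\mathbb C$ satisfy $x^n(u_0-u_0^b)\in L^1(-\infty,0)$ and $x^nu_0\in L^1(0,\infty)$ for $n=0,\dots,N_1$. Write $\mathbb C_\pm=\{\pm\operatorname{Im}k>0\}$, $\sigma_3=\mathrm{diag}(1,-1)$, $U_0=\begin{pmatrix}0&u_0\\ \overline{u_0}&0\end{pmatrix}$, $U_0^b=\begin{pmatrix}0&u_0^b\\ \overline{u_0^b}&0\end{pmatrix}$. Let $X(k)=\sqrt{(k-E_1)(k-E_2)}$ and $\Delta(k)=\left(\frac{k-E_2}{k-E_1}\right)^{1/4}$ be the branches that are analytic off $[E_1,E_2]$ with $X(k)=k+\beta+O(k^{-1})$ and $\Delta(k)=1+O(k^{-1})$ as $k\to\infty$, and let $$\phi_1^b(x,k)=e^{i\beta x\sigma_3}s^b(k)e^{-iX(k)x\sigma_3},\qquad s^b=\frac12\begin{pmatrix}\Delta+\Delta^{-1}&i(\Delta-\Delta^{-1})\\-i(\Delta-\Delta^{-1})&\Delta+\Delta^{-1}\end{pmatrix}.$$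 Let $\phi_1,\phi_2$ be given by the Volterra equations (for $x\in\mathbb R$) $$\phi_1(x,k)=\phi_1^b(x,k)+\int_{-\infty}^x\phi_1^b(x,k)\phi_1^b(x',k)^{-1}(U_0-U_0^b)(x')\phi_1(x',k)\,dx',$$ $$\phi_2(x,k)=e^{-ikx\sigma_3}-\int_x^\infty e^{ik(x'-x)\sigma_3}U_0(x')\phi_2(x',k)\,dx',$$ with absolutely convergent integrals. Here the first column of $\phi_1$ is taken for $k\in\overline{\mathbb C_+}\setminus\{E_1,E_2\}$ and the second for $k\in\overline{\mathbb C_-}\setminus\{E_1,E_2\}$, where on the cut $(E_1,E_2)$ the boundary values of $X,\Delta$ from $\mathbb C_+$ are used for the first column and those from $\mathbb C_-$ for the second; the first column of $\phi_2$ is taken for $k\in\overline{\mathbb C_-}$ and the second for $k\in\overline{\mathbb C_+}$. For real $k\ne E_1,E_2$ let $s(k)=\phi_2(0,k)^{-1}\phi_1(0,k)$, $a=s_{11}$, $b=-s_{12}$. Proposition 3.3. The columns of $\phi_1,\phi_2$ are uniquely determined by these equations, and for $k\in\mathbb R\setminus\{E_1,E_2\}$ one has $s(k)=\phi_2(x,k)^{-1}\phi_1(x,k)$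 for every $x\in\mathbb R$, and $s=\begin{pmatrix}a&-b\\-\overline b&\overline a\end{pmatrix}$. Moreover, for all $k\in\mathbb R\setminus\{E_1,E_2\}$ and $x\in\mathbb R$, $$a=\phi_{1,11}\phi_{2,22}-\phi_{1,21}\phi_{2,12},\qquad \overline a=\phi_{1,22}\phi_{2,11}-\phi_{1,12}\phi_{2,21},$$ $$b=\phi_{1,22}\phi_{2,12}-\phi_{1,12}\phi_{2,22},\qquad \overline b=\phi_{1,11}\phi_{2,21}-\phi_{1,21}\phi_{2,11}.$$ In particular $a,b\in C^{N_1}(\mathbb R\setminus\{E_1,E_2\})$, and $a$ extends to a function in $C^{N_1}(\overline{\mathbb C_+}\setminus\{E_1,E_2\})$, again denoted by $a$, which is analytic in $\mathbb C_+$, has no zeros in $\overline{\mathbb C_+}\setminus\{E_1,E_2\}$ (so that the discrete spectrum is empty in this sense), and is given by $$a(k)=\det\big([\phi_1(x,k)]_1,[\phi_2(x,k)]_2\big),\qquad k\in\overline{\mathbb C_+}\setminus\{E_1,E_2\},\ x\in\mathbb R,$$ where $[\,\cdot\,]_j$ denotes the $j$-th column. Furthermore $\det s=|a|^2-|b|^2=1$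 on $\mathbb R\setminus[E_1,E_2]$; in particular $|a|\ge1$ and $|b|/|a|<1$ there. -/

import Mathlib

open MeasureTheory Set
open scoped ComplexConjugate Matrix

noncomputable section

namespace NLSStep

/-- Left end point `E₁ = -β - α` of the branch cut. -/
def E₁ (α β : ℝ) : ℝ := -β - α

/-- Right end point `E₂ = -β + α` of the branch cut. -/
def E₂ (α β : ℝ) : ℝ := -β + α

/-- The background initial datum `u₀ᵇ(x) = α e^{2iβx}`. -/
def u₀b (α β x : ℝ) : ℂ := (α : ℂ) * Complex.exp (2 * Complex.I * β * x)

/-- Step-like data: `xⁿ(u₀ - u₀ᵇ) ∈ L¹(ℝ₋)` and `xⁿ u₀ ∈ L¹(ℝ₊)` for `n = 0, …, N`. -/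
def StepLike (α β : ℝ) (N : ℕ) (u₀ : ℝ → ℂ) : Prop :=
  ∀ n : ℕ, n ≤ N →
    IntegrableOn (fun x : ℝ => (x : ℂ) ^ n * (u₀ x - u₀b α β x)) (Iio 0) ∧
    IntegrableOn (fun x : ℝ => (x : ℂ) ^ n * u₀ x) (Ioi 0)

/-- The diagonal matrix `e^{zσ₃}`. -/
def expσ₃ (z : ℂ) : Matrix (Fin 2) (Fin 2) ℂ := !![Complex.exp z, 0; 0, Complex.exp (-z)]

/-- The potential matrix with entries `u` and `ū` off the diagonal. -/
def potential (u : ℂ) : Matrix (Fin 2) (Fin 2) ℂ := !![0, u; conj u, 0]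

/-- `X(k) = √((k - E₁)(k - E₂))`, with the branch `X(k) = k + β + O(1/k)` at infinity.
The product of the two principal roots is analytic off `[E₁, E₂]`. As the principal
argument of a negative real number is `π`, the value on the cut `(E₁, E₂)` is the boundary value
from the upper half-plane. -/
def radX (α β : ℝ) (k : ℂ) : ℂ :=
  (k - E₁ α β) ^ (1 / 2 : ℂ) * (k - E₂ α β) ^ (1 / 2 : ℂ)

/-- `Δ(k) = ((k - E₂)/(k - E₁))^{1/4}`, with `Δ(k) → 1` at infinity. The quotient is a negative
real number exactly on `(E₁, E₂)`, and there the value is the boundary value from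
the upper half-plane. -/
def quartΔ (α β : ℝ) (k : ℂ) : ℂ :=
  ((k - E₂ α β) / (k - E₁ α β)) ^ (1 / 4 : ℂ)

/-- `X` with the boundary value from the lower half-plane on `(E₁, E₂)`.
Off `[E₁, E₂]` it agrees with `radX`, since `X` commutes with conjugation there. -/
def radXLower (α β : ℝ) (k : ℂ) : ℂ := conj (radX α β (conj k))

/-- `Δ` with the boundary value from the lower half-plane on `(E₁, E₂)`.
Off `[E₁, E₂]` it agrees with `quartΔ`. -/
def quartΔLower (α β : ℝ) (k : ℂ) : ℂ := conj (quartΔ α β (conj k))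

/-- The matrix `sᵇ` as a function of `Δ`. -/
def sb (Δ : ℂ) : Matrix (Fin 2) (Fin 2) ℂ :=
  (1 / 2 : ℂ) • !![Δ + Δ⁻¹, Complex.I * (Δ - Δ⁻¹); -Complex.I * (Δ - Δ⁻¹), Δ + Δ⁻¹]

/-- The background eigenfunction `φ₁ᵇ(x, 0, k) = e^{iβxσ₃} sᵇ(k) e^{-iX(k)xσ₃}`, with boundary
values from the upper half-plane on the cut. -/
def φb (α β : ℝ) (k : ℂ) (x : ℝ) : Matrix (Fin 2) (Fin 2) ℂ :=
  expσ₃ (Complex.I * β * x) * sb (quartΔ α β k) * expσ₃ (-(Complex.I * radX α β k * x))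

/-- The background eigenfunction with boundary values from the lower half-plane on the cut. -/
def φbLower (α β : ℝ) (k : ℂ) (x : ℝ) : Matrix (Fin 2) (Fin 2) ℂ :=
  expσ₃ (Complex.I * β * x) * sb (quartΔLower α β k) *
    expσ₃ (-(Complex.I * radXLower α β k * x))

/-- `φ` solves column `j` of the Volterra equation
`φ₁(x) = Φ(x) + ∫_{-∞}^x Φ(x) Φ(x')⁻¹ (U₀ - U₀ᵇ)(x') φ₁(x') dx'` for all real `x`, where `Φ` is
the background eigenfunction at the given spectral parameter; the integral converges absolutely. -/
def SolvesLeft (α β : ℝ) (u₀ : ℝ → ℂ) (Φ : ℝ → Matrix (Fin 2) (Fin 2) ℂ) (j : Fin 2)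
    (φ : ℝ → Fin 2 → ℂ) : Prop :=
  ∀ x : ℝ,
    IntegrableOn (fun x' : ℝ =>
      (Φ x * (Φ x')⁻¹ * (potential (u₀ x') - potential (u₀b α β x'))) *ᵥ φ x') (Iic x) ∧
    φ x = (Φ x).col j + ∫ x' in Iic x,
      (Φ x * (Φ x')⁻¹ * (potential (u₀ x') - potential (u₀b α β x'))) *ᵥ φ x'

/-- `φ` solves column `j` of the Volterra equation
`φ₂(x) = e^{-ikxσ₃} - ∫_x^∞ e^{ik(x'-x)σ₃} U₀(x') φ₂(x') dx'` for all real `x`; the integral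
converges absolutely. -/
def SolvesRight (u₀ : ℝ → ℂ) (k : ℂ) (j : Fin 2) (φ : ℝ → Fin 2 → ℂ) : Prop :=
  ∀ x : ℝ,
    IntegrableOn (fun x' : ℝ =>
      (expσ₃ (Complex.I * k * (x' - x)) * potential (u₀ x')) *ᵥ φ x') (Ici x) ∧
    φ x = (expσ₃ (-(Complex.I * k * x))).col j - ∫ x' in Ici x,
      (expσ₃ (Complex.I * k * (x' - x)) * potential (u₀ x')) *ᵥ φ x'

/-- The first column of `φ₁(·, k)`, meant for `Im k ≥ 0`, `k ≠ E₁, E₂`: the solution of its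
Volterra equation. -/
def φ₁col₁ (α β : ℝ) (u₀ : ℝ → ℂ) (k : ℂ) : ℝ → Fin 2 → ℂ :=
  Classical.epsilon (SolvesLeft α β u₀ (φb α β k) 0)

/-- The second column of `φ₁(·, k)`, meant for `Im k ≤ 0`, `k ≠ E₁, E₂`. On the cut it is the
boundary value from the lower half-plane. -/
def φ₁col₂ (α β : ℝ) (u₀ : ℝ → ℂ) (k : ℂ) : ℝ → Fin 2 → ℂ :=
  Classical.epsilon (SolvesLeft α β u₀ (φbLower α β k) 1)

/-- The first column of `φ₂(·, k)`, meant for `Im k ≤ 0`. -/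
def φ₂col₁ (u₀ : ℝ → ℂ) (k : ℂ) : ℝ → Fin 2 → ℂ :=
  Classical.epsilon (SolvesRight u₀ k 0)

/-- The second column of `φ₂(·, k)`, meant for `Im k ≥ 0`. -/
def φ₂col₂ (u₀ : ℝ → ℂ) (k : ℂ) : ℝ → Fin 2 → ℂ :=
  Classical.epsilon (SolvesRight u₀ k 1)

/-- The eigenfunction `φ₁(x, k)`. Its first column is meaningful in the closed upper, its second
column in the closed lower half-plane, away from `E₁, E₂`. -/
def φ₁ (α β : ℝ) (u₀ : ℝ → ℂ) (x : ℝ) (k : ℂ) : Matrix (Fin 2) (Fin 2) ℂ :=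
  !![φ₁col₁ α β u₀ k x 0, φ₁col₂ α β u₀ k x 0;
     φ₁col₁ α β u₀ k x 1, φ₁col₂ α β u₀ k x 1]

/-- The eigenfunction `φ₂(x, k)`. Its first column is meaningful in the closed lower, its second
column in the closed upper half-plane. -/
def φ₂ (u₀ : ℝ → ℂ) (x : ℝ) (k : ℂ) : Matrix (Fin 2) (Fin 2) ℂ :=
  !![φ₂col₁ u₀ k x 0, φ₂col₂ u₀ k x 0;
     φ₂col₁ u₀ k x 1, φ₂col₂ u₀ k x 1]

/-- The scattering matrix `s(k) = φ₂(x, k)⁻¹ φ₁(x, k)` for real `k ≠ E₁, E₂`. It does not depend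
on `x`, so it is read off at `x = 0`. -/
def scat (α β : ℝ) (u₀ : ℝ → ℂ) (k : ℝ) : Matrix (Fin 2) (Fin 2) ℂ :=
  (φ₂ u₀ 0 k)⁻¹ * φ₁ α β u₀ 0 k

/-- The scattering function `a = s₁₁`. -/
def a (α β : ℝ) (u₀ : ℝ → ℂ) (k : ℝ) : ℂ := scat α β u₀ k 0 0

/-- The scattering function `b = -s₁₂`. -/
def b (α β : ℝ) (u₀ : ℝ → ℂ) (k : ℝ) : ℂ := -scat α β u₀ k 0 1

/-- The set `{k : Im k ≥ 0} \ {E₁, E₂}`. -/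
def closedUpper (α β : ℝ) : Set ℂ := {k | 0 ≤ k.im} \ {(E₁ α β : ℂ), (E₂ α β : ℂ)}

/-- The set `{k : Im k ≤ 0} \ {E₁, E₂}`. -/
def closedLower (α β : ℝ) : Set ℂ := {k | k.im ≤ 0} \ {(E₁ α β : ℂ), (E₂ α β : ℂ)}

end NLSStep

end

/-!
All four columns reduce to a single Volterra problem at `-∞`: the first column for a background
`e^{iβxσ₃} S e^{-iζxσ₃}` with `det S = 1`, `Im ζ ≥ 0` and a potential integrable at `-∞`. The first
column of `φ₁` is the case `S = sᵇ`, `ζ = X(k)`. Reflecting the line and exchanging the components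
turns the second column of `φ₂` into the case `S = 1`, `ζ = k`. The symmetry `φ ↦ σ₁ φ̄`, `k ↦ k̄`
gives the other two columns.

Existence for that problem: `w = e^{iζx} e^{-iβxσ₃} φ` solves a Volterra equation with kernel
`P + e^{2iζ(x-y)} Q`, bounded for `y ≤ x`, and in a norm with the weight `exp(-λ ∫_{-∞}^t ‖V‖)` the
integral operator is a contraction (`VolterraData.norm_op_le_inv`, `exists_forall_isVolterraSol`).
Uniqueness holds among all functions with convergent integrals: the Wronskian of two solutions is
constant and vanishes at `-∞`, so a solution is proportional to the bounded one and hence itself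
bounded (`SolvesVolterra.isVolterraSol`). Smoothness in `k` up to the real axis: the operator is
`C^N` in `ζ` in operator norm on the closed half-plane when the potential has `N` moments
(`VolterraData.contDiffOn_op_expKer`), and inversion of operators is smooth.

The columns are solutions of one Dirac system with a trace-free matrix, so their Wronskians do not
depend on `x`; `a` and `b` are such Wronskians. Everything else rests on the energy
`E = |φ₀|² - |φ₁|²`, which satisfies `E' = 2 Im k (|φ₀|² + |φ₁|²)` (`energy_sub_energy`), and on the
Plücker relation `E(u) E(v) = |det(u, σ₁ v̄)|² - |det(u, v)|²` (`energy_mul_energy`). For real `k`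
the second column `χ` of `φ₂` has `E(χ) = -1`, hence `|a|² - |b|² = E(φ)` for the first column `φ`
of `φ₁`, and comparing with `x → -∞` gives `E(φ) = 1` off the cut and `E(φ) = 0` on it. If `a(k) = 0`
with `Im k > 0`, then `φ` is proportional to `χ`, whose energy is negative near `+∞`, whereas `E(φ)`
increases strictly from `0` near `-∞`: a contradiction. If `a(k) = 0` for real `k`, then also
`b(k) = 0`, so `φ = 0`, contradicting its asymptotics (`aExt_ne_zero`).
-/

/-! ### Absolutely continuous functions on the line -/

noncomputable section

open Filter Topology

namespace NLSStep

variable {E : Type*} [NormedAddCommGroup E]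

/-- A function whose increments are dominated by those of an absolutely continuous function is
absolutely continuous. -/
theorem absolutelyContinuousOnInterval_of_dist_le {f : ℝ → E} {G : ℝ → ℝ} {C p q : ℝ}
    (hG : AbsolutelyContinuousOnInterval G p q)
    (h : ∀ x ∈ uIcc p q, ∀ y ∈ uIcc p q, dist (f x) (f y) ≤ C * dist (G x) (G y)) :
    AbsolutelyContinuousOnInterval f p q := by
  unfold AbsolutelyContinuousOnInterval at hG ⊢
  refine squeeze_zero' (.of_forall fun t ↦ Finset.sum_nonneg fun i _ ↦ dist_nonneg) ?_
    (by simpa using hG.const_mul C)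
  refine eventually_inf_principal.2 (.of_forall fun ⟨n, I⟩ hI ↦ ?_)
  rw [Finset.mul_sum]
  refine Finset.sum_le_sum fun i hi ↦ ?_
  simp only [AbsolutelyContinuousOnInterval.disjWithin, mem_ofPred_eq] at hI
  exact h _ (hI.1 i hi).1 _ (hI.1 i hi).2

variable [NormedSpace ℝ E]

/-- `f` is a primitive of the locally integrable function `f'`: the fundamental theorem of calculus
holds between any two points. This is absolute continuity with the a.e. derivative `f'`. -/
def IsPrimitiveOf (f f' : ℝ → E) : Prop :=
  (∀ p q, IntervalIntegrable f' volume p q) ∧ ∀ p q, f q - f p = ∫ x in p..q, f' x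

namespace IsPrimitiveOf

variable {f f' g g' : ℝ → E}

theorem continuous (hf : IsPrimitiveOf f f') : Continuous f := by
  have : f = fun x ↦ f 0 + ∫ y in (0 : ℝ)..x, f' y := by
    ext x; rw [← hf.2]; abel
  rw [this]
  exact continuous_const.add (intervalIntegral.continuous_primitive hf.1 0)

theorem absolutelyContinuousOnInterval (hf : IsPrimitiveOf f f') (p q : ℝ) :
    AbsolutelyContinuousOnInterval f p q := by
  refine absolutelyContinuousOnInterval_of_dist_le (C := 1)
    ((hf.1 p q).norm.absolutelyContinuousOnInterval_intervalIntegral (c := p) (by simp)) ?_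
  intro x _ y _
  rw [one_mul, dist_comm, dist_eq_norm, hf.2, dist_comm, Real.dist_eq,
    intervalIntegral.integral_interval_sub_left (hf.1 _ _).norm (hf.1 _ _).norm]
  exact intervalIntegral.norm_integral_le_abs_integral_norm

theorem congr_deriv (hf : IsPrimitiveOf f f') (h : ∀ x, f' x = g' x) : IsPrimitiveOf f g' :=
  (funext h : f' = g') ▸ hf

theorem congr_fun (hf : IsPrimitiveOf f f') (h : ∀ x, f x = g x) : IsPrimitiveOf g f' :=
  (funext h : f = g) ▸ hf

theorem neg_comp_neg (hf : IsPrimitiveOf f f') :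
    IsPrimitiveOf (fun x ↦ f (-x)) (fun x ↦ -f' (-x)) := by
  refine ⟨fun p q ↦ ?_, fun p q ↦ ?_⟩
  · have := (hf.1 (-p) (-q)).comp_sub_left 0
    simp only [zero_sub, sub_neg_eq_add, zero_add] at this
    exact this.neg
  · rw [intervalIntegral.integral_neg, intervalIntegral.integral_comp_neg, ← hf.2]; abel

theorem add (hf : IsPrimitiveOf f f') (hg : IsPrimitiveOf g g') :
    IsPrimitiveOf (fun x ↦ f x + g x) (fun x ↦ f' x + g' x) :=
  ⟨fun p q ↦ (hf.1 p q).add (hg.1 p q), fun p q ↦ by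
    rw [intervalIntegral.integral_add (hf.1 p q) (hg.1 p q), ← hf.2, ← hg.2,
      add_sub_add_comm]⟩

theorem sub (hf : IsPrimitiveOf f f') (hg : IsPrimitiveOf g g') :
    IsPrimitiveOf (fun x ↦ f x - g x) (fun x ↦ f' x - g' x) :=
  ⟨fun p q ↦ (hf.1 p q).sub (hg.1 p q), fun p q ↦ by
    rw [intervalIntegral.integral_sub (hf.1 p q) (hg.1 p q), ← hf.2, ← hg.2,
      sub_sub_sub_comm]⟩

variable [CompleteSpace E]

theorem ae_hasDerivAt (hf : IsPrimitiveOf f f') : ∀ᵐ x, HasDerivAt f (f' x) x := by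
  have : LocallyIntegrable f' volume :=
    locallyIntegrable_iff.2 fun k hk ↦ by
      obtain ⟨R, hR⟩ := hk.isBounded.subset_closedBall 0
      rw [Real.closedBall_eq_Icc] at hR
      rcases le_total (0 - R) (0 + R) with h | h
      · exact ((intervalIntegrable_iff_integrableOn_Icc_of_le h).1 (hf.1 _ _)).mono_set hR
      · have := ((intervalIntegrable_iff_integrableOn_Icc_of_le h).1 (hf.1 _ _))
        refine IntegrableOn.mono_set this (hR.trans fun x hx ↦ ⟨?_, ?_⟩) <;>
          linarith [hx.1, hx.2]
  filter_upwards [LocallyIntegrable.ae_hasDerivAt_integral this] with x hx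
  have h2 : f = fun x ↦ f 0 + ∫ y in (0 : ℝ)..x, f' y := by
    ext x; rw [← hf.2]; abel
  rw [h2]
  exact (hx 0).const_add _

/-- An absolutely continuous function is a primitive of its a.e. derivative. -/
theorem of_ae_hasDerivAt (hf : ∀ p q, AbsolutelyContinuousOnInterval f p q)
    (hi : ∀ p q, IntervalIntegrable f' volume p q) (hd : ∀ᵐ x, HasDerivAt f (f' x) x) :
    IsPrimitiveOf f f' := by
  refine ⟨hi, fun p q ↦ ?_⟩
  have hP : IsPrimitiveOf (fun x ↦ ∫ y in p..x, f' y) f' := ⟨hi, fun u v ↦ by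
    rw [intervalIntegral.integral_interval_sub_left (hi _ _) (hi _ _)]⟩
  -- the difference of `f` and the primitive of `f'` has vanishing derivative a.e.
  have hac := (hf p q).sub (hP.absolutelyContinuousOnInterval p q)
  obtain ⟨C, hC⟩ := hac.const_of_ae_hasDerivAt_zero (by
    filter_upwards [hd, hP.ae_hasDerivAt] with x h1 h2 _
    simpa using h1.sub h2)
  have h1 := hC p (by simp)
  have h2 := hC q (by simp)
  simp only [Pi.sub_apply, intervalIntegral.integral_same, sub_zero] at h1 h2
  rw [h1, ← h2]; abel

theorem of_hasDerivAt (hd : ∀ x, HasDerivAt f (f' x) x) (hc : Continuous f') :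
    IsPrimitiveOf f f' :=
  ⟨fun p q ↦ hc.intervalIntegrable p q, fun p q ↦
    (intervalIntegral.integral_eq_sub_of_hasDerivAt (fun x _ ↦ hd x)
      (hc.intervalIntegrable p q)).symm⟩

end IsPrimitiveOf

theorem IsPrimitiveOf.conj {f f' : ℝ → ℂ} (hf : IsPrimitiveOf f f') :
    IsPrimitiveOf (fun x ↦ conj (f x)) (fun x ↦ conj (f' x)) := by
  refine ⟨fun p q ↦ ?_, fun p q ↦ ?_⟩
  · have := hf.1 p q
    rw [intervalIntegrable_iff] at this ⊢
    exact Complex.conjCLE.toContinuousLinearMap.integrable_comp this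
  · rw [← map_sub, hf.2]
    exact (Complex.conjCLE.toContinuousLinearMap.intervalIntegral_comp_comm (hf.1 p q)).symm

/-- The product rule for absolutely continuous functions. -/
theorem IsPrimitiveOf.mul {f f' g g' : ℝ → ℂ} (hf : IsPrimitiveOf f f')
    (hg : IsPrimitiveOf g g') :
    IsPrimitiveOf (fun x ↦ f x * g x) (fun x ↦ f' x * g x + f x * g' x) := by
  refine .of_ae_hasDerivAt (fun p q ↦ ?_) (fun p q ↦ ?_) ?_
  · exact (hf.absolutelyContinuousOnInterval p q).smul (hg.absolutelyContinuousOnInterval p q)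
  · exact ((hf.1 p q).mul_continuousOn hg.continuous.continuousOn).add
      ((hg.1 p q).continuousOn_mul hf.continuous.continuousOn)
  · filter_upwards [hf.ae_hasDerivAt, hg.ae_hasDerivAt] with x h1 h2
    exact h1.mul h2

/-- A function that is integrated up from `-∞`. -/
theorem isPrimitiveOf_integral_Iic {f' : ℝ → E} (h : ∀ x, IntegrableOn f' (Iic x)) (c : E) :
    IsPrimitiveOf (fun x ↦ c + ∫ y in Iic x, f' y) f' :=
  ⟨fun p q ↦ intervalIntegrable_iff.2 ((h (max p q)).mono_set fun x hx ↦ hx.2),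
    fun p q ↦ by rw [← intervalIntegral.integral_Iic_sub_Iic (h p) (h q), add_sub_add_left_eq_sub]⟩

/-- The chain rule for the exponential of a real absolutely continuous function. -/
theorem IsPrimitiveOf.exp {f f' : ℝ → ℝ} (hf : IsPrimitiveOf f f') :
    IsPrimitiveOf (fun x ↦ Real.exp (f x)) (fun x ↦ Real.exp (f x) * f' x) := by
  refine .of_ae_hasDerivAt (fun p q ↦ ?_) (fun p q ↦ ?_) ?_
  · obtain ⟨M, hM⟩ := (isCompact_uIcc (a := p) (b := q)).bddAbove_image hf.continuous.continuousOn
    refine absolutelyContinuousOnInterval_of_dist_le (C := Real.exp M)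
      (hf.absolutelyContinuousOnInterval p q) fun x hx y hy ↦ ?_
    have := (convex_Iic M).norm_image_sub_le_of_norm_hasDerivWithin_le (f := Real.exp)
      (f' := Real.exp) (C := Real.exp M) (fun z _ ↦ (Real.hasDerivAt_exp z).hasDerivWithinAt)
      (fun z hz ↦ by simpa using hz) (hM (mem_image_of_mem f hy)) (hM (mem_image_of_mem f hx))
    simpa [dist_eq_norm] using this
  · exact (hf.1 p q).continuousOn_mul (Real.continuous_exp.comp hf.continuous).continuousOn
  · filter_upwards [hf.ae_hasDerivAt] with x hx
    exact hx.exp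

/-- If `H` is the primitive of an integrable `h ≥ 0` that vanishes at `-∞`, then the weights
`e^{-c(H(t) - H(s))}` make integration against `h` a contraction with constant `1/c`. -/
theorem integral_exp_weight_le {h : ℝ → ℝ} (h0 : ∀ s, 0 ≤ h s) (hi : Integrable h) {c : ℝ}
    (hc : 0 < c) (t : ℝ) :
    IntegrableOn (fun s ↦ Real.exp (-(c * ((∫ y in Iic t, h y) - ∫ y in Iic s, h y))) * h s)
      (Iic t) ∧
    ∫ s in Iic t, Real.exp (-(c * ((∫ y in Iic t, h y) - ∫ y in Iic s, h y))) * h s ≤ 1 / c := by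
  set H : ℝ → ℝ := fun s ↦ ∫ y in Iic s, h y with hH
  have hP : IsPrimitiveOf H h := by
    simpa using isPrimitiveOf_integral_Iic (fun x ↦ hi.integrableOn) (0 : ℝ)
  have hmono : Monotone H := fun x y hxy ↦
    setIntegral_mono_set hi.integrableOn (.of_forall h0) (Iic_subset_Iic.2 hxy).eventuallyLE
  -- the integrand is `1/c` times the derivative of the weight, which rises from a nonnegative
  -- value to `1`
  have hPe : IsPrimitiveOf (fun s ↦ Real.exp (-(c * (H t - H s))))
      (fun s ↦ Real.exp (-(c * (H t - H s))) * (c * h s)) := by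
    refine IsPrimitiveOf.exp (f' := fun s ↦ c * h s) 
      ⟨fun p q ↦ (hP.1 p q).const_mul c, fun p q ↦ ?_⟩
    rw [intervalIntegral.integral_const_mul, ← hP.2]; ring
  have hint : IntegrableOn (fun s ↦ Real.exp (-(c * (H t - H s))) * h s) (Iic t) := by
    refine Integrable.mono' hi.integrableOn
      ((hPe.continuous.aestronglyMeasurable).mul hi.1.restrict) ?_
    refine (ae_restrict_iff' measurableSet_Iic).2 (.of_forall fun s hs ↦ ?_)
    rw [norm_mul, Real.norm_of_nonneg (Real.exp_pos _).le, Real.norm_of_nonneg (h0 s)]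
    refine mul_le_of_le_one_left (h0 s) (Real.exp_le_one_iff.2 ?_)
    have := hmono (mem_Iic.1 hs)
    nlinarith
  refine ⟨hint, ?_⟩
  refine le_of_tendsto (intervalIntegral_tendsto_integral_Iic t hint tendsto_id)
    (.of_forall fun p ↦ ?_)
  have h1 := hPe.2 p t
  have h2 : ∫ s in p..t, Real.exp (-(c * (H t - H s))) * (c * h s) =
      c * ∫ s in p..t, Real.exp (-(c * (H t - H s))) * h s := by
    rw [← intervalIntegral.integral_const_mul]; congr 1; ext s; ring
  rw [h2] at h1
  simp only [sub_self, mul_zero, neg_zero, Real.exp_zero, id] at h1 ⊢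
  rw [le_div_iff₀ hc, mul_comm, ← h1]
  linarith [Real.exp_pos (-(c * (H t - H p)))]

end NLSStep

end

/-! ### Weighted Volterra operators -/

noncomputable section

open Filter Topology BoundedContinuousFunction

namespace NLSStep

/-- Continuous convolution kernels `a(τ)`, `τ ≥ 0`, of polynomial growth of order `N`. -/
def PolyBounded (N : ℕ) (a : ℝ → ℂ) : Prop :=
  Continuous a ∧ ∃ C, ∀ τ, 0 ≤ τ → ‖a τ‖ ≤ C * (1 + τ) ^ N

theorem PolyBounded.sub {N : ℕ} {f g : ℝ → ℂ} (hf : PolyBounded N f) (hg : PolyBounded N g) :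
    PolyBounded N (fun τ ↦ f τ - g τ) := by
  obtain ⟨C, hC⟩ := hf.2
  obtain ⟨D, hD⟩ := hg.2
  exact ⟨hf.1.sub hg.1, C + D, fun τ hτ ↦ (norm_sub_le _ _).trans
    (by rw [add_mul]; exact add_le_add (hC τ hτ) (hD τ hτ))⟩

theorem PolyBounded.const_mul {N : ℕ} {f : ℝ → ℂ} (hf : PolyBounded N f) (c : ℂ) :
    PolyBounded N (fun τ ↦ c * f τ) := by
  obtain ⟨C, hC⟩ := hf.2
  exact ⟨continuous_const.mul hf.1, ‖c‖ * C, fun τ hτ ↦ by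
    rw [norm_mul, mul_assoc]; exact mul_le_mul_of_nonneg_left (hC τ hτ) (norm_nonneg c)⟩

theorem polyBounded_of_norm_le_one {N : ℕ} {f : ℝ → ℂ} (hf : Continuous f)
    (h : ∀ τ, 0 ≤ τ → ‖f τ‖ ≤ 1) : PolyBounded N f :=
  ⟨hf, 1, fun τ hτ ↦ (h τ hτ).trans (by rw [one_mul]; exact one_le_pow₀ (by linarith))⟩

variable {F : Type*} [NormedAddCommGroup F] [NormedSpace ℂ F]

/-- The data of a Volterra problem on `(-∞, X]`: an integrable operator-valued potential `V` with
`N` moments, and the strength `lam` of the exponential weight that makes the problem contractive. -/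
structure VolterraData (F : Type*) [NormedAddCommGroup F] [NormedSpace ℂ F] where
  /-- The potential. -/
  V : ℝ → F →L[ℂ] F
  /-- The right end point. -/
  X : ℝ
  /-- The number of moments of the potential. -/
  N : ℕ
  /-- The strength of the weight. -/
  lam : ℝ
  lam_pos : 0 < lam
  integrable : Integrable V
  moment : IntegrableOn (fun s ↦ (1 + (X - s)) ^ N * ‖V s‖) (Iic X)

namespace VolterraData

variable (D : VolterraData F)

/-- The mass `∫_{-∞}^t ‖V‖`. -/
def mass (t : ℝ) : ℝ := ∫ s in Iic t, ‖D.V s‖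

/-- The exponential weight `e^{-lam (mass t - mass s)}`. -/
def weight (t s : ℝ) : ℝ := Real.exp (-(D.lam * (D.mass t - D.mass s)))

theorem mass_mono : Monotone D.mass := fun _ _ hxy ↦
  setIntegral_mono_set D.integrable.norm.integrableOn (.of_forall fun _ ↦ norm_nonneg _)
    (Iic_subset_Iic.2 hxy).eventuallyLE

theorem continuous_mass : Continuous D.mass := by
  have := (isPrimitiveOf_integral_Iic (f' := fun s ↦ ‖D.V s‖)
    (fun x ↦ D.integrable.norm.integrableOn) (0 : ℝ)).continuous
  simpa only [zero_add] using! this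

theorem weight_pos (t s : ℝ) : 0 < D.weight t s := Real.exp_pos _

theorem weight_le_one {t s : ℝ} (h : s ≤ t) : D.weight t s ≤ 1 := by
  refine Real.exp_le_one_iff.2 ?_
  have := D.mass_mono h
  nlinarith [D.lam_pos]

theorem continuous_weight : Continuous fun p : ℝ × ℝ ↦ D.weight p.1 p.2 := by
  have := D.continuous_mass
  unfold weight
  fun_prop

/-- The integrand of the weighted Volterra operator with convolution kernel `a`. -/
def integrand (a : ℝ → ℂ) (g : ℝ → F) (t s : ℝ) : F :=
  ((D.weight t s : ℂ) * a (t - s)) • D.V s (g s)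

variable {D}

theorem norm_integrand_le {a : ℝ → ℂ} (g : ℝ →ᵇ F) (t s : ℝ) :
    ‖D.integrand a g t s‖ ≤ D.weight t s * ‖a (t - s)‖ * ‖D.V s‖ * ‖g‖ := by
  rw [integrand, norm_smul, norm_mul, Complex.norm_real, Real.norm_of_nonneg (D.weight_pos t s).le,
    mul_assoc _ ‖D.V s‖]
  gcongr
  · exact mul_nonneg (D.weight_pos t s).le (norm_nonneg _)
  · exact (D.V s).le_opNorm_of_le (g.norm_coe_le_norm s)

/-- A nondecreasing majorant `m` of the kernel bounds `a(t - s)` by `m(X - s)`, uniformly in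
`t ≤ X`. -/
theorem norm_integrand_le_of_le {a : ℝ → ℂ} {m : ℝ → ℝ}
    (hm : ∀ τ σ, 0 ≤ τ → τ ≤ σ → m τ ≤ m σ) (ha : ∀ τ, 0 ≤ τ → ‖a τ‖ ≤ m τ) (g : ℝ →ᵇ F)
    {t s : ℝ} (hs : s ≤ t) (ht : t ≤ D.X) :
    ‖D.integrand a g t s‖ ≤ m (D.X - s) * ‖D.V s‖ * ‖g‖ := by
  refine (norm_integrand_le g t s).trans ?_
  have h1 : ‖a (t - s)‖ ≤ m (D.X - s) :=
    (ha _ (by linarith)).trans (hm _ _ (by linarith) (by linarith))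
  gcongr
  calc D.weight t s * ‖a (t - s)‖ ≤ 1 * ‖a (t - s)‖ := by gcongr; exact D.weight_le_one hs
    _ ≤ _ := by rwa [one_mul]

theorem aestronglyMeasurable_integrand {a : ℝ → ℂ} (ha : Continuous a) {g : ℝ → F}
    (hg : Continuous g) (t : ℝ) {μ : Measure ℝ} (hμ : μ ≤ volume) :
    AEStronglyMeasurable (D.integrand a g t) μ := by
  have h1 : Continuous fun s ↦ ((D.weight t s : ℂ) * a (t - s)) := by
    have : Continuous fun s ↦ D.weight t s :=
      D.continuous_weight.comp (by fun_prop : Continuous fun s ↦ (t, s))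
    fun_prop
  have h2 : AEStronglyMeasurable (fun s ↦ D.V s (g s)) μ :=
    (ContinuousLinearMap.id ℂ (F →L[ℂ] F)).aestronglyMeasurable_comp₂
      (D.integrable.1.mono_measure hμ) hg.aestronglyMeasurable
  exact h1.aestronglyMeasurable.smul h2

theorem polyMajorant_mono {N : ℕ} {C : ℝ} (hC : 0 ≤ C) (τ σ : ℝ) (h0 : 0 ≤ τ) (h : τ ≤ σ) :
    C * (1 + τ) ^ N ≤ C * (1 + σ) ^ N := by gcongr

theorem exists_majorant {N : ℕ} {a : ℝ → ℂ} (ha : PolyBounded N a) :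
    ∃ C, 0 ≤ C ∧ ∀ τ, 0 ≤ τ → ‖a τ‖ ≤ C * (1 + τ) ^ N := by
  obtain ⟨C, hC⟩ := ha.2
  refine ⟨C, ?_, hC⟩
  have := (norm_nonneg _).trans (hC 0 le_rfl)
  simpa using this

theorem integrableOn_integrand {a : ℝ → ℂ} (ha : PolyBounded D.N a) (g : ℝ →ᵇ F) {t : ℝ}
    (ht : t ≤ D.X) : IntegrableOn (D.integrand a g t) (Iic t) := by
  obtain ⟨C, hC0, hC⟩ := exists_majorant ha
  refine Integrable.mono' (g := fun s ↦ C * ((1 + (D.X - s)) ^ D.N * ‖D.V s‖) * ‖g‖)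
    (((D.moment.mono_set (Iic_subset_Iic.2 ht)).const_mul C).mul_const _)
    (aestronglyMeasurable_integrand ha.1 g.continuous t Measure.restrict_le_self) ?_
  refine (ae_restrict_iff' measurableSet_Iic).2 (.of_forall fun s hs ↦ ?_)
  have := norm_integrand_le_of_le (polyMajorant_mono hC0) hC g (mem_Iic.1 hs) ht
  rwa [mul_assoc C] at this

/-- The integral in the Volterra operator depends continuously on its upper end point `t`, which
is stopped at `X`. -/
theorem continuous_setIntegral_integrand {a : ℝ → ℂ} (ha : PolyBounded D.N a) (g : ℝ →ᵇ F) :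
    Continuous fun t ↦ ∫ s in Iic (min t D.X), D.integrand a g (min t D.X) s := by
  obtain ⟨C, hC0, hC⟩ := exists_majorant ha
  refine continuous_iff_continuousAt.2 fun t₀ ↦ ?_
  simp_rw [← integral_indicator measurableSet_Iic]
  refine continuousAt_of_dominated
    (bound := (Iic D.X).indicator fun s ↦ C * ((1 + (D.X - s)) ^ D.N * ‖D.V s‖) * ‖g‖)
    (.of_forall fun t ↦ ?_) (.of_forall fun t ↦ .of_forall fun s ↦ ?_) ?_ ?_
  · exact (aestronglyMeasurable_integrand ha.1 g.continuous _ le_rfl).indicator measurableSet_Iic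
  · by_cases hs : s ≤ min t D.X
    · rw [indicator_of_mem (mem_Iic.2 hs),
        indicator_of_mem (mem_Iic.2 (hs.trans (min_le_right _ _)))]
      have := norm_integrand_le_of_le (polyMajorant_mono hC0) hC g hs (min_le_right _ _)
      rwa [mul_assoc C] at this
    · rw [indicator_of_notMem (by simpa using hs), norm_zero]
      refine indicator_nonneg (fun s hs ↦ ?_) s
      have : 0 ≤ D.X - s := sub_nonneg.2 hs
      positivity
  · exact IntegrableOn.integrable_indicator ((D.moment.const_mul C).mul_const _) measurableSet_Iic
  -- for `s` other than the end point, `s` stays on one side of it when `t` varies a little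
  · have : ∀ᵐ s : ℝ, s ≠ min t₀ D.X := by simp [ae_iff, measure_singleton]
    filter_upwards [this] with s hs
    have hm : Continuous fun t : ℝ ↦ min t D.X := by fun_prop
    rcases lt_or_gt_of_ne hs with h | h
    · have h1 : Continuous fun t ↦ D.integrand a g (min t D.X) s := by
        have h2 : Continuous fun t ↦ D.weight (min t D.X) s :=
          D.continuous_weight.comp (by fun_prop : Continuous fun t : ℝ ↦ (min t D.X, s))
        have := ha.1
        unfold integrand
        fun_prop
      refine h1.continuousAt.congr ?_
      filter_upwards [hm.continuousAt.eventually_const_lt h] with t ht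
      rw [indicator_of_mem (mem_Iic.2 ht.le)]
    · refine (continuousAt_const (y := (0 : F))).congr ?_
      filter_upwards [hm.continuousAt.eventually_lt_const h] with t ht
      exact (indicator_of_notMem (fun h' ↦ not_le.2 ht (mem_Iic.1 h')) _).symm

theorem norm_setIntegral_integrand_le {a : ℝ → ℂ} {m : ℝ → ℝ}
    (hm : ∀ τ σ, 0 ≤ τ → τ ≤ σ → m τ ≤ m σ) (ha : ∀ τ, 0 ≤ τ → ‖a τ‖ ≤ m τ)
    (hi : IntegrableOn (fun s ↦ m (D.X - s) * ‖D.V s‖) (Iic D.X)) (g : ℝ →ᵇ F)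
    {t : ℝ} (ht : t ≤ D.X) :
    ‖∫ s in Iic t, D.integrand a g t s‖ ≤ (∫ s in Iic D.X, m (D.X - s) * ‖D.V s‖) * ‖g‖ := by
  rw [← integral_mul_const]
  have hm0 : ∀ τ, 0 ≤ τ → 0 ≤ m τ := fun τ h ↦ (norm_nonneg _).trans (ha τ h)
  refine (norm_integral_le_of_norm_le
    ((hi.mono_set (Iic_subset_Iic.2 ht)).mul_const ‖g‖) ?_).trans ?_
  · exact (ae_restrict_iff' measurableSet_Iic).2 (.of_forall fun s hs ↦
      norm_integrand_le_of_le hm ha g (mem_Iic.1 hs) ht)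
  · refine setIntegral_mono_set (hi.mul_const _) ?_ (Iic_subset_Iic.2 ht).eventuallyLE
    refine (ae_restrict_iff' measurableSet_Iic).2 (.of_forall fun s hs ↦ ?_)
    have := hm0 (D.X - s) (sub_nonneg.2 hs)
    simp only [Pi.zero_apply]
    positivity

theorem exists_norm_setIntegral_integrand_le {a : ℝ → ℂ} (ha : PolyBounded D.N a) :
    ∃ M, 0 ≤ M ∧ ∀ (g : ℝ →ᵇ F) (t : ℝ),
      ‖∫ s in Iic (min t D.X), D.integrand a g (min t D.X) s‖ ≤ M * ‖g‖ := by
  obtain ⟨C, hC0, hC⟩ := exists_majorant ha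
  refine ⟨∫ s in Iic D.X, C * (1 + (D.X - s)) ^ D.N * ‖D.V s‖, ?_, fun g t ↦ ?_⟩
  · refine setIntegral_nonneg measurableSet_Iic fun s hs ↦ ?_
    have h2 : 0 ≤ D.X - s := sub_nonneg.2 hs
    positivity
  · exact norm_setIntegral_integrand_le (polyMajorant_mono hC0) hC
      (by simpa only [mul_assoc] using! D.moment.const_mul C) g (min_le_right _ _)

variable (D) in
open Classical in
/-- The weighted Volterra operator
`g ↦ (t ↦ ∫_{-∞}^t e^{-lam (mass t - mass s)} a(t - s) V(s) g(s) ds)` on bounded continuous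
functions, where `t` is stopped at the end point `X`. Kernels that are not continuous and of
polynomial growth get the operator `0`. -/
def op (a : ℝ → ℂ) : (ℝ →ᵇ F) →L[ℂ] (ℝ →ᵇ F) :=
  if ha : PolyBounded D.N a then
    LinearMap.mkContinuousOfExistsBound
      { toFun := fun g ↦ BoundedContinuousFunction.ofNormedAddCommGroup
          (fun t ↦ ∫ s in Iic (min t D.X), D.integrand a g (min t D.X) s)
          (continuous_setIntegral_integrand ha g)
          ((exists_norm_setIntegral_integrand_le ha).choose * ‖g‖)
          ((exists_norm_setIntegral_integrand_le ha).choose_spec.2 g)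
        map_add' := fun f g ↦ by
          ext t
          simp only [coe_ofNormedAddCommGroup, coe_add, Pi.add_apply]
          rw [← integral_add (integrableOn_integrand ha f (min_le_right _ _))
            (integrableOn_integrand ha g (min_le_right _ _))]
          simp [integrand]
        map_smul' := fun c g ↦ by
          ext t
          simp only [coe_ofNormedAddCommGroup, BoundedContinuousFunction.smul_apply,
            RingHom.id_apply]
          rw [← integral_smul]
          congr 1
          ext s
          simp only [integrand, map_smul, BoundedContinuousFunction.smul_apply]
          rw [smul_comm] }
      ⟨_, fun g ↦ BoundedContinuousFunction.norm_ofNormedAddCommGroup_le _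
        (mul_nonneg (exists_norm_setIntegral_integrand_le ha).choose_spec.1 (norm_nonneg g))
        ((exists_norm_setIntegral_integrand_le ha).choose_spec.2 g)⟩
  else 0

theorem op_apply {a : ℝ → ℂ} (ha : PolyBounded D.N a) (g : ℝ →ᵇ F) (t : ℝ) :
    D.op a g t = ∫ s in Iic (min t D.X), D.integrand a g (min t D.X) s := by
  rw [op, dif_pos ha]; rfl

theorem op_sub {f g : ℝ → ℂ} (hf : PolyBounded D.N f) (hg : PolyBounded D.N g) :
    D.op f - D.op g = D.op (fun τ ↦ f τ - g τ) := by
  ext u t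
  rw [_root_.sub_apply, coe_sub, Pi.sub_apply, op_apply hf, op_apply hg,
    op_apply (hf.sub hg), ← integral_sub (integrableOn_integrand hf u (min_le_right _ _))
      (integrableOn_integrand hg u (min_le_right _ _))]
  congr 1
  ext s
  simp only [integrand]
  rw [mul_sub, sub_smul]

theorem op_const_mul {f : ℝ → ℂ} (hf : PolyBounded D.N f) (c : ℂ) :
    c • D.op f = D.op (fun τ ↦ c * f τ) := by
  ext u t
  rw [_root_.smul_apply, BoundedContinuousFunction.smul_apply, op_apply hf,
    op_apply (hf.const_mul c),
    ← integral_smul]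
  congr 1
  ext s
  simp only [integrand]
  rw [smul_smul]
  congr 1
  ring

/-- The norm of a Volterra operator is at most the integral of a nondecreasing majorant of its
kernel against `‖V‖`. -/
theorem norm_op_le {a : ℝ → ℂ} (h : PolyBounded D.N a) {m : ℝ → ℝ}
    (hm : ∀ τ σ, 0 ≤ τ → τ ≤ σ → m τ ≤ m σ) (ha : ∀ τ, 0 ≤ τ → ‖a τ‖ ≤ m τ)
    (hi : IntegrableOn (fun s ↦ m (D.X - s) * ‖D.V s‖) (Iic D.X)) :
    ‖D.op a‖ ≤ ∫ s in Iic D.X, m (D.X - s) * ‖D.V s‖ := by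
  have h0 : 0 ≤ ∫ s in Iic D.X, m (D.X - s) * ‖D.V s‖ :=
    setIntegral_nonneg measurableSet_Iic fun s hs ↦ mul_nonneg
      ((norm_nonneg _).trans (ha _ (sub_nonneg.2 hs))) (norm_nonneg _)
  refine ContinuousLinearMap.opNorm_le_bound _ h0 fun g ↦ ?_
  refine (BoundedContinuousFunction.norm_le (mul_nonneg h0 (norm_nonneg g))).2 fun t ↦ ?_
  rw [op_apply h]
  exact norm_setIntegral_integrand_le hm ha hi g (min_le_right _ _)

/-- Thanks to the weight, a Volterra operator with a bounded kernel has a small norm. -/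
theorem norm_op_le_inv {a : ℝ → ℂ} (hc : Continuous a) (ha : ∀ τ, 0 ≤ τ → ‖a τ‖ ≤ 1) :
    ‖D.op a‖ ≤ 1 / D.lam := by
  have hl : 0 ≤ 1 / D.lam := one_div_nonneg.2 D.lam_pos.le
  refine ContinuousLinearMap.opNorm_le_bound _ hl fun g ↦ ?_
  refine (BoundedContinuousFunction.norm_le (mul_nonneg hl (norm_nonneg g))).2 fun t ↦ ?_
  rw [op_apply (polyBounded_of_norm_le_one hc ha)]
  obtain ⟨h1, h2⟩ := integral_exp_weight_le (h := fun s ↦ ‖D.V s‖) (fun s ↦ norm_nonneg _)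
    D.integrable.norm D.lam_pos (min t D.X)
  refine (norm_integral_le_of_norm_le (h1.mul_const ‖g‖) ?_).trans ?_
  · refine (ae_restrict_iff' measurableSet_Iic).2 (.of_forall fun s hs ↦ ?_)
    refine (norm_integrand_le g _ s).trans ?_
    have h3 := ha (min t D.X - s) (sub_nonneg.2 hs)
    have h4 : D.weight (min t D.X) s * ‖a (min t D.X - s)‖ ≤ D.weight (min t D.X) s :=
      mul_le_of_le_one_right (D.weight_pos _ _).le h3
    gcongr
    exact h4
  · rw [integral_mul_const]
    gcongr

end VolterraData

end NLSStep

end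

/-! ### Smooth dependence of Volterra operators on the spectral parameter -/

noncomputable section

open Filter Topology BoundedContinuousFunction

namespace NLSStep

/-- The kernel `(2iτ)^n e^{2iζτ}`, the `n`-th `ζ`-derivative of `e^{2iζτ}`. -/
def expKer (n : ℕ) (ζ : ℂ) (τ : ℝ) : ℂ :=
  (2 * Complex.I * τ) ^ n * Complex.exp (2 * Complex.I * ζ * τ)

theorem continuous_expKer (n : ℕ) (ζ : ℂ) : Continuous (expKer n ζ) := by
  unfold expKer; fun_prop

theorem norm_expKer_le (n : ℕ) {ζ : ℂ} (hζ : 0 ≤ ζ.im) {τ : ℝ} (hτ : 0 ≤ τ) :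
    ‖expKer n ζ τ‖ ≤ (2 * τ) ^ n := by
  have h1 : ‖Complex.exp (2 * Complex.I * ζ * τ)‖ ≤ 1 := by
    rw [Complex.norm_exp]
    refine Real.exp_le_one_iff.2 ?_
    have : (2 * Complex.I * ζ * τ).re = -(2 * (ζ.im * τ)) := by simp; ring
    rw [this]
    have := mul_nonneg hζ hτ
    linarith
  rw [expKer, norm_mul, norm_pow]
  have h2 : ‖2 * Complex.I * (τ : ℂ)‖ = 2 * τ := by simp [abs_of_nonneg hτ]
  rw [h2]
  exact mul_le_of_le_one_right (by positivity) h1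

theorem norm_expKer_zero_le {ζ : ℂ} (hζ : 0 ≤ ζ.im) (τ : ℝ) (hτ : 0 ≤ τ) :
    ‖expKer 0 ζ τ‖ ≤ 1 := by
  simpa using norm_expKer_le 0 hζ hτ

theorem two_mul_pow_le {n N : ℕ} (h : n ≤ N) {τ : ℝ} (hτ : 0 ≤ τ) :
    (2 * τ) ^ n ≤ 2 ^ n * (1 + τ) ^ N := by
  rw [mul_pow]
  gcongr
  calc τ ^ n ≤ (1 + τ) ^ n := by gcongr; linarith
    _ ≤ (1 + τ) ^ N := pow_le_pow_right₀ (by linarith) h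

theorem polyBounded_expKer {n N : ℕ} (h : n ≤ N) {ζ : ℂ} (hζ : 0 ≤ ζ.im) :
    PolyBounded N (expKer n ζ) :=
  ⟨continuous_expKer n ζ, 2 ^ n, fun _ hτ ↦ (norm_expKer_le n hζ hτ).trans (two_mul_pow_le h hτ)⟩

/-- The factor `min 2 (2τ|ξ - ζ|)` tends to `0` as `ξ → ζ` while staying bounded, so dominated
convergence applies to it without a further moment. -/
theorem norm_expKer_sub_le (n : ℕ) {ζ ξ : ℂ} (hζ : 0 ≤ ζ.im) (hξ : 0 ≤ ξ.im) {τ : ℝ}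
    (hτ : 0 ≤ τ) :
    ‖expKer n ξ τ - expKer n ζ τ‖ ≤ (2 * τ) ^ n * min 2 (2 * τ * ‖ξ - ζ‖) := by
  have h0 : ‖expKer 0 ξ τ - expKer 0 ζ τ‖ ≤ 2 * τ * ‖ξ - ζ‖ := by
    refine (convex_halfSpace_im_ge (0 : ℝ)).norm_image_sub_le_of_norm_hasDerivWithin_le
      (f := fun z ↦ expKer 0 z τ) (f' := fun z ↦ expKer 1 z τ) (fun z hz ↦ ?_) (fun z hz ↦ ?_)
      hζ hξ
    · have := ((((hasDerivAt_id z).const_mul (2 * Complex.I)).mul_const (τ : ℂ)).cexp)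
      simp only [id, expKer, pow_zero, one_mul, pow_one] at this ⊢
      convert this.hasDerivWithinAt using 1
      ring
    · simpa using norm_expKer_le 1 hz hτ
  have h1 : ‖expKer 0 ξ τ - expKer 0 ζ τ‖ ≤ 2 := by
    refine (norm_sub_le _ _).trans ?_
    linarith [norm_expKer_zero_le hξ τ hτ, norm_expKer_zero_le hζ τ hτ]
  have h2 : expKer n ξ τ - expKer n ζ τ =
      (2 * Complex.I * τ) ^ n * (expKer 0 ξ τ - expKer 0 ζ τ) := by
    simp only [expKer]; ring
  have h3 : ‖2 * Complex.I * (τ : ℂ)‖ = 2 * τ := by simp [abs_of_nonneg hτ]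
  rw [h2, norm_mul, norm_pow, h3]
  gcongr
  exact le_min h1 h0

/-- First order Taylor estimate for the exponential kernels. The remainder grows in `τ` by one
order only, as the derivative does. -/
theorem norm_expKer_taylor_le (n : ℕ) {ζ ξ : ℂ} (hζ : 0 ≤ ζ.im) (hξ : 0 ≤ ξ.im) {τ : ℝ}
    (hτ : 0 ≤ τ) :
    ‖expKer n ξ τ - expKer n ζ τ - (ξ - ζ) * expKer (n + 1) ζ τ‖ ≤
      (2 * τ) ^ (n + 1) * min 2 (2 * τ * ‖ξ - ζ‖) * ‖ξ - ζ‖ := by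
  have hd : ∀ z, HasDerivAt (fun z ↦ expKer n z τ - (z - ζ) * expKer (n + 1) ζ τ)
      (expKer (n + 1) z τ - expKer (n + 1) ζ τ) z := fun z ↦ by
    have h1 := (((((hasDerivAt_id z).const_mul (2 * Complex.I)).mul_const (τ : ℂ)).cexp).const_mul
      ((2 * Complex.I * τ) ^ n)).sub
      (((hasDerivAt_id z).sub_const ζ).mul_const (expKer (n + 1) ζ τ))
    simp only [id, expKer] at h1 ⊢
    refine h1.congr_deriv ?_
    ring
  have hconv := (convex_halfSpace_im_ge (0 : ℝ)).inter (convex_closedBall ζ ‖ξ - ζ‖)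
  have h0 := hconv.norm_image_sub_le_of_norm_hasDerivWithin_le
      (C := (2 * τ) ^ (n + 1) * min 2 (2 * τ * ‖ξ - ζ‖))
      (fun z hz ↦ (hd z).hasDerivWithinAt) (fun z hz ↦ ?_)
      (x := ζ) (y := ξ) ⟨hζ, by simp⟩ ⟨hξ, by simp [dist_eq_norm]⟩
  · simpa [sub_right_comm] using h0
  · refine (norm_expKer_sub_le (n + 1) hζ hz.1 hτ).trans ?_
    have := hz.2
    rw [mem_closedBall_iff_norm] at this
    gcongr

variable {F : Type*} [NormedAddCommGroup F] [NormedSpace ℂ F]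

namespace VolterraData

variable {D : VolterraData F}

theorem integrableOn_moment_min {n : ℕ} (h : n ≤ D.N) {δ : ℝ} (hδ : 0 ≤ δ) :
    IntegrableOn (fun s ↦ (2 * (D.X - s)) ^ n * min 2 (2 * (D.X - s) * δ) * ‖D.V s‖)
      (Iic D.X) := by
  refine Integrable.mono' (D.moment.const_mul (2 ^ n * 2)) ?_ ?_
  · refine AEStronglyMeasurable.mul ?_ D.integrable.1.norm.restrict
    exact Continuous.aestronglyMeasurable (by fun_prop)
  · refine (ae_restrict_iff' measurableSet_Iic).2 (.of_forall fun s hs ↦ ?_)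
    have h1 : 0 ≤ D.X - s := sub_nonneg.2 hs
    have h2 := two_mul_pow_le h h1
    have h3 : 0 ≤ min 2 (2 * (D.X - s) * δ) := le_min (by norm_num) (by positivity)
    rw [Real.norm_of_nonneg (by positivity)]
    calc (2 * (D.X - s)) ^ n * min 2 (2 * (D.X - s) * δ) * ‖D.V s‖
        ≤ (2 ^ n * (1 + (D.X - s)) ^ D.N) * 2 * ‖D.V s‖ := by gcongr; exact min_le_left _ _
      _ = _ := by ring

variable (D) in
/-- The moduli of continuity of the operators with kernels `(2iτ)^n e^{2iζτ}`. -/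
def modulus (n : ℕ) (δ : ℝ) : ℝ :=
  ∫ s in Iic D.X, (2 * (D.X - s)) ^ n * min 2 (2 * (D.X - s) * δ) * ‖D.V s‖

theorem tendsto_modulus {n : ℕ} (h : n ≤ D.N) {ζ : ℂ} {U : Set ℂ} :
    Tendsto (fun ξ ↦ D.modulus n ‖ξ - ζ‖) (𝓝[U] ζ) (𝓝 0) := by
  have h0 : ∫ s in Iic D.X, (0 : ℝ) = 0 := by simp
  rw [← h0]
  unfold modulus
  refine tendsto_integral_filter_of_dominated_convergence
    (fun s ↦ 2 ^ n * 2 * ((1 + (D.X - s)) ^ D.N * ‖D.V s‖)) ?_ ?_ (D.moment.const_mul _) ?_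
  · exact .of_forall fun ξ ↦ (integrableOn_moment_min h (norm_nonneg (ξ - ζ))).1
  · refine .of_forall fun ξ ↦ (ae_restrict_iff' measurableSet_Iic).2 (.of_forall fun s hs ↦ ?_)
    have h1 : 0 ≤ D.X - s := sub_nonneg.2 hs
    have h2 := two_mul_pow_le h h1
    have h3 : 0 ≤ min 2 (2 * (D.X - s) * ‖ξ - ζ‖) := le_min (by norm_num) (by positivity)
    rw [Real.norm_of_nonneg (by positivity)]
    calc (2 * (D.X - s)) ^ n * min 2 (2 * (D.X - s) * ‖ξ - ζ‖) * ‖D.V s‖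
        ≤ (2 ^ n * (1 + (D.X - s)) ^ D.N) * 2 * ‖D.V s‖ := by gcongr; exact min_le_left _ _
      _ = _ := by ring
  · refine .of_forall fun s ↦ ?_
    have hc : Continuous fun ξ : ℂ ↦
        (2 * (D.X - s)) ^ n * min 2 (2 * (D.X - s) * ‖ξ - ζ‖) * ‖D.V s‖ := by fun_prop
    have h1 := (hc.tendsto ζ).mono_left (nhdsWithin_le_nhds (s := U))
    simpa using h1

theorem norm_op_expKer_taylor_le {n : ℕ} (h : n + 1 ≤ D.N) {ζ ξ : ℂ} (hζ : 0 ≤ ζ.im)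
    (hξ : 0 ≤ ξ.im) :
    ‖D.op (expKer n ξ) - D.op (expKer n ζ) - (ξ - ζ) • D.op (expKer (n + 1) ζ)‖ ≤
      D.modulus (n + 1) ‖ξ - ζ‖ * ‖ξ - ζ‖ := by
  have hb1 := polyBounded_expKer (n.le_succ.trans h) hξ
  have hb2 := polyBounded_expKer (n.le_succ.trans h) hζ
  have hb3 := polyBounded_expKer h hζ
  rw [op_sub hb1 hb2, op_const_mul hb3, op_sub (hb1.sub hb2) (hb3.const_mul _), modulus,
    ← integral_mul_const]
  have hi := (integrableOn_moment_min h (norm_nonneg (ξ - ζ))).mul_const ‖ξ - ζ‖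
  refine (norm_op_le ((hb1.sub hb2).sub (hb3.const_mul _))
    (m := fun τ ↦ (2 * τ) ^ (n + 1) * min 2 (2 * τ * ‖ξ - ζ‖) * ‖ξ - ζ‖) (fun τ σ h0 h1 ↦ ?_)
    (fun τ hτ ↦ norm_expKer_taylor_le n hζ hξ hτ) ?_).trans_eq ?_
  · have := h0.trans h1
    have : 0 ≤ min 2 (2 * τ * ‖ξ - ζ‖) := le_min (by norm_num) (by positivity)
    gcongr
  · simpa only [mul_right_comm _ ‖ξ - ζ‖] using! hi
  · simp only [mul_right_comm _ ‖ξ - ζ‖]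

theorem norm_op_expKer_sub_le {n : ℕ} (h : n ≤ D.N) {ζ ξ : ℂ} (hζ : 0 ≤ ζ.im)
    (hξ : 0 ≤ ξ.im) :
    ‖D.op (expKer n ξ) - D.op (expKer n ζ)‖ ≤ D.modulus n ‖ξ - ζ‖ := by
  have hb1 := polyBounded_expKer h hξ
  have hb2 := polyBounded_expKer h hζ
  rw [op_sub hb1 hb2]
  refine norm_op_le (hb1.sub hb2) (m := fun τ ↦ (2 * τ) ^ n * min 2 (2 * τ * ‖ξ - ζ‖))
    (fun τ σ h0 h1 ↦ ?_) (fun τ hτ ↦ norm_expKer_sub_le n hζ hξ hτ)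
    (integrableOn_moment_min h (norm_nonneg _))
  have := h0.trans h1
  have : 0 ≤ min 2 (2 * τ * ‖ξ - ζ‖) := le_min (by norm_num) (by positivity)
  gcongr

theorem continuousOn_op_expKer {n : ℕ} (h : n ≤ D.N) :
    ContinuousOn (fun ζ ↦ D.op (expKer n ζ)) {z : ℂ | 0 ≤ z.im} := by
  intro ζ hζ
  refine tendsto_iff_norm_sub_tendsto_zero.2 (squeeze_zero' (.of_forall fun _ ↦ norm_nonneg _) ?_
    (tendsto_modulus h))
  filter_upwards [self_mem_nhdsWithin] with ξ hξ
  exact norm_op_expKer_sub_le h hζ hξ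

theorem hasDerivWithinAt_op_expKer {n : ℕ} (h : n + 1 ≤ D.N) {ζ : ℂ} (hζ : 0 ≤ ζ.im) :
    HasDerivWithinAt (fun ζ ↦ D.op (expKer n ζ)) (D.op (expKer (n + 1) ζ))
      {z : ℂ | 0 ≤ z.im} ζ := by
  rw [hasDerivWithinAt_iff_isLittleO]
  refine Asymptotics.IsLittleO.of_bound fun c hc ↦ ?_
  have := (tendsto_modulus h (ζ := ζ) (U := {z : ℂ | 0 ≤ z.im})).eventually_le_const hc
  filter_upwards [self_mem_nhdsWithin, this] with ξ hξ h1
  exact (norm_op_expKer_taylor_le h hζ hξ).trans (by gcongr)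

/-- The operator-valued function `ζ ↦ T(e^{2iζτ})` is as smooth up to the boundary of the upper
half-plane as the potential has moments. -/
theorem contDiffOn_op_expKer (m : ℕ) : ∀ {n : ℕ}, n + m ≤ D.N →
    ContDiffOn ℂ m (fun ζ ↦ D.op (expKer n ζ)) {z : ℂ | 0 ≤ z.im} := by
  -- derivatives within the closed half-plane are unique already over `ℝ`, as it is a convex body
  have hu : UniqueDiffOn ℂ {z : ℂ | 0 ≤ z.im} := by
    refine UniqueDiffOn.mono_field (𝕜 := ℝ)
      (uniqueDiffOn_convex (convex_halfSpace_im_ge (0 : ℝ)) ?_)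
    rw [Complex.interior_setOfPred_le_im]
    exact ⟨Complex.I, by simp⟩
  induction m with
  | zero => intro n h; exact contDiffOn_zero.2 (continuousOn_op_expKer h)
  | succ m ih =>
    intro n h
    have hd : ∀ ζ ∈ {z : ℂ | 0 ≤ z.im}, HasDerivWithinAt (fun ζ ↦ D.op (expKer n ζ))
        (D.op (expKer (n + 1) ζ)) {z : ℂ | 0 ≤ z.im} ζ :=
      fun ζ hζ ↦ hasDerivWithinAt_op_expKer (by omega) hζ
    push_cast
    rw [contDiffOn_succ_iff_derivWithin hu]
    refine ⟨fun ζ hζ ↦ (hd ζ hζ).differentiableWithinAt, by simp, ?_⟩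
    exact (ih (n := n + 1) (by omega)).congr fun ζ hζ ↦ (hd ζ hζ).derivWithin (hu ζ hζ)

end VolterraData

end NLSStep

end

/-! ### Volterra equations on a half-line -/

noncomputable section

open Filter Topology BoundedContinuousFunction

namespace NLSStep

variable {F : Type*} [NormedAddCommGroup F] [NormedSpace ℂ F]

/-- `w` solves, on `(-∞, X]` and within the bounded continuous functions, the Volterra equation
`w(t) = v + ∫_{-∞}^t (P + e^{2iζ(t-s)} Q) V(s) w(s) ds`. -/
structure IsVolterraSol (V : ℝ → F →L[ℂ] F) (P Q : F →L[ℂ] F) (ζ : ℂ) (v : F) (X : ℝ)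
    (w : ℝ → F) : Prop where
  continuousOn : ContinuousOn w (Iic X)
  bounded : ∃ M, ∀ t ≤ X, ‖w t‖ ≤ M
  eq : ∀ t ≤ X, w t = v + ∫ s in Iic t, (P + expKer 0 ζ (t - s) • Q) (V s (w s))

theorem IsVolterraSol.mono {V : ℝ → F →L[ℂ] F} {P Q : F →L[ℂ] F} {ζ : ℂ} {v : F} {X Y : ℝ}
    {w : ℝ → F} (h : IsVolterraSol V P Q ζ v X w) (hY : Y ≤ X) : IsVolterraSol V P Q ζ v Y w :=
  ⟨h.continuousOn.mono (Iic_subset_Iic.2 hY),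
    h.bounded.imp fun _ hM t ht ↦ hM t (ht.trans hY), fun t ht ↦ h.eq t (ht.trans hY)⟩

theorem IsVolterraSol.congr {V V' : ℝ → F →L[ℂ] F} {P Q : F →L[ℂ] F} {ζ : ℂ} {v : F} {X : ℝ}
    {w : ℝ → F} (h : IsVolterraSol V P Q ζ v X w) (hV : ∀ s ≤ X, V s = V' s) :
    IsVolterraSol V' P Q ζ v X w :=
  ⟨h.continuousOn, h.bounded, fun t ht ↦ by
    rw [h.eq t ht]
    congr 1
    refine setIntegral_congr_fun measurableSet_Iic fun s hs ↦ ?_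
    rw [hV s ((mem_Iic.1 hs).trans ht)]⟩

namespace VolterraData

variable (D : VolterraData F)

/-- The weight `e^{-lam mass(t)}`, with `t` stopped at the end point. -/
def damp (t : ℝ) : ℝ := Real.exp (-(D.lam * D.mass (min t D.X)))

theorem damp_pos (t : ℝ) : 0 < D.damp t := Real.exp_pos _

theorem mass_nonneg (t : ℝ) : 0 ≤ D.mass t := integral_nonneg fun _ ↦ norm_nonneg _

theorem damp_le_one (t : ℝ) : D.damp t ≤ 1 := by
  refine Real.exp_le_one_iff.2 ?_
  have := mul_nonneg D.lam_pos.le (D.mass_nonneg (min t D.X))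
  linarith

theorem continuous_damp : Continuous D.damp := by
  have := D.continuous_mass
  unfold damp
  fun_prop

theorem exp_mass_le_damp (t : ℝ) : Real.exp (-(D.lam * D.mass D.X)) ≤ D.damp t := by
  refine Real.exp_le_exp.2 ?_
  have := mul_le_mul_of_nonneg_left (D.mass_mono (min_le_right t D.X)) D.lam_pos.le
  linarith

/-- The weight conjugates: if `g = e^{-lam mass} w`, the weighted operator applied to `g` is
`e^{-lam mass}` times the original one applied to `w`. -/
theorem weight_eq {t s : ℝ} (hs : s ≤ D.X) :
    D.weight (min t D.X) s * D.damp s = D.damp t := by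
  rw [weight, damp, damp, ← Real.exp_add, min_eq_left hs]
  congr 1
  ring

/-- Multiplication of a constant by the damping weight. -/
def dampL : F →L[ℂ] (ℝ →ᵇ F) :=
  LinearMap.mkContinuous
    { toFun := fun v ↦ BoundedContinuousFunction.ofNormedAddCommGroup
        (fun t ↦ (D.damp t : ℂ) • v)
        ((Complex.continuous_ofReal.comp D.continuous_damp).smul continuous_const) ‖v‖
        (fun t ↦ by
          rw [norm_smul, Complex.norm_real, Real.norm_of_nonneg (D.damp_pos t).le]
          exact mul_le_of_le_one_left (norm_nonneg v) (D.damp_le_one t))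
      map_add' := fun v w ↦ by ext t; simp
      map_smul' := fun c v ↦ by
        ext t
        simp only [coe_ofNormedAddCommGroup, BoundedContinuousFunction.smul_apply,
          RingHom.id_apply]
        rw [smul_comm] }
    1 fun v ↦ by
      rw [one_mul]
      refine (BoundedContinuousFunction.norm_le (norm_nonneg v)).2 fun t ↦ ?_
      change ‖(D.damp t : ℂ) • v‖ ≤ _
      rw [norm_smul, Complex.norm_real, Real.norm_of_nonneg (D.damp_pos t).le]
      exact mul_le_of_le_one_left (norm_nonneg v) (D.damp_le_one t)

theorem dampL_apply (v : F) (t : ℝ) : D.dampL v t = (D.damp t : ℂ) • v := rfl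

theorem norm_compLeftContinuousBounded_le (P : F →L[ℂ] F) :
    ‖P.compLeftContinuousBounded ℝ‖ ≤ ‖P‖ := by
  refine ContinuousLinearMap.opNorm_le_bound _ (norm_nonneg P) fun g ↦ ?_
  refine (BoundedContinuousFunction.norm_le (by positivity)).2 fun t ↦ ?_
  exact P.le_opNorm_of_le (g.norm_coe_le_norm t)

/-- Postcomposition of bounded continuous functions, as a continuous linear function of the
operator applied. -/
def postL : (F →L[ℂ] F) →L[ℂ] (ℝ →ᵇ F) →L[ℂ] (ℝ →ᵇ F) :=
  LinearMap.mkContinuous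
    { toFun := fun P ↦ P.compLeftContinuousBounded ℝ
      map_add' := fun P Q ↦ by ext; simp
      map_smul' := fun c P ↦ by ext; simp }
    1 fun P ↦ by
      rw [one_mul]
      exact norm_compLeftContinuousBounded_le P

theorem postL_apply (P : F →L[ℂ] F) (g : ℝ →ᵇ F) (t : ℝ) : postL P g t = P (g t) := rfl

theorem norm_postL_le (P : F →L[ℂ] F) : ‖postL P‖ ≤ ‖P‖ :=
  norm_compLeftContinuousBounded_le P

/-- The weighted operator of the Volterra equation with kernel `(P + e^{2iζ(t-s)} Q) V(s)`. -/
def volterraOp (P Q : F →L[ℂ] F) (ζ : ℂ) : (ℝ →ᵇ F) →L[ℂ] (ℝ →ᵇ F) :=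
  (postL P).comp (D.op (expKer 0 0)) + (postL Q).comp (D.op (expKer 0 ζ))

theorem norm_volterraOp_le (P Q : F →L[ℂ] F) {ζ : ℂ} (hζ : 0 ≤ ζ.im) :
    ‖D.volterraOp P Q ζ‖ ≤ (‖P‖ + ‖Q‖) / D.lam := by
  have h : ∀ (P : F →L[ℂ] F) {ζ : ℂ}, 0 ≤ ζ.im →
      ‖(postL P).comp (D.op (expKer 0 ζ))‖ ≤ ‖P‖ * (1 / D.lam) := fun P ζ hζ ↦
    (ContinuousLinearMap.opNorm_comp_le _ _).trans <| mul_le_mul (norm_postL_le P)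
      (norm_op_le_inv (continuous_expKer 0 ζ) (norm_expKer_zero_le hζ)) (norm_nonneg _)
      (norm_nonneg _)
  calc _ ≤ _ := norm_add_le _ _
    _ ≤ ‖P‖ * (1 / D.lam) + ‖Q‖ * (1 / D.lam) := add_le_add (h P (by simp)) (h Q hζ)
    _ = _ := by ring

variable {D} [CompleteSpace F]

/-- The weighted operator is the integral operator of the Volterra equation, conjugated by the
damping factor. -/
theorem volterraOp_apply {P Q : F →L[ℂ] F} {ζ : ℂ} (hζ : 0 ≤ ζ.im) {g : ℝ →ᵇ F} {w : ℝ → F}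
    (hg : ∀ s ≤ D.X, g s = (D.damp s : ℂ) • w s) (t : ℝ) :
    D.volterraOp P Q ζ g t = (D.damp t : ℂ) •
      ∫ s in Iic (min t D.X), (P + expKer 0 ζ (min t D.X - s) • Q) (D.V s (w s)) := by
  have h0 : PolyBounded D.N (expKer 0 0) := polyBounded_expKer (Nat.zero_le _) (by simp)
  have h1 : PolyBounded D.N (expKer 0 ζ) := polyBounded_expKer (Nat.zero_le _) hζ
  rw [volterraOp, _root_.add_apply, BoundedContinuousFunction.add_apply,
    ContinuousLinearMap.comp_apply, ContinuousLinearMap.comp_apply, postL_apply, postL_apply,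
    op_apply h0, op_apply h1,
    ← ContinuousLinearMap.integral_comp_comm _ (integrableOn_integrand h0 g (min_le_right _ _)),
    ← ContinuousLinearMap.integral_comp_comm _ (integrableOn_integrand h1 g (min_le_right _ _)),
    ← integral_add (ContinuousLinearMap.integrable_comp _
        (integrableOn_integrand h0 g (min_le_right _ _)))
      (ContinuousLinearMap.integrable_comp _
        (integrableOn_integrand h1 g (min_le_right _ _))), ← integral_smul]
  refine setIntegral_congr_fun measurableSet_Iic fun s hs ↦ ?_
  have hs' : s ≤ D.X := (mem_Iic.1 hs).trans (min_le_right _ _)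
  simp only [integrand]
  rw [hg s hs', ← D.weight_eq (t := t) hs']
  simp only [expKer, map_smul, _root_.add_apply, _root_.smul_apply, smul_add, smul_smul]
  push_cast
  simp only [pow_zero, one_mul, mul_zero, zero_mul, Complex.exp_zero, mul_one]
  congr 2
  ring

/-- Bounded solutions of the Volterra equation are given by inverting the weighted operator. -/
theorem eq_of_isVolterraSol {P Q : F →L[ℂ] F} {ζ : ℂ} (hζ : 0 ≤ ζ.im) {v : F} {w : ℝ → F}
    (hw : IsVolterraSol D.V P Q ζ v D.X w) (hn : ‖D.volterraOp P Q ζ‖ < 1) {t : ℝ} (ht : t ≤ D.X) :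
    w t = ((D.damp t)⁻¹ : ℂ) • Ring.inverse (1 - D.volterraOp P Q ζ) (D.dampL v) t := by
  obtain ⟨M, hM⟩ := hw.bounded
  -- the damped function, continued as a constant beyond `X`, is a bounded continuous solution of
  -- the weighted equation
  have hcont : Continuous fun t ↦ (D.damp t : ℂ) • w (min t D.X) :=
    (Complex.continuous_ofReal.comp D.continuous_damp).smul
      (hw.continuousOn.comp_continuous (by fun_prop) fun t ↦ mem_Iic.2 (min_le_right _ _))
  let g : ℝ →ᵇ F := BoundedContinuousFunction.ofNormedAddCommGroup
    (fun t ↦ (D.damp t : ℂ) • w (min t D.X)) hcont M fun t ↦ by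
      rw [norm_smul, Complex.norm_real, Real.norm_of_nonneg (D.damp_pos t).le]
      exact (mul_le_of_le_one_left (norm_nonneg _) (D.damp_le_one t)).trans
        (hM _ (min_le_right _ _))
  have hg : ∀ s ≤ D.X, g s = (D.damp s : ℂ) • w s := fun s hs ↦ by
    change (D.damp s : ℂ) • w (min s D.X) = _
    rw [min_eq_left hs]
  have hfix : (1 - D.volterraOp P Q ζ) g = D.dampL v := by
    ext t
    rw [_root_.sub_apply, BoundedContinuousFunction.sub_apply, volterraOp_apply hζ hg,
      dampL_apply]
    change (D.damp t : ℂ) • w (min t D.X) - _ = _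
    rw [← smul_sub, hw.eq _ (min_le_right _ _), add_sub_cancel_right]
  have hu := isUnit_one_sub_of_norm_lt_one hn
  have hg2 : Ring.inverse (1 - D.volterraOp P Q ζ) (D.dampL v) = g := by
    rw [← hfix, ← mul_apply_eq_comp, Ring.inverse_mul_cancel _ hu,
      one_apply_eq_self]
  rw [hg2, hg t ht, smul_smul, inv_mul_cancel₀, one_smul]
  exact_mod_cast (D.damp_pos t).ne'

theorem exists_isVolterraSol {P Q : F →L[ℂ] F} {ζ : ℂ} (hζ : 0 ≤ ζ.im) (v : F)
    (hn : ‖D.volterraOp P Q ζ‖ < 1) : ∃ w, IsVolterraSol D.V P Q ζ v D.X w := by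
  have hu := isUnit_one_sub_of_norm_lt_one hn
  set g := Ring.inverse (1 - D.volterraOp P Q ζ) (D.dampL v) with hgdef
  have hfix : (1 - D.volterraOp P Q ζ) g = D.dampL v := by
    rw [hgdef, ← mul_apply_eq_comp, Ring.mul_inverse_cancel _ hu,
      one_apply_eq_self]
  have hd : ∀ t, (D.damp t : ℂ) ≠ 0 := fun t ↦ by exact_mod_cast (D.damp_pos t).ne'
  let w : ℝ → F := fun t ↦ ((D.damp t)⁻¹ : ℂ) • g t
  have hg : ∀ s ≤ D.X, g s = (D.damp s : ℂ) • w s := fun s _ ↦ by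
    rw [smul_smul, mul_inv_cancel₀ (hd s), one_smul]
  refine ⟨w, ?_, ⟨(Real.exp (-(D.lam * D.mass D.X)))⁻¹ * ‖g‖, fun t ht ↦ ?_⟩, fun t ht ↦ ?_⟩
  · have : Continuous fun t ↦ ((D.damp t)⁻¹ : ℂ) :=
      (Complex.continuous_ofReal.comp D.continuous_damp).inv₀ hd
    exact (this.smul g.continuous).continuousOn
  · rw [norm_smul, norm_inv, Complex.norm_real, Real.norm_of_nonneg (D.damp_pos t).le]
    gcongr
    · exact D.exp_mass_le_damp t
    · exact g.norm_coe_le_norm t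
  · have h1 := congrArg (fun f : ℝ →ᵇ F ↦ f t) hfix
    rw [_root_.sub_apply, BoundedContinuousFunction.sub_apply, volterraOp_apply hζ hg, dampL_apply,
      one_apply_eq_self, hg t ht, ← smul_sub, min_eq_left ht] at h1
    exact sub_eq_iff_eq_add.1 (smul_right_injective F (hd t) h1)

/-- Solutions of a Volterra equation whose data depend smoothly on a spectral parameter are smooth
in that parameter, as many times as the potential has moments. -/
theorem contDiffWithinAt_of_isVolterraSol {P Q : ℂ → F →L[ℂ] F} {ζ : ℂ → ℂ} {v : ℂ → F}
    {w : ℂ → ℝ → F} {U : Set ℂ} {k₀ : ℂ} (hk₀ : k₀ ∈ U) (hζ : ∀ k ∈ U, 0 ≤ (ζ k).im)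
    (hP : ContDiffWithinAt ℂ D.N P U k₀) (hQ : ContDiffWithinAt ℂ D.N Q U k₀)
    (hζs : ContDiffWithinAt ℂ D.N ζ U k₀) (hv : ContDiffWithinAt ℂ D.N v U k₀)
    (hw : ∀ k ∈ U, IsVolterraSol D.V (P k) (Q k) (ζ k) (v k) D.X (w k))
    (hn : ‖D.volterraOp (P k₀) (Q k₀) (ζ k₀)‖ < 1) :
    ContDiffWithinAt ℂ D.N (fun k ↦ w k D.X) U k₀ := by
  have hop : ContDiffWithinAt ℂ D.N (fun k ↦ D.op (expKer 0 (ζ k))) U k₀ :=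
    ((contDiffOn_op_expKer D.N (by omega)) (ζ k₀) (hζ k₀ hk₀)).comp k₀ hζs hζ
  have hT : ContDiffWithinAt ℂ D.N (fun k ↦ D.volterraOp (P k) (Q k) (ζ k)) U k₀ := by
    have hP' : ContDiffWithinAt ℂ D.N (fun k ↦ postL (P k)) U k₀ :=
      hP.continuousLinearMap_comp (postL (F := F))
    have hQ' : ContDiffWithinAt ℂ D.N (fun k ↦ postL (Q k)) U k₀ :=
      hQ.continuousLinearMap_comp (postL (F := F))
    have h0 : ContDiffWithinAt ℂ D.N (fun _ : ℂ ↦ D.op (expKer 0 0)) U k₀ :=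
      contDiffWithinAt_const
    exact (hP'.clm_comp h0).add (hQ'.clm_comp hop)
  have hev : ∀ᶠ k in 𝓝[U] k₀, ‖D.volterraOp (P k) (Q k) (ζ k)‖ < 1 :=
    hT.continuousWithinAt.norm.eventually_lt_const hn
  obtain ⟨u, hu⟩ := isUnit_one_sub_of_norm_lt_one hn
  have hinv : ContDiffWithinAt ℂ D.N
      (fun k ↦ Ring.inverse (1 - D.volterraOp (P k) (Q k) (ζ k))) U k₀ := by
    have h1 := contDiffAt_ringInverse ℂ (n := D.N) u
    rw [hu] at h1
    exact h1.comp_contDiffWithinAt k₀ (contDiffWithinAt_const.sub hT)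
  have hv' : ContDiffWithinAt ℂ D.N (fun k ↦ D.dampL (v k)) U k₀ :=
    hv.continuousLinearMap_comp D.dampL
  have hg : ContDiffWithinAt ℂ D.N (fun k ↦
      Ring.inverse (1 - D.volterraOp (P k) (Q k) (ζ k)) (D.dampL (v k))) U k₀ :=
    hinv.clm_apply hv'
  have hsol : ContDiffWithinAt ℂ D.N (fun k ↦ ((D.damp D.X)⁻¹ : ℂ) •
      Ring.inverse (1 - D.volterraOp (P k) (Q k) (ζ k)) (D.dampL (v k)) D.X) U k₀ :=
    ((BoundedContinuousFunction.evalCLM ℂ D.X).contDiff.comp_contDiffWithinAt hg).const_smul _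
  refine hsol.congr_of_eventuallyEq ?_ (eq_of_isVolterraSol (hζ k₀ hk₀) (hw k₀ hk₀) hn le_rfl)
  filter_upwards [hev, self_mem_nhdsWithin] with k hk hkU
  exact eq_of_isVolterraSol (hζ k hkU) (hw k hkU) hk le_rfl

end VolterraData

end NLSStep

end

/-! ### Volterra equations on the line -/

noncomputable section

open Filter Topology BoundedContinuousFunction

namespace NLSStep

theorem tendsto_setIntegral_Iic_atBot {E : Type*} [NormedAddCommGroup E] [NormedSpace ℝ E]
    {f : ℝ → E} {X : ℝ} (hf : IntegrableOn f (Iic X)) :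
    Tendsto (fun t ↦ ∫ s in Iic t, f s) atBot (𝓝 0) := by
  have h := (tendsto_const_nhds (x := ∫ s in Iic X, f s)).sub
    (intervalIntegral_tendsto_integral_Iic X hf tendsto_id)
  rw [sub_self] at h
  refine h.congr' ?_
  filter_upwards [eventually_le_atBot X] with t ht
  rw [id, ← intervalIntegral.integral_Iic_sub_Iic (hf.mono_set (Iic_subset_Iic.2 ht)) hf]
  simp

/-- The function `f`, cut off to the right of `X`. -/
def cutoff {E : Type*} [NormedAddCommGroup E] (X : ℝ) (f : ℝ → E) : ℝ → E := (Iic X).indicator f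

theorem cutoff_of_le {E : Type*} [NormedAddCommGroup E] {X s : ℝ} (f : ℝ → E) (h : s ≤ X) :
    cutoff X f s = f s := indicator_of_mem (mem_Iic.2 h) f

theorem integrable_cutoff {E : Type*} [NormedAddCommGroup E] {X : ℝ} {f : ℝ → E}
    (hf : IntegrableOn f (Iic X)) : Integrable (cutoff X f) :=
  hf.integrable_indicator measurableSet_Iic

variable {F : Type*} [NormedAddCommGroup F] [NormedSpace ℂ F]

/-- The Volterra data of a potential, cut off to the right of `X`. -/
def VolterraData.ofPotential (V : ℝ → F →L[ℂ] F) (X : ℝ) (N : ℕ) (lam : ℝ) (hlam : 0 < lam)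
    (hV : IntegrableOn V (Iic X))
    (hm : IntegrableOn (fun s ↦ (1 + (X - s)) ^ N * ‖V s‖) (Iic X)) : VolterraData F where
  V := cutoff X V
  X := X
  N := N
  lam := lam
  lam_pos := hlam
  integrable := integrable_cutoff hV
  moment := IntegrableOn.congr_fun hm (fun s hs ↦ by rw [cutoff_of_le V hs]) measurableSet_Iic

variable {V : ℝ → F →L[ℂ] F} {P Q : F →L[ℂ] F} {ζ : ℂ} {v : F} {X : ℝ} {w w' : ℝ → F}

/-- Large weights make every Volterra equation contractive. -/
theorem exists_volterraData {N : ℕ} (hV : IntegrableOn V (Iic X))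
    (hm : IntegrableOn (fun s ↦ (1 + (X - s)) ^ N * ‖V s‖) (Iic X)) (P Q : F →L[ℂ] F)
    (hζ : 0 ≤ ζ.im) :
    ∃ D : VolterraData F, D.X = X ∧ D.N = N ∧ (∀ s ≤ X, D.V s = V s) ∧
      ‖D.volterraOp P Q ζ‖ < 1 := by
  -- the weight `lam = ‖P‖ + ‖Q‖ + 1` beats the bound `(‖P‖ + ‖Q‖) / lam` of the norm
  refine ⟨.ofPotential V X N (‖P‖ + ‖Q‖ + 1) (by positivity) hV hm, rfl, rfl,
    fun s hs ↦ cutoff_of_le V hs, ?_⟩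
  refine (VolterraData.norm_volterraOp_le _ P Q hζ).trans_lt ?_
  change (‖P‖ + ‖Q‖) / (‖P‖ + ‖Q‖ + 1) < 1
  rw [div_lt_one (by positivity)]
  linarith

namespace IsVolterraSol

theorem integrableOn (h : IsVolterraSol V P Q ζ v X w) (hζ : 0 ≤ ζ.im)
    (hV : IntegrableOn V (Iic X)) {t : ℝ} (ht : t ≤ X) :
    IntegrableOn (fun s ↦ (P + expKer 0 ζ (t - s) • Q) (V s (w s))) (Iic t) := by
  obtain ⟨M, hM⟩ := h.bounded
  have hVt := hV.mono_set (Iic_subset_Iic.2 ht)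
  refine Integrable.mono' (g := fun s ↦ (‖P‖ + ‖Q‖) * (‖V s‖ * M))
    ((hVt.norm.mul_const M).const_mul _) ?_ ?_
  · have h1 : AEStronglyMeasurable (fun s ↦ V s (w s)) (volume.restrict (Iic t)) :=
      (ContinuousLinearMap.id ℂ (F →L[ℂ] F)).aestronglyMeasurable_comp₂ hVt.1
        ((h.continuousOn.mono (Iic_subset_Iic.2 ht)).aestronglyMeasurable measurableSet_Iic)
    have h2 : Continuous fun s : ℝ ↦ P + expKer 0 ζ (t - s) • Q := by
      have := continuous_expKer 0 ζ
      fun_prop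
    exact (ContinuousLinearMap.id ℂ (F →L[ℂ] F)).aestronglyMeasurable_comp₂
      h2.aestronglyMeasurable h1
  · refine (ae_restrict_iff' measurableSet_Iic).2 (.of_forall fun s hs ↦ ?_)
    have h1 := norm_expKer_zero_le hζ (t - s) (sub_nonneg.2 hs)
    refine (ContinuousLinearMap.le_opNorm_of_le _
      ((V s).le_opNorm_of_le (hM s ((mem_Iic.1 hs).trans ht)))).trans ?_
    have hM0 : 0 ≤ M := (norm_nonneg _).trans (hM t ht)
    gcongr
    refine (norm_add_le _ _).trans (add_le_add le_rfl ?_)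
    rw [norm_smul]
    exact mul_le_of_le_one_left (norm_nonneg _) h1

theorem tendsto_atBot (h : IsVolterraSol V P Q ζ v X w) (hζ : 0 ≤ ζ.im)
    (hV : IntegrableOn V (Iic X)) : Tendsto w atBot (𝓝 v) := by
  obtain ⟨M, hM⟩ := h.bounded
  rw [tendsto_iff_norm_sub_tendsto_zero]
  have h0 : Tendsto (fun t ↦ ∫ s in Iic t, (‖P‖ + ‖Q‖) * (‖V s‖ * M)) atBot (𝓝 0) :=
    tendsto_setIntegral_Iic_atBot (X := X) ((hV.norm.mul_const M).const_mul _)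
  refine squeeze_zero' (.of_forall fun _ ↦ norm_nonneg _) ?_ h0
  filter_upwards [eventually_le_atBot X] with t ht
  rw [h.eq t ht, add_sub_cancel_left]
  refine norm_integral_le_of_norm_le
    (((hV.mono_set (Iic_subset_Iic.2 ht)).norm.mul_const M).const_mul _) ?_
  refine (ae_restrict_iff' measurableSet_Iic).2 (.of_forall fun s hs ↦ ?_)
  have h1 := norm_expKer_zero_le hζ (t - s) (sub_nonneg.2 hs)
  refine (ContinuousLinearMap.le_opNorm_of_le _
    ((V s).le_opNorm_of_le (hM s ((mem_Iic.1 hs).trans ht)))).trans ?_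
  have hM0 : 0 ≤ M := (norm_nonneg _).trans (hM t ht)
  gcongr
  refine (norm_add_le _ _).trans (add_le_add le_rfl ?_)
  rw [norm_smul]
  exact mul_le_of_le_one_left (norm_nonneg _) h1

variable [CompleteSpace F]

theorem unique (h : IsVolterraSol V P Q ζ v X w) (h' : IsVolterraSol V P Q ζ v X w')
    (hζ : 0 ≤ ζ.im) (hV : IntegrableOn V (Iic X)) {t : ℝ} (ht : t ≤ X) : w t = w' t := by
  obtain ⟨D, hX, -, hDV, hn⟩ :=
    exists_volterraData (N := 0) hV (by simpa using! hV.norm) P Q hζ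
  subst hX
  rw [VolterraData.eq_of_isVolterraSol hζ (h.congr fun s hs ↦ (hDV s hs).symm) hn ht,
    VolterraData.eq_of_isVolterraSol hζ (h'.congr fun s hs ↦ (hDV s hs).symm) hn ht]

end IsVolterraSol

variable [CompleteSpace F]

/-- A Volterra equation whose potential is integrable on every left half-line has a solution on the
whole line: the solutions on the half-lines fit together by uniqueness. -/
theorem exists_forall_isVolterraSol (hV : ∀ X, IntegrableOn V (Iic X)) (P Q : F →L[ℂ] F)
    (hζ : 0 ≤ ζ.im) (v : F) : ∃ w, ∀ X, IsVolterraSol V P Q ζ v X w := by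
  have hex : ∀ X, ∃ w, IsVolterraSol V P Q ζ v X w := fun X ↦ by
    obtain ⟨D, hX, -, hDV, hn⟩ :=
      exists_volterraData (N := 0) (hV X) (by simpa using! (hV X).norm) P Q hζ
    subst hX
    obtain ⟨w, hw⟩ := VolterraData.exists_isVolterraSol hζ v hn
    exact ⟨w, hw.congr hDV⟩
  choose f hf using hex
  have heq : ∀ X, ∀ t ≤ X, f X t = f t t := fun X t ht ↦
    ((hf X).mono ht).unique (hf t) hζ (hV t) le_rfl
  refine ⟨fun t ↦ f t t, fun X ↦ ⟨?_, ?_, fun t ht ↦ ?_⟩⟩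
  · exact (hf X).continuousOn.congr fun t ht ↦ (heq X t ht).symm
  · obtain ⟨M, hM⟩ := (hf X).bounded
    exact ⟨M, fun t ht ↦ heq X t ht ▸ hM t ht⟩
  · rw [(hf t).eq t le_rfl]
    congr 1
    refine setIntegral_congr_fun measurableSet_Iic fun s hs ↦ ?_
    rw [heq t s hs]

/-- The solution of a Volterra equation at the end point `X` is as smooth in the spectral parameter
as the potential has moments. -/
theorem contDiffOn_of_isVolterraSol {N : ℕ} (hV : IntegrableOn V (Iic X))
    (hm : IntegrableOn (fun s ↦ (1 + (X - s)) ^ N * ‖V s‖) (Iic X))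
    {P Q : ℂ → F →L[ℂ] F} {ζ : ℂ → ℂ} {v : ℂ → F} {w : ℂ → ℝ → F} {U : Set ℂ}
    (hζ : ∀ k ∈ U, 0 ≤ (ζ k).im) (hP : ContDiffOn ℂ N P U) (hQ : ContDiffOn ℂ N Q U)
    (hζs : ContDiffOn ℂ N ζ U) (hv : ContDiffOn ℂ N v U)
    (hw : ∀ k ∈ U, IsVolterraSol V (P k) (Q k) (ζ k) (v k) X (w k)) :
    ContDiffOn ℂ N (fun k ↦ w k X) U := by
  intro k₀ hk₀
  obtain ⟨D, hX, hN, hDV, hn⟩ := exists_volterraData hV hm (P k₀) (Q k₀) (hζ k₀ hk₀)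
  subst hX hN
  exact VolterraData.contDiffWithinAt_of_isVolterraSol hk₀ hζ (hP k₀ hk₀) (hQ k₀ hk₀)
    (hζs k₀ hk₀) (hv k₀ hk₀) (fun k hk ↦ (hw k hk).congr fun s hs ↦ (hDV s hs).symm) hn

end NLSStep

end

/-! ### Background eigenfunctions and their normalization -/

noncomputable section

open Filter Topology

namespace NLSStep

/-- A `2 × 2` matrix as a continuous linear map. -/
def mulVecL (M : Matrix (Fin 2) (Fin 2) ℂ) : (Fin 2 → ℂ) →L[ℂ] (Fin 2 → ℂ) :=
  LinearMap.toContinuousLinearMap M.mulVecLin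

@[simp] theorem mulVecL_apply (M : Matrix (Fin 2) (Fin 2) ℂ) (v : Fin 2 → ℂ) :
    mulVecL M v = M *ᵥ v := rfl

theorem mulVecL_eq_sum (M : Matrix (Fin 2) (Fin 2) ℂ) :
    mulVecL M = ∑ i, ∑ j, M i j • mulVecL (Matrix.single i j 1) := by
  ext v i
  fin_cases i <;>
    simp [Fin.sum_univ_two, Matrix.mulVec, dotProduct, Matrix.single]

theorem contDiffOn_mulVecL {N : ℕ} {U : Set ℂ} {M : ℂ → Matrix (Fin 2) (Fin 2) ℂ}
    (hM : ∀ i j, ContDiffOn ℂ N (fun k ↦ M k i j) U) :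
    ContDiffOn ℂ N (fun k ↦ mulVecL (M k)) U := by
  simp_rw [mulVecL_eq_sum (M _)]
  exact ContDiffOn.sum fun i _ ↦ ContDiffOn.sum fun j _ ↦ (hM i j).smul contDiffOn_const

theorem expσ₃_mul (z w : ℂ) : expσ₃ z * expσ₃ w = expσ₃ (z + w) := by
  simp only [expσ₃]
  ext i j
  fin_cases i <;> fin_cases j <;> simp [Complex.exp_add, mul_comm]

theorem expσ₃_zero : expσ₃ 0 = 1 := by
  ext i j
  fin_cases i <;> fin_cases j <;> simp [expσ₃]

theorem expσ₃_inv (z : ℂ) : (expσ₃ z)⁻¹ = expσ₃ (-z) :=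
  Matrix.inv_eq_right_inv (by rw [expσ₃_mul, add_neg_cancel, expσ₃_zero])

theorem det_expσ₃ (z : ℂ) : (expσ₃ z).det = 1 := by
  simp [expσ₃, Matrix.det_fin_two, ← Complex.exp_add]

/-- Eigenfunctions `e^{iβxσ₃} S e^{-iζxσ₃}` of a constant-amplitude background. -/
def bgΦ (β : ℝ) (S : Matrix (Fin 2) (Fin 2) ℂ) (ζ : ℂ) (x : ℝ) : Matrix (Fin 2) (Fin 2) ℂ :=
  expσ₃ (Complex.I * β * x) * S * expσ₃ (-(Complex.I * ζ * x))

theorem det_bgΦ {β : ℝ} {S : Matrix (Fin 2) (Fin 2) ℂ} (hS : S.det = 1) (ζ : ℂ) (x : ℝ) :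
    (bgΦ β S ζ x).det = 1 := by
  rw [bgΦ, Matrix.det_mul, Matrix.det_mul, det_expσ₃, det_expσ₃, hS]; norm_num

/-- `φ` solves column `j` of the Volterra equation
`φ(x) = Φ(x) + ∫_{-∞}^x Φ(x) Φ(x')⁻¹ Q(x') φ(x') dx'`, with absolutely convergent integrals. -/
def SolvesVolterra (Φ Q : ℝ → Matrix (Fin 2) (Fin 2) ℂ) (j : Fin 2) (φ : ℝ → Fin 2 → ℂ) : Prop :=
  ∀ x : ℝ,
    IntegrableOn (fun x' : ℝ ↦ (Φ x * (Φ x')⁻¹ * Q x') *ᵥ φ x') (Iic x) ∧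
    φ x = (Φ x).col j + ∫ x' in Iic x, (Φ x * (Φ x')⁻¹ * Q x') *ᵥ φ x'

/-- The gauge-transformed potential `e^{-2iβx} q(x)`, as an operator. -/
def gaugedPotential (β : ℝ) (q : ℝ → ℂ) (x : ℝ) : (Fin 2 → ℂ) →L[ℂ] (Fin 2 → ℂ) :=
  mulVecL (potential (Complex.exp (-(2 * Complex.I * β * x)) * q x))

/-- The projection `S diag(1, 0) S⁻¹`. -/
def projFst (S : Matrix (Fin 2) (Fin 2) ℂ) : Matrix (Fin 2) (Fin 2) ℂ := S * !![1, 0; 0, 0] * S⁻¹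

/-- The projection `S diag(0, 1) S⁻¹`. -/
def projSnd (S : Matrix (Fin 2) (Fin 2) ℂ) : Matrix (Fin 2) (Fin 2) ℂ := S * !![0, 0; 0, 1] * S⁻¹

/-- The normalized function `e^{iζx} e^{-iβxσ₃} φ(x)`, which stays bounded as `x → -∞` when `φ`
is the first column of an eigenfunction. -/
def normalized (β : ℝ) (ζ : ℂ) (φ : ℝ → Fin 2 → ℂ) (x : ℝ) : Fin 2 → ℂ :=
  Complex.exp (Complex.I * ζ * x) • (expσ₃ (-(Complex.I * β * x)) *ᵥ φ x)

/-- Conjugation by `e^{-iβxσ₃}` turns the potential into the gauge-transformed one. -/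
theorem expσ₃_mul_potential (β x : ℝ) (q : ℂ) :
    expσ₃ (-(Complex.I * β * x)) * potential q =
      potential (Complex.exp (-(2 * Complex.I * β * x)) * q) * expσ₃ (-(Complex.I * β * x)) := by
  have h1 : Complex.exp (-(2 * Complex.I * β * x)) * Complex.exp (Complex.I * β * x) =
      Complex.exp (-(Complex.I * β * x)) := by
    rw [← Complex.exp_add]; congr 1; ring
  have h2 : conj (Complex.exp (-(2 * Complex.I * β * x))) * Complex.exp (-(Complex.I * β * x)) =
      Complex.exp (Complex.I * β * x) := by
    rw [← Complex.exp_conj, ← Complex.exp_add]; congr 1; simp [Complex.conj_ofNat]; ring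
  simp only [expσ₃, potential, Matrix.mul_fin_two, mul_zero, zero_mul, add_zero, zero_add, neg_neg,
    map_mul]
  rw [mul_right_comm _ q, h1, mul_right_comm _ (conj q), h2]

theorem exp_smul_expσ₃ (ζ : ℂ) (x y : ℝ) :
    Complex.exp (Complex.I * ζ * x) • (expσ₃ (-(Complex.I * ζ * x)) * expσ₃ (Complex.I * ζ * y)) =
      Complex.exp (Complex.I * ζ * y) •
        (!![1, 0; 0, 0] + expKer 0 ζ (x - y) • !![0, 0; 0, 1]) := by
  rw [expσ₃_mul]
  ext i j
  fin_cases i <;> fin_cases j <;> simp [expσ₃, expKer, ← Complex.exp_add]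
  ring_nf

/-- After normalization, the Volterra kernel `Φ(x) Φ(y)⁻¹` becomes
`S diag(1, e^{2iζ(x-y)}) S⁻¹`, which is bounded for `y ≤ x` and `Im ζ ≥ 0`. -/
theorem normalized_kernel {β : ℝ} {S : Matrix (Fin 2) (Fin 2) ℂ} {ζ : ℂ}
    (q : ℝ → ℂ) (φ : ℝ → Fin 2 → ℂ) (x y : ℝ) :
    Complex.exp (Complex.I * ζ * x) • (expσ₃ (-(Complex.I * β * x)) *ᵥ
        ((bgΦ β S ζ x * (bgΦ β S ζ y)⁻¹ * potential (q y)) *ᵥ φ y)) =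
      (mulVecL (projFst S) + expKer 0 ζ (x - y) • mulVecL (projSnd S))
        (gaugedPotential β q y (normalized β ζ φ y)) := by
  have hinv : (bgΦ β S ζ y)⁻¹ =
      expσ₃ (Complex.I * ζ * y) * S⁻¹ * expσ₃ (-(Complex.I * β * y)) := by
    rw [bgΦ, Matrix.mul_inv_rev, Matrix.mul_inv_rev, expσ₃_inv, expσ₃_inv, neg_neg,
      ← Matrix.mul_assoc]
  have hcancel : expσ₃ (-(Complex.I * β * x)) * expσ₃ (Complex.I * β * x) = 1 := by
    rw [expσ₃_mul, neg_add_cancel, expσ₃_zero]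
  have hmat : Complex.exp (Complex.I * ζ * x) • (expσ₃ (-(Complex.I * β * x)) *
        (bgΦ β S ζ x * (bgΦ β S ζ y)⁻¹ * potential (q y))) =
      Complex.exp (Complex.I * ζ * y) • ((projFst S + expKer 0 ζ (x - y) • projSnd S) *
        potential (Complex.exp (-(2 * Complex.I * β * y)) * q y) *
          expσ₃ (-(Complex.I * β * y))) := by
    calc _ = S * (Complex.exp (Complex.I * ζ * x) •
          (expσ₃ (-(Complex.I * ζ * x)) * expσ₃ (Complex.I * ζ * y))) * S⁻¹ *
            (expσ₃ (-(Complex.I * β * y)) * potential (q y)) := by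
          rw [hinv, bgΦ, Matrix.mul_smul, Matrix.smul_mul, Matrix.smul_mul]
          congr 1
          simp only [← mul_assoc]
          rw [hcancel, one_mul]
      _ = _ := by
          rw [exp_smul_expσ₃, expσ₃_mul_potential, Matrix.mul_smul, Matrix.smul_mul,
            Matrix.smul_mul, projFst, projSnd, Matrix.mul_add, Matrix.add_mul, Matrix.mul_smul,
            Matrix.smul_mul, mul_assoc _ (potential _)]
  rw [Matrix.mulVec_mulVec, ← Matrix.smul_mulVec, hmat]
  simp only [gaugedPotential, normalized, mulVecL_apply, _root_.add_apply, _root_.smul_apply,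
    Matrix.mulVec_smul, Matrix.mulVec_mulVec, Matrix.smul_mulVec, Matrix.add_mul,
    Matrix.add_mulVec, Matrix.smul_mul, smul_add, Matrix.mul_assoc]
  rw [smul_comm]

theorem normalized_bgΦ_col (β : ℝ) (S : Matrix (Fin 2) (Fin 2) ℂ) (ζ : ℂ) (x : ℝ) :
    Complex.exp (Complex.I * ζ * x) •
      (expσ₃ (-(Complex.I * β * x)) *ᵥ (bgΦ β S ζ x).col 0) = S.col 0 := by
  have hcancel : expσ₃ (-(Complex.I * β * x)) * bgΦ β S ζ x =
      S * expσ₃ (-(Complex.I * ζ * x)) := by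
    rw [bgΦ, ← mul_assoc, ← mul_assoc, expσ₃_mul, neg_add_cancel, expσ₃_zero, one_mul]
  have : expσ₃ (-(Complex.I * β * x)) *ᵥ (bgΦ β S ζ x).col 0 =
      (expσ₃ (-(Complex.I * β * x)) * bgΦ β S ζ x).col 0 := rfl
  rw [this, hcancel]
  ext i
  simp [expσ₃, Matrix.mul_apply, Fin.sum_univ_two]
  rw [mul_left_comm, ← Complex.exp_add]
  simp

theorem integrableOn_smul_add_smul {E : Type*} [NormedAddCommGroup E] [NormedSpace ℂ E]
    {f g : ℝ → ℂ} {s : Set ℝ} (hf : IntegrableOn f s) (hg : IntegrableOn g s) (A B : E) :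
    IntegrableOn (fun x ↦ f x • A + g x • B) s :=
  (Integrable.smul_const hf A).add (Integrable.smul_const hg B)

theorem integrableOn_gaugedPotential {β : ℝ} {q : ℝ → ℂ} {s : Set ℝ} (hq : IntegrableOn q s) :
    IntegrableOn (gaugedPotential β q) s := by
  set f : ℝ → ℂ := fun x ↦ Complex.exp (-(2 * Complex.I * β * x)) * q x with hf
  have hfi : IntegrableOn f s := by
    refine Integrable.mono' hq.norm ?_ (.of_forall fun x ↦ ?_)
    · have : Continuous fun x : ℝ ↦ Complex.exp (-(2 * Complex.I * β * x)) := by fun_prop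
      exact this.aestronglyMeasurable.mul hq.1
    · rw [hf, norm_mul, Complex.norm_exp]
      simp
  have heq : gaugedPotential β q = fun x ↦ f x • mulVecL (Matrix.single 0 1 1) +
      conj (f x) • mulVecL (Matrix.single 1 0 1) := by
    ext x v i
    fin_cases i <;> simp [gaugedPotential, potential, f, Matrix.mulVec, dotProduct, Matrix.single,
      Fin.sum_univ_two]
  have hci : IntegrableOn (fun x ↦ conj (f x)) s :=
    Complex.conjCLE.toContinuousLinearMap.integrable_comp hfi
  rw [heq]
  exact integrableOn_smul_add_smul hfi hci _ _

theorem norm_gaugedPotential_le (β : ℝ) (q : ℝ → ℂ) (x : ℝ) :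
    ‖gaugedPotential β q x‖ ≤ ‖q x‖ := by
  refine ContinuousLinearMap.opNorm_le_bound _ (norm_nonneg _) fun v ↦ ?_
  refine (pi_norm_le_iff_of_nonneg (by positivity)).2 fun i ↦ ?_
  have he : ‖Complex.exp (-(2 * Complex.I * β * x))‖ = 1 := by rw [Complex.norm_exp]; simp
  fin_cases i
  · simpa [gaugedPotential, potential, he, Matrix.mulVec, dotProduct, Fin.sum_univ_two] using
      mul_le_mul_of_nonneg_left (norm_le_pi_norm v 1) (norm_nonneg (q x))
  · simpa [gaugedPotential, potential, he, Matrix.mulVec, dotProduct, Fin.sum_univ_two] using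
      mul_le_mul_of_nonneg_left (norm_le_pi_norm v 0) (norm_nonneg (q x))

end NLSStep

end

/-! ### The first column of an eigenfunction -/

noncomputable section

open Filter Topology

namespace NLSStep

/-- The Wronskian `det (u, v)` of two vectors. -/
def wronskian (u v : Fin 2 → ℂ) : ℂ := u 0 * v 1 - u 1 * v 0

theorem wronskian_mulVec (M : Matrix (Fin 2) (Fin 2) ℂ) (u v : Fin 2 → ℂ) :
    wronskian (M *ᵥ u) (M *ᵥ v) = M.det * wronskian u v := by
  simp only [wronskian, Matrix.det_fin_two, Matrix.mulVec, dotProduct, Fin.sum_univ_two]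
  ring

/-- The derivative of a Wronskian of solutions of `φ' = Qφ` is the trace of `Q` times it. -/
theorem wronskian_mulVec_add (Q : Matrix (Fin 2) (Fin 2) ℂ) (u v : Fin 2 → ℂ) :
    wronskian (Q *ᵥ u) v + wronskian u (Q *ᵥ v) = Q.trace * wronskian u v := by
  simp only [wronskian, Matrix.trace_fin_two, Matrix.mulVec, dotProduct, Fin.sum_univ_two]
  ring

/-- Vectors with vanishing Wronskian are proportional. -/
theorem smul_eq_of_wronskian_eq_zero {u v : Fin 2 → ℂ} (h : wronskian u v = 0) :
    u 0 • v = v 0 • u := by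
  ext i
  simp only [wronskian] at h
  fin_cases i
  · exact mul_comm (u 0) (v 0)
  · change u 0 * v 1 = v 0 * u 1
    linear_combination h

theorem IsPrimitiveOf.apply {u u' : ℝ → Fin 2 → ℂ} (h : IsPrimitiveOf u u') (i : Fin 2) :
    IsPrimitiveOf (fun x ↦ u x i) (fun x ↦ u' x i) := by
  let p : (Fin 2 → ℂ) →L[ℝ] ℂ := ContinuousLinearMap.proj i
  refine ⟨fun a b ↦ ?_, fun a b ↦ ?_⟩
  · have := h.1 a b
    rw [intervalIntegrable_iff] at this ⊢
    exact p.integrable_comp this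
  · exact (congrArg p (h.2 a b)).trans (p.intervalIntegral_comp_comm (h.1 a b)).symm

theorem isPrimitiveOf_pi {u u' : ℝ → Fin 2 → ℂ}
    (h : ∀ i, IsPrimitiveOf (fun x ↦ u x i) (fun x ↦ u' x i)) : IsPrimitiveOf u u' := by
  have hi : ∀ a b, IntervalIntegrable u' volume a b := fun a b ↦ by
    rw [intervalIntegrable_iff]
    exact Integrable.of_eval fun i ↦ intervalIntegrable_iff.1 ((h i).1 a b)
  refine ⟨hi, fun a b ↦ ?_⟩
  ext i
  let p : (Fin 2 → ℂ) →L[ℝ] ℂ := ContinuousLinearMap.proj i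
  exact ((h i).2 a b).trans (p.intervalIntegral_comp_comm (hi a b))

theorem IsPrimitiveOf.wronskian {u u' v v' : ℝ → Fin 2 → ℂ} (hu : IsPrimitiveOf u u')
    (hv : IsPrimitiveOf v v') :
    IsPrimitiveOf (fun x ↦ wronskian (u x) (v x))
      (fun x ↦ NLSStep.wronskian (u' x) (v x) + NLSStep.wronskian (u x) (v' x)) :=
  (((hu.apply 0).mul (hv.apply 1)).sub ((hu.apply 1).mul (hv.apply 0))).congr_deriv
    fun x ↦ by simp only [NLSStep.wronskian]; ring

theorem IsPrimitiveOf.eq_of_deriv_zero {f f' : ℝ → ℂ} (h : IsPrimitiveOf f f')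
    (h0 : ∀ x, f' x = 0) (x y : ℝ) : f x = f y := by
  have := h.2 y x
  simp_rw [h0] at this
  simpa [sub_eq_zero] using this

theorem IsPrimitiveOf.mulVec {Φ Φ' : ℝ → Matrix (Fin 2) (Fin 2) ℂ} {ψ ψ' : ℝ → Fin 2 → ℂ}
    (hΦ : ∀ i j, IsPrimitiveOf (fun x ↦ Φ x i j) (fun x ↦ Φ' x i j)) (hψ : IsPrimitiveOf ψ ψ') :
    IsPrimitiveOf (fun x ↦ Φ x *ᵥ ψ x) (fun x ↦ Φ' x *ᵥ ψ x + Φ x *ᵥ ψ' x) := by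
  refine isPrimitiveOf_pi fun i ↦ ?_
  have h := ((hΦ i 0).mul (hψ.apply 0)).add ((hΦ i 1).mul (hψ.apply 1))
  simp only [Matrix.mulVec, dotProduct, Fin.sum_univ_two, Pi.add_apply]
  exact h.congr_deriv fun x ↦ by ring

/-- Solutions of a Volterra equation in the interaction picture `ψ = Φ⁻¹ φ`. -/
theorem SolvesVolterra.interaction {Φ Q : ℝ → Matrix (Fin 2) (Fin 2) ℂ} {j : Fin 2}
    {φ : ℝ → Fin 2 → ℂ} (h : SolvesVolterra Φ Q j φ) (hΦ : ∀ x, (Φ x).det = 1) :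
    (∀ x, IntegrableOn (fun y ↦ ((Φ y)⁻¹ * Q y) *ᵥ φ y) (Iic x)) ∧
    ∀ x, (Φ x)⁻¹ *ᵥ φ x = Pi.single j 1 + ∫ y in Iic x, ((Φ y)⁻¹ * Q y) *ᵥ φ y := by
  have hinv : ∀ x, (Φ x)⁻¹ * Φ x = 1 := fun x ↦ Matrix.nonsing_inv_mul _ (by simp [hΦ x])
  have hk : ∀ x y, mulVecL (Φ x)⁻¹ ((Φ x * (Φ y)⁻¹ * Q y) *ᵥ φ y) = ((Φ y)⁻¹ * Q y) *ᵥ φ y :=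
    fun x y ↦ by
      rw [mulVecL_apply, Matrix.mulVec_mulVec, ← Matrix.mul_assoc, ← Matrix.mul_assoc, hinv,
        Matrix.one_mul]
  refine ⟨fun x ↦ ?_, fun x ↦ ?_⟩
  · have := (mulVecL (Φ x)⁻¹).integrable_comp (h x).1
    simp only [hk] at this
    exact this
  · have hcol : mulVecL (Φ x)⁻¹ ((Φ x).col j) = Pi.single j 1 := by
      have : (Φ x).col j = Φ x *ᵥ Pi.single j 1 := by simp
      rw [mulVecL_apply, this, Matrix.mulVec_mulVec, hinv, Matrix.one_mulVec]
    have h2 := congrArg (mulVecL (Φ x)⁻¹) (h x).2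
    rw [map_add, ← ContinuousLinearMap.integral_comp_comm _ (h x).1, hcol] at h2
    simp only [hk] at h2
    exact h2

/-- The Volterra equation in differential form: `(Φ⁻¹φ)' = Φ⁻¹Qφ`. -/
theorem SolvesVolterra.isPrimitiveOf {Φ Q : ℝ → Matrix (Fin 2) (Fin 2) ℂ} {j : Fin 2}
    {φ : ℝ → Fin 2 → ℂ} (h : SolvesVolterra Φ Q j φ) (hΦ : ∀ x, (Φ x).det = 1) :
    IsPrimitiveOf (fun x ↦ (Φ x)⁻¹ *ᵥ φ x) (fun y ↦ ((Φ y)⁻¹ * Q y) *ᵥ φ y) := by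
  obtain ⟨h1, h2⟩ := h.interaction hΦ
  simp_rw [h2]
  exact isPrimitiveOf_integral_Iic h1 _

theorem SolvesVolterra.tendsto {Φ Q : ℝ → Matrix (Fin 2) (Fin 2) ℂ} {j : Fin 2}
    {φ : ℝ → Fin 2 → ℂ} (h : SolvesVolterra Φ Q j φ) (hΦ : ∀ x, (Φ x).det = 1) :
    Tendsto (fun x ↦ (Φ x)⁻¹ *ᵥ φ x) atBot (𝓝 (Pi.single j 1)) := by
  obtain ⟨h1, h2⟩ := h.interaction hΦ
  simp_rw [h2]
  simpa using tendsto_const_nhds.add (tendsto_setIntegral_Iic_atBot (h1 0))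

/-- Two solutions for the same column have vanishing Wronskian: it is constant, as the potential is
trace-free, and tends to `det (e_j, e_j) = 0` at `-∞`. -/
theorem SolvesVolterra.wronskian_eq_zero {Φ Q : ℝ → Matrix (Fin 2) (Fin 2) ℂ} {j : Fin 2}
    {φ χ : ℝ → Fin 2 → ℂ} (h : SolvesVolterra Φ Q j φ) (h' : SolvesVolterra Φ Q j χ)
    (hΦ : ∀ x, (Φ x).det = 1) (hQ : ∀ x, (Q x).trace = 0) (x : ℝ) :
    wronskian ((Φ x)⁻¹ *ᵥ φ x) ((Φ x)⁻¹ *ᵥ χ x) = 0 := by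
  have hc := ((h.isPrimitiveOf hΦ).wronskian (h'.isPrimitiveOf hΦ)).eq_of_deriv_zero fun x ↦ by
    rw [← Matrix.mulVec_mulVec, ← Matrix.mulVec_mulVec, wronskian_mulVec, wronskian_mulVec,
      ← mul_add, wronskian_mulVec_add, hQ, zero_mul, mul_zero]
  have ht : Tendsto (fun x ↦ wronskian ((Φ x)⁻¹ *ᵥ φ x) ((Φ x)⁻¹ *ᵥ χ x)) atBot
      (𝓝 (wronskian (Pi.single j 1) (Pi.single j 1))) := by
    have h1 := tendsto_pi_nhds.1 (h.tendsto hΦ)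
    have h2 := tendsto_pi_nhds.1 (h'.tendsto hΦ)
    exact ((h1 0).mul (h2 1)).sub ((h1 1).mul (h2 0))
  have h0 : wronskian (Pi.single j 1) (Pi.single j 1) = 0 := by
    simp only [wronskian]; ring
  rw [h0] at ht
  exact tendsto_nhds_unique
    (tendsto_const_nhds.congr fun y ↦ hc x y) ht

section Background

variable {β : ℝ} {S : Matrix (Fin 2) (Fin 2) ℂ} {ζ : ℂ} {q : ℝ → ℂ} {φ χ : ℝ → Fin 2 → ℂ}

/-- The normalization `e^{iζx} e^{-iβxσ₃}` as an operator. -/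
def normL (β : ℝ) (ζ : ℂ) (x : ℝ) : (Fin 2 → ℂ) →L[ℂ] (Fin 2 → ℂ) :=
  Complex.exp (Complex.I * ζ * x) • mulVecL (expσ₃ (-(Complex.I * β * x)))

theorem normL_apply (β : ℝ) (ζ : ℂ) (x : ℝ) (φ : ℝ → Fin 2 → ℂ) :
    normL β ζ x (φ x) = normalized β ζ φ x := rfl

/-- The inverse of the normalization. -/
def normLinv (β : ℝ) (ζ : ℂ) (x : ℝ) : (Fin 2 → ℂ) →L[ℂ] (Fin 2 → ℂ) :=
  Complex.exp (-(Complex.I * ζ * x)) • mulVecL (expσ₃ (Complex.I * β * x))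

theorem normLinv_normL (β : ℝ) (ζ : ℂ) (x : ℝ) (v : Fin 2 → ℂ) :
    normLinv β ζ x (normL β ζ x v) = v := by
  simp only [normL, normLinv, _root_.smul_apply, mulVecL_apply, Matrix.mulVec_smul,
    Matrix.mulVec_mulVec, expσ₃_mul, add_neg_cancel, expσ₃_zero, Matrix.one_mulVec, smul_smul,
    ← Complex.exp_add, neg_add_cancel, Complex.exp_zero, one_smul]

theorem normL_normLinv (β : ℝ) (ζ : ℂ) (x : ℝ) (v : Fin 2 → ℂ) :
    normL β ζ x (normLinv β ζ x v) = v := by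
  simp only [normL, normLinv, _root_.smul_apply, mulVecL_apply, Matrix.mulVec_smul,
    Matrix.mulVec_mulVec, expσ₃_mul, add_neg_cancel, neg_add_cancel, expσ₃_zero,
    Matrix.one_mulVec, smul_smul, ← Complex.exp_add, Complex.exp_zero, one_smul]

theorem normL_kernel (q : ℝ → ℂ) (φ : ℝ → Fin 2 → ℂ) (x y : ℝ) :
    normL β ζ x ((bgΦ β S ζ x * (bgΦ β S ζ y)⁻¹ * potential (q y)) *ᵥ φ y) =
      (mulVecL (projFst S) + expKer 0 ζ (x - y) • mulVecL (projSnd S))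
        (gaugedPotential β q y (normalized β ζ φ y)) :=
  normalized_kernel q φ x y

/-- The normalized solution solves a Volterra equation with a bounded kernel. -/
theorem SolvesVolterra.normalized_eq
    (h : SolvesVolterra (bgΦ β S ζ) (fun x ↦ potential (q x)) 0 φ) (x : ℝ) :
    normalized β ζ φ x = S.col 0 + ∫ y in Iic x,
      (mulVecL (projFst S) + expKer 0 ζ (x - y) • mulVecL (projSnd S))
        (gaugedPotential β q y (normalized β ζ φ y)) := by
  have h2 := congrArg (normL β ζ x) (h x).2
  rw [map_add, ← ContinuousLinearMap.integral_comp_comm _ (h x).1] at h2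
  simp only [normL_kernel] at h2
  rw [normL_apply] at h2
  rw [h2]
  congr 1
  exact normalized_bgΦ_col β S ζ x

/-- Solving the normalized equation on all half-lines yields a solution of the original one. -/
theorem exists_solvesVolterra (hζ : 0 ≤ ζ.im) (hq : ∀ X, IntegrableOn q (Iic X)) :
    ∃ φ, SolvesVolterra (bgΦ β S ζ) (fun x ↦ potential (q x)) 0 φ ∧
      ∀ X, IsVolterraSol (gaugedPotential β q) (mulVecL (projFst S)) (mulVecL (projSnd S)) ζ
        (S.col 0) X (normalized β ζ φ) := by
  have hV := fun X ↦ integrableOn_gaugedPotential (β := β) (hq X)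
  obtain ⟨w, hw⟩ := exists_forall_isVolterraSol hV (mulVecL (projFst S)) (mulVecL (projSnd S)) hζ
    (S.col 0)
  set φ : ℝ → Fin 2 → ℂ := fun x ↦ normLinv β ζ x (w x) with hφ
  have hn : normalized β ζ φ = w := by
    ext x : 1
    rw [← normL_apply, hφ, normL_normLinv]
  refine ⟨φ, fun x ↦ ?_, fun X ↦ hn ▸ hw X⟩
  have hk : ∀ y, (bgΦ β S ζ x * (bgΦ β S ζ y)⁻¹ * potential (q y)) *ᵥ φ y =
      normLinv β ζ x ((mulVecL (projFst S) + expKer 0 ζ (x - y) • mulVecL (projSnd S))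
        (gaugedPotential β q y (w y))) := fun y ↦ by
    rw [← hn, ← normL_kernel, normLinv_normL]
  have hi := (hw x).integrableOn hζ (hV x) le_rfl
  simp only [hk]
  refine ⟨(normLinv β ζ x).integrable_comp hi, ?_⟩
  rw [ContinuousLinearMap.integral_comp_comm _ hi, ← normLinv_normL β ζ x ((bgΦ β S ζ x).col 0),
    ← map_add]
  have : normL β ζ x ((bgΦ β S ζ x).col 0) = S.col 0 := normalized_bgΦ_col β S ζ x
  rw [this, ← (hw x).eq x le_rfl]

theorem continuous_bgΦ (β : ℝ) (S : Matrix (Fin 2) (Fin 2) ℂ) (ζ : ℂ) :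
    Continuous (bgΦ β S ζ) := by
  unfold bgΦ expσ₃
  fun_prop

theorem trace_potential (u : ℂ) : (potential u).trace = 0 := by
  simp [potential, Matrix.trace_fin_two]

/-- The first column of every solution is bounded at `-∞` after normalization. As the Wronskian with
the bounded solution vanishes, it is a multiple of that solution, and the factor tends to `1`. -/
theorem SolvesVolterra.isVolterraSol (hS : S.det = 1) (hζ : 0 ≤ ζ.im)
    (hq : ∀ X, IntegrableOn q (Iic X))
    (h : SolvesVolterra (bgΦ β S ζ) (fun x ↦ potential (q x)) 0 φ) (X : ℝ) :
    IsVolterraSol (gaugedPotential β q) (mulVecL (projFst S)) (mulVecL (projSnd S)) ζ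
      (S.col 0) X (normalized β ζ φ) := by
  obtain ⟨χ, hχ, hχw⟩ := exists_solvesVolterra (β := β) (S := S) hζ hq
  have hΦ : ∀ x, (bgΦ β S ζ x).det = 1 := det_bgΦ hS ζ
  have hinv : ∀ x, bgΦ β S ζ x * (bgΦ β S ζ x)⁻¹ = 1 :=
    fun x ↦ Matrix.mul_nonsing_inv _ (by simp [hΦ x])
  set u : ℝ → Fin 2 → ℂ := fun x ↦ (bgΦ β S ζ x)⁻¹ *ᵥ φ x with hu
  set v : ℝ → Fin 2 → ℂ := fun x ↦ (bgΦ β S ζ x)⁻¹ *ᵥ χ x with hv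
  have hφu : ∀ x, φ x = bgΦ β S ζ x *ᵥ u x := fun x ↦ by
    rw [hu]; simp only; rw [Matrix.mulVec_mulVec, hinv, Matrix.one_mulVec]
  have hχv : ∀ x, χ x = bgΦ β S ζ x *ᵥ v x := fun x ↦ by
    rw [hv]; simp only; rw [Matrix.mulVec_mulVec, hinv, Matrix.one_mulVec]
  -- `φ` and the bounded solution `χ` are proportional, with factor `u₀ / v₀`
  have hprop : ∀ x, v x 0 • normalized β ζ φ x = u x 0 • normalized β ζ χ x := fun x ↦ by
    have h1 := smul_eq_of_wronskian_eq_zero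
      (hχ.wronskian_eq_zero h hΦ (fun x ↦ trace_potential _) x)
    have h2 : normalized β ζ φ x = normL β ζ x (mulVecL (bgΦ β S ζ x) (u x)) := by
      rw [mulVecL_apply, ← hφu, normL_apply]
    have h3 : normalized β ζ χ x = normL β ζ x (mulVecL (bgΦ β S ζ x) (v x)) := by
      rw [mulVecL_apply, ← hχv, normL_apply]
    rw [h2, h3, ← map_smul, ← map_smul, ← map_smul, ← map_smul]
    exact congrArg _ (congrArg _ h1)
  have hcφ : Continuous φ := by
    have h1 := (continuous_bgΦ β S ζ).matrix_mulVec (h.isPrimitiveOf hΦ).continuous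
    exact h1.congr fun x ↦ (hφu x).symm
  have hcn : Continuous (normalized β ζ φ) := by
    have h1 : Continuous fun x : ℝ ↦ expσ₃ (-(Complex.I * β * x)) := by unfold expσ₃; fun_prop
    have h2 := h1.matrix_mulVec hcφ
    unfold normalized
    fun_prop
  refine ⟨hcn.continuousOn, ?_, fun t _ ↦ h.normalized_eq t⟩
  have hu0 : Tendsto (fun x ↦ u x 0) atBot (𝓝 1) := by
    exact tendsto_pi_nhds.1 (h.tendsto hΦ) 0
  have hv0 : Tendsto (fun x ↦ v x 0) atBot (𝓝 1) := by
    exact tendsto_pi_nhds.1 (hχ.tendsto hΦ) 0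
  have hev := (hu0.norm.eventually_lt_const (u := 2) (by norm_num)).and
    (hv0.norm.eventually_const_lt (u := 1 / 2) (by norm_num))
  obtain ⟨x₀, hx₀⟩ := eventually_atBot.1 hev
  obtain ⟨M, hM⟩ := (hχw x₀).bounded
  obtain ⟨M', hM'⟩ := (isCompact_Icc (a := x₀) (b := X)).exists_bound_of_continuousOn
    hcn.continuousOn
  refine ⟨max (4 * M) M', fun t ht ↦ ?_⟩
  rcases le_total t x₀ with h1 | h1
  · refine le_max_of_le_left ?_
    obtain ⟨h2, h3⟩ := hx₀ t h1
    have h4 := congrArg norm (hprop t)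
    rw [norm_smul, norm_smul] at h4
    have h5 := hM t h1
    have h6 := norm_nonneg (normalized β ζ φ t)
    have h7 := norm_nonneg (normalized β ζ χ t)
    nlinarith
  · exact le_max_of_le_right (hM' t ⟨h1, ht⟩)

theorem SolvesVolterra.unique (hS : S.det = 1) (hζ : 0 ≤ ζ.im)
    (hq : ∀ X, IntegrableOn q (Iic X))
    (h : SolvesVolterra (bgΦ β S ζ) (fun x ↦ potential (q x)) 0 φ)
    (h' : SolvesVolterra (bgΦ β S ζ) (fun x ↦ potential (q x)) 0 χ) : φ = χ := by
  ext x : 1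
  have h1 := (h.isVolterraSol hS hζ hq x).unique (h'.isVolterraSol hS hζ hq x) hζ
    (integrableOn_gaugedPotential (hq x)) le_rfl
  rw [← normLinv_normL β ζ x (φ x), ← normLinv_normL β ζ x (χ x), normL_apply, normL_apply, h1]

theorem existsUnique_solvesVolterra (hS : S.det = 1) (hζ : 0 ≤ ζ.im)
    (hq : ∀ X, IntegrableOn q (Iic X)) :
    ∃! φ, SolvesVolterra (bgΦ β S ζ) (fun x ↦ potential (q x)) 0 φ := by
  obtain ⟨φ, hφ, -⟩ := exists_solvesVolterra (β := β) (S := S) hζ hq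
  exact ⟨φ, hφ, fun χ hχ ↦ hχ.unique hS hζ hq hφ⟩

/-- Asymptotics of the first column: `e^{iζx} e^{-iβxσ₃} φ(x)` tends to the first column of `S`. -/
theorem SolvesVolterra.tendsto_normalized (hS : S.det = 1) (hζ : 0 ≤ ζ.im)
    (hq : ∀ X, IntegrableOn q (Iic X))
    (h : SolvesVolterra (bgΦ β S ζ) (fun x ↦ potential (q x)) 0 φ) :
    Tendsto (normalized β ζ φ) atBot (𝓝 (S.col 0)) :=
  (h.isVolterraSol hS hζ hq 0).tendsto_atBot hζ (integrableOn_gaugedPotential (hq 0))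

/-- If the background eigenfunction satisfies the Dirac system with matrix `A`, the Volterra
solution satisfies the one with matrix `A + U`, where `U` is the potential. -/
theorem SolvesVolterra.isPrimitiveOf_dirac (hS : S.det = 1)
    (h : SolvesVolterra (bgΦ β S ζ) (fun x ↦ potential (q x)) 0 φ)
    {A : ℝ → Matrix (Fin 2) (Fin 2) ℂ} (hA : ∀ i j, IsPrimitiveOf (fun x ↦ bgΦ β S ζ x i j)
      (fun x ↦ (A x * bgΦ β S ζ x) i j)) :
    IsPrimitiveOf φ (fun x ↦ (A x + potential (q x)) *ᵥ φ x) := by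
  have hΦ : ∀ x, (bgΦ β S ζ x).det = 1 := det_bgΦ hS ζ
  have hinv : ∀ x, bgΦ β S ζ x * (bgΦ β S ζ x)⁻¹ = 1 :=
    fun x ↦ Matrix.mul_nonsing_inv _ (by simp [hΦ x])
  have h1 := IsPrimitiveOf.mulVec (Φ' := fun x ↦ A x * bgΦ β S ζ x) hA (h.isPrimitiveOf hΦ)
  have h2 : (fun x ↦ bgΦ β S ζ x *ᵥ (bgΦ β S ζ x)⁻¹ *ᵥ φ x) = φ := by
    ext x : 1
    rw [Matrix.mulVec_mulVec, hinv, Matrix.one_mulVec]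
  rw [h2] at h1
  refine h1.congr_deriv fun x ↦ ?_
  rw [Matrix.mulVec_mulVec, Matrix.mulVec_mulVec, Matrix.mul_assoc,
    ← Matrix.mul_assoc (bgΦ β S ζ x), hinv, Matrix.mul_one, Matrix.one_mul, Matrix.add_mulVec]

end Background

end NLSStep

end

/-! ### The branches of the square root and the fourth root -/

noncomputable section

open Filter Topology

namespace NLSStep

/-- On the closed upper half-plane, the principal logarithm is a branch that is analytic across the
negative real axis. -/
theorem log_eq_log_neg_I_mul {z : ℂ} (hz : 0 ≤ z.im) (h0 : z ≠ 0) :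
    Complex.log z = Complex.log (-Complex.I * z) + Complex.I * (Real.pi / 2) := by
  have h1 : -Complex.I * z ≠ 0 := mul_ne_zero (by simp) h0
  have h2 : Complex.exp (Complex.log (-Complex.I * z) + Complex.I * (Real.pi / 2)) = z := by
    rw [Complex.exp_add, Complex.exp_log h1, mul_comm Complex.I (_ / _),
      Complex.exp_pi_div_two_mul_I]
    linear_combination (-z) * Complex.I_mul_I
  have h3 : |(-Complex.I * z).arg| ≤ Real.pi / 2 :=
    Complex.abs_arg_le_pi_div_two_iff.2 (by simpa using hz)
  rw [abs_le] at h3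
  have h4 : (Complex.log (-Complex.I * z) + Complex.I * (Real.pi / 2)).im =
      (-Complex.I * z).arg + Real.pi / 2 := by
    have : (Real.pi / 2 : ℂ) = ((Real.pi / 2 : ℝ) : ℂ) := by push_cast; rfl
    rw [this]
    simp [Complex.log_im]
  conv_lhs => rw [← h2]
  exact Complex.log_exp (by rw [h4]; linarith [Real.pi_pos]) (by rw [h4]; linarith [Real.pi_pos])

/-- The principal logarithm is smooth up to the boundary from the closed upper half-plane. -/
theorem contDiffOn_log_sub {N : ℕ} (c : ℝ) :
    ContDiffOn ℂ N (fun k : ℂ ↦ Complex.log (k - c)) ({k | 0 ≤ k.im} \ {(c : ℂ)}) := by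
  have h : ∀ k ∈ ({k | 0 ≤ k.im} \ {(c : ℂ)} : Set ℂ), 0 ≤ (k - c).im ∧ k - c ≠ 0 := fun k hk ↦
    ⟨by simpa using hk.1, sub_ne_zero.2 (by simpa using hk.2)⟩
  refine ContDiffOn.congr (f := fun k : ℂ ↦
    Complex.log (-Complex.I * (k - c)) + Complex.I * (Real.pi / 2)) ?_ fun k hk ↦
      log_eq_log_neg_I_mul (h k hk).1 (h k hk).2
  refine ContDiffOn.add ?_ contDiffOn_const
  intro k hk
  refine (Complex.contDiffAt_log ?_).comp_contDiffWithinAt k (by fun_prop)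
  obtain ⟨h1, h2⟩ := h k hk
  rw [Complex.mem_slitPlane_iff]
  rcases h1.lt_or_eq with h3 | h3
  · left; simpa using h3
  · right
    intro h4
    exact h2 (Complex.ext (by simpa [sub_eq_zero, eq_comm] using h4) h3.symm)

section Branches

variable {α β : ℝ} {k : ℂ}

theorem sub_E₁_ne_zero (hk : k ∈ closedUpper α β) : k - E₁ α β ≠ 0 :=
  sub_ne_zero.2 fun h ↦ hk.2 (by simp [h])

theorem sub_E₂_ne_zero (hk : k ∈ closedUpper α β) : k - E₂ α β ≠ 0 :=
  sub_ne_zero.2 fun h ↦ hk.2 (by simp [h])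

theorem arg_mem_of_im_nonneg {z : ℂ} (hz : 0 ≤ z.im) : 0 ≤ z.arg ∧ z.arg ≤ Real.pi :=
  ⟨Complex.arg_nonneg_iff.2 hz, Complex.arg_le_pi z⟩

theorem im_sub_real (k : ℂ) (c : ℝ) : (k - c).im = k.im := by simp

/-- On the closed upper half-plane both arguments lie in `[0, π]`, and their difference is not `-π`,
as this would need `k - E₂ > 0 > k - E₁`. So it is the principal argument of the quotient. -/
theorem log_quot (hα : 0 < α) (hk : k ∈ closedUpper α β) :
    Complex.log ((k - E₂ α β) / (k - E₁ α β)) =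
      Complex.log (k - E₂ α β) - Complex.log (k - E₁ α β) := by
  have h1 := arg_mem_of_im_nonneg (z := k - E₁ α β) (by rw [im_sub_real]; exact hk.1)
  have h2 := arg_mem_of_im_nonneg (z := k - E₂ α β) (by rw [im_sub_real]; exact hk.1)
  have h3 : -Real.pi < (k - E₂ α β).arg - (k - E₁ α β).arg := by
    by_contra hcon
    have h4 : (k - E₂ α β).arg = 0 := by linarith
    have h5 : (k - E₁ α β).arg = Real.pi := by linarith
    rw [Complex.arg_eq_pi_iff] at h5
    rw [Complex.arg_eq_zero_iff] at h4
    have h6 := h5.1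
    have h7 := h4.1
    simp only [Complex.sub_re, Complex.ofReal_re, E₁, E₂] at h6 h7
    linarith
  rw [← Complex.exp_log (sub_E₁_ne_zero hk), ← Complex.exp_log (sub_E₂_ne_zero hk),
    ← Complex.exp_sub, Complex.log_exp, Complex.exp_log (sub_E₁_ne_zero hk),
    Complex.exp_log (sub_E₂_ne_zero hk)]
  · simpa [Complex.log_im] using h3
  · simp only [Complex.sub_im, Complex.log_im]
    linarith

theorem quartΔ_eq (hα : 0 < α) (hk : k ∈ closedUpper α β) :
    quartΔ α β k =
      Complex.exp ((Complex.log (k - E₂ α β) - Complex.log (k - E₁ α β)) * (1 / 4)) := by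
  rw [quartΔ, Complex.cpow_def_of_ne_zero
    (div_ne_zero (sub_E₂_ne_zero hk) (sub_E₁_ne_zero hk)), log_quot hα hk]

theorem radX_eq (hk : k ∈ closedUpper α β) :
    radX α β k =
      Complex.exp ((Complex.log (k - E₁ α β) + Complex.log (k - E₂ α β)) * (1 / 2)) := by
  rw [radX, Complex.cpow_def_of_ne_zero (sub_E₁_ne_zero hk),
    Complex.cpow_def_of_ne_zero (sub_E₂_ne_zero hk), ← Complex.exp_add, add_mul]

theorem quartΔ_ne_zero (hα : 0 < α) (hk : k ∈ closedUpper α β) : quartΔ α β k ≠ 0 := by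
  rw [quartΔ_eq hα hk]; exact Complex.exp_ne_zero _

theorem radX_mul_quartΔ_sq (hα : 0 < α) (hk : k ∈ closedUpper α β) :
    radX α β k * quartΔ α β k ^ 2 = k - E₂ α β := by
  rw [quartΔ_eq hα hk, radX_eq hk, ← Complex.exp_nat_mul, ← Complex.exp_add]
  conv_rhs => rw [← Complex.exp_log (sub_E₂_ne_zero hk)]
  congr 1
  push_cast
  ring

theorem radX_eq_quartΔ_sq_mul (hα : 0 < α) (hk : k ∈ closedUpper α β) :
    radX α β k = quartΔ α β k ^ 2 * (k - E₁ α β) := by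
  have h := Complex.exp_log (sub_E₁_ne_zero hk)
  rw [quartΔ_eq hα hk, radX_eq hk, ← Complex.exp_nat_mul]
  conv_rhs => rw [← h]
  rw [← Complex.exp_add]
  congr 1
  rw [h]
  push_cast
  ring

/-- The argument of `X` is the mean of those of `k - E₁` and `k - E₂`. -/
theorem radX_im (hk : k ∈ closedUpper α β) :
    (radX α β k).im = ‖radX α β k‖ * Real.sin (((k - E₁ α β).arg + (k - E₂ α β).arg) / 2) := by
  have h1 : ((Complex.log (k - E₁ α β) + Complex.log (k - E₂ α β)) * (1 / 2)).im =
      ((k - E₁ α β).arg + (k - E₂ α β).arg) / 2 := by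
    have : (1 / 2 : ℂ) = ((1 / 2 : ℝ) : ℂ) := by push_cast; rfl
    rw [this, Complex.im_mul_ofReal]
    simp only [Complex.add_im, Complex.log_im]
    ring
  rw [radX_eq hk, Complex.exp_im, Complex.norm_exp, h1]

theorem radX_im_nonneg (hk : k ∈ closedUpper α β) : 0 ≤ (radX α β k).im := by
  rw [radX_im hk]
  have h1 := arg_mem_of_im_nonneg (z := k - E₁ α β) (by rw [im_sub_real]; exact hk.1)
  have h2 := arg_mem_of_im_nonneg (z := k - E₂ α β) (by rw [im_sub_real]; exact hk.1)
  exact mul_nonneg (norm_nonneg _) (Real.sin_nonneg_of_nonneg_of_le_pi (by linarith) (by linarith))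

theorem radX_ne_zero (hk : k ∈ closedUpper α β) : radX α β k ≠ 0 := by
  rw [radX_eq hk]; exact Complex.exp_ne_zero _

theorem radX_im_pos (hk : k ∈ closedUpper α β) (h : 0 < k.im) : 0 < (radX α β k).im := by
  rw [radX_im hk]
  have harg : ∀ c : ℝ, 0 < (k - c).arg ∧ (k - c).arg < Real.pi := fun c ↦ by
    have him : (k - c).im = k.im := im_sub_real k c
    have h1 := arg_mem_of_im_nonneg (z := k - c) (by rw [him]; exact h.le)
    refine ⟨h1.1.lt_of_ne fun h0 ↦ ?_, h1.2.lt_of_ne fun h0 ↦ ?_⟩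
    · have := (Complex.arg_eq_zero_iff.1 h0.symm).2
      rw [him] at this; exact h.ne' this
    · have := (Complex.arg_eq_pi_iff.1 h0).2
      rw [him] at this; exact h.ne' this
  have h1 := harg (E₁ α β)
  have h2 := harg (E₂ α β)
  exact mul_pos (norm_pos_iff.2 (radX_ne_zero hk))
    (Real.sin_pos_of_pos_of_lt_pi (by linarith) (by linarith))

theorem ofReal_mem_closedUpper {k : ℝ} (h1 : k ≠ E₁ α β) (h2 : k ≠ E₂ α β) :
    (k : ℂ) ∈ closedUpper α β := by
  refine ⟨by simp, ?_⟩
  simp [Complex.ofReal_inj, h1, h2]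

theorem arg_ofReal_sub_of_lt {k c : ℝ} (h : c < k) : ((k : ℂ) - c).arg = 0 := by
  rw [← Complex.ofReal_sub, Complex.arg_ofReal_of_nonneg (by linarith)]

theorem arg_ofReal_sub_of_gt {k c : ℝ} (h : k < c) : ((k : ℂ) - c).arg = Real.pi := by
  rw [← Complex.ofReal_sub, Complex.arg_ofReal_of_neg (by linarith)]

theorem radX_im_pos_of_mem_cut {k : ℝ} (h1 : E₁ α β < k) (h2 : k < E₂ α β) :
    0 < (radX α β k).im := by
  have hk := ofReal_mem_closedUpper h1.ne' h2.ne
  rw [radX_im hk, arg_ofReal_sub_of_lt h1, arg_ofReal_sub_of_gt h2, zero_add, Real.sin_pi_div_two,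
    mul_one]
  exact norm_pos_iff.2 (radX_ne_zero hk)

/-- Off the cut, the arguments of `k - E₁` and `k - E₂` agree, so `X` and `Δ` are real. -/
theorem arg_eq_arg_of_notMem (hα : 0 < α) {k : ℝ} (hk : k ∉ Icc (E₁ α β) (E₂ α β)) :
    ((k : ℂ) - E₁ α β).arg = ((k : ℂ) - E₂ α β).arg ∧
      Real.sin ((((k : ℂ) - E₁ α β).arg + ((k : ℂ) - E₂ α β).arg) / 2) = 0 := by
  have hE : E₁ α β < E₂ α β := by simp only [E₁, E₂]; linarith
  rcases lt_or_ge k (E₁ α β) with h | h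
  · rw [arg_ofReal_sub_of_gt h, arg_ofReal_sub_of_gt (h.trans hE)]
    simp
  · have h2 : E₂ α β < k := by
      by_contra hcon
      exact hk ⟨h, not_lt.1 hcon⟩
    rw [arg_ofReal_sub_of_lt (hE.trans h2), arg_ofReal_sub_of_lt h2]
    simp

theorem radX_im_of_notMem (hα : 0 < α) {k : ℝ} (hk : k ∉ Icc (E₁ α β) (E₂ α β))
    (hk' : (k : ℂ) ∈ closedUpper α β) : (radX α β k).im = 0 := by
  rw [radX_im hk', (arg_eq_arg_of_notMem hα hk).2, mul_zero]

theorem conj_quartΔ_of_notMem (hα : 0 < α) {k : ℝ} (hk : k ∉ Icc (E₁ α β) (E₂ α β))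
    (hk' : (k : ℂ) ∈ closedUpper α β) : conj (quartΔ α β k) = quartΔ α β k := by
  rw [quartΔ_eq hα hk', ← Complex.exp_conj]
  congr 1
  rw [Complex.conj_eq_iff_im]
  have : (1 / 4 : ℂ) = ((1 / 4 : ℝ) : ℂ) := by push_cast; rfl
  rw [this, Complex.im_mul_ofReal, Complex.sub_im, Complex.log_im, Complex.log_im,
    (arg_eq_arg_of_notMem hα hk).1]
  ring

theorem contDiffOn_radX (N : ℕ) : ContDiffOn ℂ N (radX α β) (closedUpper α β) := by
  refine ContDiffOn.congr (f := fun k ↦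
    Complex.exp ((Complex.log (k - E₁ α β) + Complex.log (k - E₂ α β)) * (1 / 2))) ?_
    fun k hk ↦ radX_eq hk
  refine (ContDiffOn.mul (ContDiffOn.add ?_ ?_) contDiffOn_const).cexp
  · exact (contDiffOn_log_sub _).mono (sdiff_subset_sdiff_right (by simp))
  · exact (contDiffOn_log_sub _).mono (sdiff_subset_sdiff_right (by simp))

theorem contDiffOn_quartΔ (hα : 0 < α) (N : ℕ) :
    ContDiffOn ℂ N (quartΔ α β) (closedUpper α β) := by
  refine ContDiffOn.congr (f := fun k ↦
    Complex.exp ((Complex.log (k - E₂ α β) - Complex.log (k - E₁ α β)) * (1 / 4))) ?_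
    fun k hk ↦ quartΔ_eq hα hk
  refine (ContDiffOn.mul (ContDiffOn.sub ?_ ?_) contDiffOn_const).cexp
  · exact (contDiffOn_log_sub _).mono (sdiff_subset_sdiff_right (by simp))
  · exact (contDiffOn_log_sub _).mono (sdiff_subset_sdiff_right (by simp))

end Branches

theorem det_sb {Δ : ℂ} (h : Δ ≠ 0) : (sb Δ).det = 1 := by
  simp only [sb, Matrix.det_fin_two, Matrix.smul_apply, smul_eq_mul, Matrix.of_apply,
    Matrix.cons_val', Matrix.cons_val_zero, Matrix.cons_val_one, Matrix.cons_val_fin_one]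
  linear_combination (1 / 4 * (Δ - Δ⁻¹) ^ 2) * Complex.I_mul_I + mul_inv_cancel₀ h

/-- The matrix of the Dirac system `φ' = (-ikσ₃ + U) φ`. -/
def dirac (k u : ℂ) : Matrix (Fin 2) (Fin 2) ℂ := !![-(Complex.I * k), u; conj u, Complex.I * k]

theorem dirac_add_potential (k u v : ℂ) : dirac k u + potential v = dirac k (u + v) := by
  simp only [dirac, potential]
  ext i j
  fin_cases i <;> fin_cases j <;> simp

theorem bgΦ_eq (β : ℝ) (S : Matrix (Fin 2) (Fin 2) ℂ) (ζ : ℂ) (x : ℝ) :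
    bgΦ β S ζ x =
      !![Complex.exp ((Complex.I * β - Complex.I * ζ) * x) * S 0 0,
          Complex.exp ((Complex.I * β + Complex.I * ζ) * x) * S 0 1;
        Complex.exp ((-(Complex.I * β) - Complex.I * ζ) * x) * S 1 0,
          Complex.exp ((-(Complex.I * β) + Complex.I * ζ) * x) * S 1 1] := by
  rw [bgΦ, Matrix.eta_fin_two S]
  simp only [expσ₃, Matrix.mul_fin_two, mul_zero, zero_mul, add_zero, zero_add, neg_neg,
    Matrix.of_apply, Matrix.cons_val', Matrix.cons_val_zero, Matrix.cons_val_one,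
    Matrix.cons_val_fin_one]
  congr 1
  simp only [mul_right_comm _ (S _ _), ← Complex.exp_add]
  ring_nf

/-- The background eigenfunctions satisfy a Dirac system with potential `u e^{2iβx}`, once
`S` satisfies the corresponding algebraic relations. -/
theorem isPrimitiveOf_bgΦ {β c : ℝ} {S : Matrix (Fin 2) (Fin 2) ℂ} {ζ k : ℂ}
    (h00 : Complex.I * (β - ζ + k) * S 0 0 = c * S 1 0)
    (h01 : Complex.I * (β + ζ + k) * S 0 1 = c * S 1 1)
    (h10 : Complex.I * (-β - ζ - k) * S 1 0 = c * S 0 0)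
    (h11 : Complex.I * (-β + ζ - k) * S 1 1 = c * S 0 1) (i j : Fin 2) :
    IsPrimitiveOf (fun x ↦ bgΦ β S ζ x i j) (fun x ↦ (dirac k (u₀b c β x) * bgΦ β S ζ x) i j) := by
  have hexp : ∀ z s : ℂ, IsPrimitiveOf (fun x : ℝ ↦ Complex.exp (z * x) * s)
      (fun x : ℝ ↦ z * (Complex.exp (z * x) * s)) := fun z s ↦ by
    refine .of_hasDerivAt (fun x ↦ ?_) (by fun_prop)
    have h1 : HasDerivAt (fun x : ℝ ↦ z * (x : ℂ)) z x := by
      simpa using (Complex.ofRealCLM.hasDerivAt (x := x)).const_mul z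
    exact (h1.cexp.mul_const s).congr_deriv (by ring)
  have hconj : ∀ x : ℝ, conj (u₀b c β x) = c * Complex.exp (-(2 * Complex.I * β * x)) := fun x ↦ by
    rw [u₀b, map_mul, ← Complex.exp_conj]
    simp [Complex.conj_ofNat]
  have he : ∀ (x : ℝ) (z w v : ℂ), z + w = v → Complex.exp (v * x) =
      Complex.exp (z * x) * Complex.exp (w * x) := fun x z w v h ↦ by
    rw [← Complex.exp_add, ← h, add_mul]
  simp only [Matrix.mul_apply, Fin.sum_univ_two]
  fin_cases i <;> fin_cases j <;>
    simp only [Fin.zero_eta, Fin.mk_one, bgΦ_eq, dirac, Matrix.of_apply, Matrix.cons_val',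
      Matrix.cons_val_zero, Matrix.cons_val_one, Matrix.cons_val_fin_one, hconj]
  · refine (hexp _ _).congr_deriv fun x ↦ ?_
    have h := he x (2 * Complex.I * β) (-(Complex.I * β) - Complex.I * ζ)
      (Complex.I * β - Complex.I * ζ) (by ring)
    rw [u₀b, h]
    linear_combination (Complex.exp (2 * Complex.I * β * x) *
      Complex.exp ((-(Complex.I * β) - Complex.I * ζ) * x)) * h00
  · refine (hexp _ _).congr_deriv fun x ↦ ?_
    have h := he x (2 * Complex.I * β) (-(Complex.I * β) + Complex.I * ζ)
      (Complex.I * β + Complex.I * ζ) (by ring)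
    rw [u₀b, h]
    linear_combination (Complex.exp (2 * Complex.I * β * x) *
      Complex.exp ((-(Complex.I * β) + Complex.I * ζ) * x)) * h01
  · refine (hexp _ _).congr_deriv fun x ↦ ?_
    have h := he x (-(2 * Complex.I * β)) (Complex.I * β - Complex.I * ζ)
      (-(Complex.I * β) - Complex.I * ζ) (by ring)
    rw [h, neg_mul]
    linear_combination (Complex.exp (-(2 * Complex.I * β * x)) *
      Complex.exp ((Complex.I * β - Complex.I * ζ) * x)) * h10
  · refine (hexp _ _).congr_deriv fun x ↦ ?_
    have h := he x (-(2 * Complex.I * β)) (Complex.I * β + Complex.I * ζ)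
      (-(Complex.I * β) + Complex.I * ζ) (by ring)
    rw [h, neg_mul]
    linear_combination (Complex.exp (-(2 * Complex.I * β * x)) *
      Complex.exp ((Complex.I * β + Complex.I * ζ) * x)) * h11

end NLSStep

end

/-! ### Symmetries -/

noncomputable section

open Filter Topology

namespace NLSStep

/-- The symmetry `v ↦ σ₁ v̄` of vectors. -/
def flipVec : (Fin 2 → ℂ) →L[ℝ] (Fin 2 → ℂ) :=
  ContinuousLinearMap.pi fun i ↦
    Complex.conjCLE.toContinuousLinearMap.comp (ContinuousLinearMap.proj (i + 1))

@[simp] theorem flipVec_zero (v : Fin 2 → ℂ) : flipVec v 0 = conj (v 1) := rfl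

@[simp] theorem flipVec_one (v : Fin 2 → ℂ) : flipVec v 1 = conj (v 0) := rfl

theorem flipVec_flipVec (v : Fin 2 → ℂ) : flipVec (flipVec v) = v := by
  ext i; fin_cases i <;> simp

/-- The symmetry `M ↦ σ₁ M̄ σ₁` of matrices. -/
def flipMat (M : Matrix (Fin 2) (Fin 2) ℂ) : Matrix (Fin 2) (Fin 2) ℂ :=
  !![conj (M 1 1), conj (M 1 0); conj (M 0 1), conj (M 0 0)]

theorem flipMat_mul (M N : Matrix (Fin 2) (Fin 2) ℂ) :
    flipMat (M * N) = flipMat M * flipMat N := by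
  ext i j
  fin_cases i <;> fin_cases j <;> simp [flipMat, Matrix.mul_apply, Fin.sum_univ_two, add_comm]

theorem flipMat_flipMat (M : Matrix (Fin 2) (Fin 2) ℂ) : flipMat (flipMat M) = M := by
  ext i j
  fin_cases i <;> fin_cases j <;> simp [flipMat]

theorem flipMat_one : flipMat 1 = 1 := by
  ext i j
  fin_cases i <;> fin_cases j <;> simp [flipMat]

theorem det_flipMat (M : Matrix (Fin 2) (Fin 2) ℂ) : (flipMat M).det = conj M.det := by
  simp [flipMat, Matrix.det_fin_two]; ring

theorem flipMat_inv {M : Matrix (Fin 2) (Fin 2) ℂ} (hM : M.det = 1) :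
    flipMat M⁻¹ = (flipMat M)⁻¹ :=
  (Matrix.inv_eq_left_inv (by
    rw [← flipMat_mul, Matrix.nonsing_inv_mul _ (by simp [hM]), flipMat_one])).symm

theorem flipMat_mulVec (M : Matrix (Fin 2) (Fin 2) ℂ) (v : Fin 2 → ℂ) :
    flipMat M *ᵥ flipVec v = flipVec (M *ᵥ v) := by
  ext i
  fin_cases i <;> simp [flipMat, Matrix.mulVec, dotProduct, Fin.sum_univ_two, add_comm]

theorem flipMat_col (M : Matrix (Fin 2) (Fin 2) ℂ) (j : Fin 2) :
    (flipMat M).col (j + 1) = flipVec (M.col j) := by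
  ext i
  fin_cases i <;> fin_cases j <;> simp [flipMat]

theorem flipMat_potential (u : ℂ) : flipMat (potential u) = potential u := by
  ext i j
  fin_cases i <;> fin_cases j <;> simp [flipMat, potential]

theorem flipMat_dirac (k u : ℂ) : flipMat (dirac k u) = dirac (conj k) u := by
  ext i j
  fin_cases i <;> fin_cases j <;> simp [flipMat, dirac]

theorem flipMat_expσ₃ (z : ℂ) : flipMat (expσ₃ z) = expσ₃ (-conj z) := by
  ext i j
  fin_cases i <;> fin_cases j <;> simp [flipMat, expσ₃, ← Complex.exp_conj]

theorem flipMat_sb (Δ : ℂ) : flipMat (sb Δ) = sb (conj Δ) := by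
  have h2 : conj (2⁻¹ : ℂ) = 2⁻¹ := by rw [map_inv₀, Complex.conj_ofNat]
  ext i j
  fin_cases i <;> fin_cases j <;> simp [flipMat, sb, h2]

/-- The symmetry maps solutions for one column to solutions for the other one. -/
theorem SolvesVolterra.flip {Φ Q : ℝ → Matrix (Fin 2) (Fin 2) ℂ} {j : Fin 2}
    {φ : ℝ → Fin 2 → ℂ} (h : SolvesVolterra Φ Q j φ) (hΦ : ∀ x, (Φ x).det = 1) :
    SolvesVolterra (fun x ↦ flipMat (Φ x)) (fun x ↦ flipMat (Q x)) (j + 1)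
      (fun x ↦ flipVec (φ x)) := by
  intro x
  have hk : ∀ y, (flipMat (Φ x) * (flipMat (Φ y))⁻¹ * flipMat (Q y)) *ᵥ flipVec (φ y) =
      flipVec ((Φ x * (Φ y)⁻¹ * Q y) *ᵥ φ y) := fun y ↦ by
    rw [← flipMat_inv (hΦ y), ← flipMat_mul, ← flipMat_mul, flipMat_mulVec]
  simp only [hk]
  refine ⟨flipVec.integrable_comp (h x).1, ?_⟩
  rw [flipVec.integral_comp_comm (h x).1, flipMat_col, ← map_add, ← (h x).2]

theorem potential_sub (u v : ℂ) : potential u - potential v = potential (u - v) := by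
  ext i j
  fin_cases i <;> fin_cases j <;> simp [potential]

/-- The symmetry exchanges the boundary values of the background eigenfunction from the two
half-planes. -/
theorem flipMat_φb (α β : ℝ) (k : ℂ) (x : ℝ) :
    flipMat (φb α β k x) = φbLower α β (conj k) x := by
  have h1 : -conj (Complex.I * β * x) = Complex.I * β * x := by simp
  have h2 : -conj (-(Complex.I * radX α β k * x)) =
      -(Complex.I * conj (radX α β k) * x) := by simp
  rw [φb, flipMat_mul, flipMat_mul, flipMat_expσ₃, flipMat_expσ₃, flipMat_sb, h1, h2, φbLower,
    quartΔLower, radXLower, Complex.conj_conj]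

theorem solvesLeft_iff {α β : ℝ} {u₀ : ℝ → ℂ} {Φ : ℝ → Matrix (Fin 2) (Fin 2) ℂ} {j : Fin 2}
    {φ : ℝ → Fin 2 → ℂ} : SolvesLeft α β u₀ Φ j φ ↔
      SolvesVolterra Φ (fun x ↦ potential (u₀ x - u₀b α β x)) j φ := by
  simp only [SolvesLeft, SolvesVolterra, potential_sub]

theorem φb_eq_bgΦ (α β : ℝ) (k : ℂ) :
    φb α β k = bgΦ β (sb (quartΔ α β k)) (radX α β k) := rfl

theorem solvesLeft_flip {α β : ℝ} {u₀ : ℝ → ℂ} {k : ℂ} {φ : ℝ → Fin 2 → ℂ}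
    (hd : quartΔ α β k ≠ 0) (h : SolvesLeft α β u₀ (φb α β k) 0 φ) :
    SolvesLeft α β u₀ (φbLower α β (conj k)) 1 (fun x ↦ flipVec (φ x)) := by
  rw [solvesLeft_iff] at h ⊢
  have := h.flip fun x ↦ by rw [φb_eq_bgΦ]; exact det_bgΦ (det_sb hd) _ x
  simp only [flipMat_potential, flipMat_φb, zero_add] at this
  exact this

theorem solvesLeft_of_flip {α β : ℝ} {u₀ : ℝ → ℂ} {k : ℂ} {φ : ℝ → Fin 2 → ℂ}
    (hd : quartΔ α β k ≠ 0) (h : SolvesLeft α β u₀ (φbLower α β (conj k)) 1 φ) :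
    SolvesLeft α β u₀ (φb α β k) 0 (fun x ↦ flipVec (φ x)) := by
  rw [solvesLeft_iff] at h ⊢
  have := h.flip fun x ↦ by
    rw [← flipMat_φb, det_flipMat, φb_eq_bgΦ, det_bgΦ (det_sb hd) _ x, map_one]
  simp only [flipMat_potential, ← flipMat_φb, flipMat_flipMat] at this
  exact this

theorem integrableOn_Iic_comp_neg {E : Type*} [NormedAddCommGroup E] {f : ℝ → E} {c : ℝ}
    (h : IntegrableOn f (Ici (-c))) : IntegrableOn (fun y ↦ f (-y)) (Iic c) := by
  have := (integrable_indicator_iff measurableSet_Ici).2 h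
  refine (integrable_indicator_iff measurableSet_Iic).1
    (this.comp_neg.congr (.of_forall fun y ↦ ?_))
  by_cases hy : y ≤ c
  · simp [hy]
  · simp [hy]

/-- The exchange of the two components. -/
def swapL : (Fin 2 → ℂ) →L[ℂ] (Fin 2 → ℂ) :=
  ContinuousLinearMap.pi fun i ↦ ContinuousLinearMap.proj (i + 1)

@[simp] theorem swapL_zero (v : Fin 2 → ℂ) : swapL v 0 = v 1 := rfl

@[simp] theorem swapL_one (v : Fin 2 → ℂ) : swapL v 1 = v 0 := rfl

theorem swapL_swapL (v : Fin 2 → ℂ) : swapL (swapL v) = v := by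
  ext i; fin_cases i <;> rfl

/-- Reflection of the line together with a swap of the components. It carries the problem at `+∞`
to a problem at `-∞`. -/
def reflect (φ : ℝ → Fin 2 → ℂ) (y : ℝ) : Fin 2 → ℂ := swapL (φ (-y))

theorem reflect_zero (φ : ℝ → Fin 2 → ℂ) (y : ℝ) : reflect φ y 0 = φ (-y) 1 := rfl

theorem reflect_one (φ : ℝ → Fin 2 → ℂ) (y : ℝ) : reflect φ y 1 = φ (-y) 0 := rfl

theorem reflect_reflect (φ : ℝ → Fin 2 → ℂ) : reflect (reflect φ) = φ := by
  ext y : 1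
  rw [reflect, reflect, swapL_swapL, neg_neg]

theorem swapL_expσ₃_col (z : ℂ) (j : Fin 2) :
    swapL ((expσ₃ z).col j) = (expσ₃ (-z)).col (j + 1) := by
  ext i; fin_cases i <;> fin_cases j <;> simp [expσ₃]

theorem bgΦ_free (k : ℂ) (x : ℝ) : bgΦ 0 1 k x = expσ₃ (-(Complex.I * k * x)) := by
  simp [bgΦ, expσ₃_zero]

theorem reflect_kernel (u₀ : ℝ → ℂ) (k : ℂ) (φ : ℝ → Fin 2 → ℂ) (x y : ℝ) :
    (bgΦ 0 1 k y * (bgΦ 0 1 k x)⁻¹ * potential (-conj (u₀ (-x)))) *ᵥ reflect φ x =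
      -swapL
        ((expσ₃ (Complex.I * k * ((-x : ℝ) - (-y : ℝ))) * potential (u₀ (-x))) *ᵥ φ (-x)) := by
  have h1 : -(Complex.I * k * y) + Complex.I * k * x = -(Complex.I * k * (y - x)) := by ring
  rw [bgΦ_free, bgΦ_free, expσ₃_inv, expσ₃_mul, neg_neg, h1]
  have h2 : Complex.I * k * ((-x : ℝ) - (-y : ℝ)) = Complex.I * k * (y - x) := by push_cast; ring
  rw [h2]
  ext i
  fin_cases i <;> simp [expσ₃, potential, reflect, Matrix.mulVec, dotProduct, Fin.sum_univ_two]

/-- Under reflection, the second column at `+∞` becomes a first column at `-∞` for the trivial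
background `β = 0`, `S = 1`, with potential `-ū₀(-y)`. -/
theorem SolvesRight.reflect {u₀ : ℝ → ℂ} {k : ℂ} {φ : ℝ → Fin 2 → ℂ} (h : SolvesRight u₀ k 1 φ) :
    SolvesVolterra (bgΦ 0 1 k) (fun y ↦ potential (-conj (u₀ (-y)))) 0 (reflect φ) := by
  intro y
  obtain ⟨h1, h2⟩ := h (-y)
  simp only [reflect_kernel]
  have hi := swapL.integrable_comp (integrableOn_Iic_comp_neg h1)
  refine ⟨hi.neg, ?_⟩
  rw [integral_neg, ContinuousLinearMap.integral_comp_comm _ (integrableOn_Iic_comp_neg h1),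
    integral_comp_neg_Iic y (fun z : ℝ ↦
      (expσ₃ (Complex.I * k * (z - (-y : ℝ))) * potential (u₀ z)) *ᵥ φ z),
    ← integral_Ici_eq_integral_Ioi, NLSStep.reflect, h2, map_sub, sub_eq_add_neg]
  congr 1
  rw [bgΦ_free, swapL_expσ₃_col]
  simp

theorem solvesRight_reflect {u₀ : ℝ → ℂ} {k : ℂ} {φ : ℝ → Fin 2 → ℂ}
    (h : SolvesVolterra (bgΦ 0 1 k) (fun y ↦ potential (-conj (u₀ (-y)))) 0 φ) :
    SolvesRight u₀ k 1 (reflect φ) := by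
  intro x
  obtain ⟨h1, h2⟩ := h (-x)
  have hk : ∀ y : ℝ, (expσ₃ (Complex.I * k * (y - x)) * potential (u₀ y)) *ᵥ reflect φ y =
      -swapL ((bgΦ 0 1 k (-x) * (bgΦ 0 1 k (-y))⁻¹ *
        potential (-conj (u₀ (- -y)))) *ᵥ φ (-y)) := fun y ↦ by
    have h3 := reflect_kernel u₀ k (reflect φ) (-y) (-x)
    rw [reflect_reflect, neg_neg, neg_neg] at h3
    rw [neg_neg, h3, map_neg, swapL_swapL, neg_neg]
  have hI : IntegrableOn (fun y : ℝ ↦ (bgΦ 0 1 k (-x) * (bgΦ 0 1 k (-y))⁻¹ *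
        potential (-conj (u₀ (- -y)))) *ᵥ φ (-y)) (Ici x) := by
    have := (integrable_indicator_iff measurableSet_Iic).2 h1
    refine (integrable_indicator_iff measurableSet_Ici).1
      (this.comp_neg.congr (.of_forall fun y ↦ ?_))
    by_cases hy : x ≤ y
    · simp [hy]
    · simp [hy]
  simp only [hk]
  refine ⟨(swapL.integrable_comp hI).neg, ?_⟩
  rw [integral_neg, ContinuousLinearMap.integral_comp_comm _ hI, integral_Ici_eq_integral_Ioi,
    integral_comp_neg_Ioi x (fun z : ℝ ↦ (bgΦ 0 1 k (-x) * (bgΦ 0 1 k z)⁻¹ *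
        potential (-conj (u₀ (-z)))) *ᵥ φ z), sub_neg_eq_add, NLSStep.reflect, h2, map_add]
  congr 1
  rw [bgΦ_free, swapL_expσ₃_col]
  simp

theorem solvesRight_flip {u₀ : ℝ → ℂ} {k : ℂ} {j : Fin 2} {φ : ℝ → Fin 2 → ℂ}
    (h : SolvesRight u₀ k j φ) : SolvesRight u₀ (conj k) (j + 1) (fun x ↦ flipVec (φ x)) := by
  intro x
  obtain ⟨h1, h2⟩ := h x
  have he : ∀ y : ℝ, flipMat (expσ₃ (Complex.I * k * (y - x))) =
      expσ₃ (Complex.I * conj k * (y - x)) := fun y ↦ by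
    rw [flipMat_expσ₃]; congr 1; simp
  have hk : ∀ y : ℝ, (expσ₃ (Complex.I * conj k * (y - x)) * potential (u₀ y)) *ᵥ flipVec (φ y) =
      flipVec ((expσ₃ (Complex.I * k * (y - x)) * potential (u₀ y)) *ᵥ φ y) := fun y ↦ by
    rw [← flipMat_mulVec, flipMat_mul, flipMat_potential, he]
  simp only [hk]
  refine ⟨flipVec.integrable_comp h1, ?_⟩
  have hc : flipMat (expσ₃ (-(Complex.I * k * x))) = expσ₃ (-(Complex.I * conj k * x)) := by
    rw [flipMat_expσ₃]; congr 1; simp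
  rw [flipVec.integral_comp_comm h1, ← hc, flipMat_col, ← map_sub, ← h2]

end NLSStep

end

/-! ### Moments of the potential and smoothness of the eigenfunctions -/

noncomputable section

open Filter Topology

namespace NLSStep

section Data

variable {α β : ℝ} {N : ℕ} {u₀ : ℝ → ℂ}

theorem continuous_u₀b (α β : ℝ) : Continuous (u₀b α β) := by
  unfold u₀b
  fun_prop

theorem StepLike.integrableOn_sub (h : StepLike α β N u₀) (X : ℝ) :
    IntegrableOn (fun x ↦ u₀ x - u₀b α β x) (Iic X) := by
  obtain ⟨h1, h2⟩ := h 0 (Nat.zero_le _)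
  simp only [pow_zero, one_mul] at h1 h2
  have h3 : IntegrableOn (fun x ↦ u₀ x - u₀b α β x) (Ioc 0 X) :=
    (h2.mono_set Ioc_subset_Ioi_self).sub
      ((continuous_u₀b α β).integrableOn_Icc.mono_set Ioc_subset_Icc_self)
  refine (((integrableOn_Iic_iff_integrableOn_Iio enorm_ne_top).2 h1).union h3).mono_set
    fun x hx ↦ ?_
  rcases le_or_gt x 0 with h | h
  · exact .inl h
  · exact .inr ⟨h, hx⟩

theorem StepLike.integrableOn (h : StepLike α β N u₀) (X : ℝ) : IntegrableOn u₀ (Ici X) := by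
  obtain ⟨h1, h2⟩ := h 0 (Nat.zero_le _)
  simp only [pow_zero, one_mul] at h1 h2
  have h3 : IntegrableOn (fun x ↦ (u₀ x - u₀b α β x) + u₀b α β x) (Icc X 0) :=
    (((integrableOn_Iic_iff_integrableOn_Iio enorm_ne_top).2 h1).mono_set Icc_subset_Iic_self).add
      (continuous_u₀b α β).integrableOn_Icc
  simp only [sub_add_cancel] at h3
  refine (h3.union h2).mono_set fun x hx ↦ ?_
  rcases le_or_gt x 0 with h | h
  · exact .inl ⟨hx, h⟩
  · exact .inr h

/-- The potential of the reflected right problem. -/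
def reflectPotential (u₀ : ℝ → ℂ) (y : ℝ) : ℂ := -conj (u₀ (-y))

theorem integrableOn_reflect_moment {n : ℕ} {c : ℝ}
    (h : IntegrableOn (fun x : ℝ ↦ (x : ℂ) ^ n * u₀ x) (Ici (-c))) :
    IntegrableOn (fun x : ℝ ↦ (x : ℂ) ^ n * reflectPotential u₀ x) (Iic c) := by
  have h1 := Complex.conjCLE.toContinuousLinearMap.integrable_comp (integrableOn_Iic_comp_neg h)
  refine ((h1.const_mul (-(-1) ^ n))).congr (.of_forall fun x ↦ ?_)
  simp only [ContinuousLinearEquiv.coe_coe, Complex.conjCLE_apply, map_mul, map_pow,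
    map_neg, Complex.conj_ofReal, Complex.ofReal_neg, reflectPotential]
  rw [neg_pow (x : ℂ), ← mul_assoc, ← mul_assoc, neg_mul, ← mul_pow]
  simp

theorem StepLike.integrableOn_reflect (h : StepLike α β N u₀) (X : ℝ) :
    IntegrableOn (reflectPotential u₀) (Iic X) := by
  simpa using integrableOn_reflect_moment (n := 0) (by simpa using h.integrableOn (-X))

theorem StepLike.integrableOn_moment_sub (h : StepLike α β N u₀) :
    IntegrableOn (fun x : ℝ ↦ (x : ℂ) ^ N * (u₀ x - u₀b α β x)) (Iic 0) :=
  (integrableOn_Iic_iff_integrableOn_Iio enorm_ne_top).2 (h N le_rfl).1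

theorem StepLike.integrableOn_moment_reflect (h : StepLike α β N u₀) :
    IntegrableOn (fun x : ℝ ↦ (x : ℂ) ^ N * reflectPotential u₀ x) (Iic 0) :=
  integrableOn_reflect_moment (by
    rw [neg_zero]; exact (integrableOn_Ici_iff_integrableOn_Ioi enorm_ne_top).2 (h N le_rfl).2)

/-- By `(1 + |s|)^N ≤ 2^{N-1} (1 + |s|^N)`, the moments of orders `0` and `N` suffice. -/
theorem integrableOn_weight_gaugedPotential {q : ℝ → ℂ} (h0 : IntegrableOn q (Iic 0))
    (hN : IntegrableOn (fun x : ℝ ↦ (x : ℂ) ^ N * q x) (Iic 0)) :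
    IntegrableOn (fun s ↦ (1 + (0 - s)) ^ N * ‖gaugedPotential β q s‖) (Iic 0) := by
  refine Integrable.mono' ((h0.norm.add hN.norm).const_mul (2 ^ (N - 1))) ?_ ?_
  · have : Continuous fun s : ℝ ↦ (1 + (0 - s)) ^ N := by fun_prop
    exact this.aestronglyMeasurable.mul (integrableOn_gaugedPotential h0).1.norm
  · refine (ae_restrict_iff' measurableSet_Iic).2 (.of_forall fun s hs ↦ ?_)
    have hs' : 0 ≤ 0 - s := sub_nonneg.2 hs
    have h1 := add_pow_le zero_le_one hs' N
    rw [one_pow] at h1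
    have h2 : ‖(s : ℂ) ^ N * q s‖ = (0 - s) ^ N * ‖q s‖ := by
      rw [norm_mul, norm_pow, Complex.norm_real, Real.norm_of_nonpos hs, zero_sub]
    have h3 := norm_gaugedPotential_le β q s
    rw [Real.norm_of_nonneg (by positivity), Pi.add_apply, h2]
    calc _ ≤ 2 ^ (N - 1) * (1 + (0 - s) ^ N) * ‖q s‖ := by gcongr
      _ = _ := by ring

end Data

section Smooth

theorem projFst_eq {S : Matrix (Fin 2) (Fin 2) ℂ} (hS : S.det = 1) :
    projFst S = !![S 0 0 * S 1 1, -(S 0 0 * S 0 1); S 1 0 * S 1 1, -(S 1 0 * S 0 1)] := by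
  rw [projFst, Matrix.inv_def, hS, Ring.inverse_one, one_smul, Matrix.adjugate_fin_two]
  ext i j
  fin_cases i <;> fin_cases j <;> simp [Matrix.mul_apply, Fin.sum_univ_two]

theorem projSnd_eq {S : Matrix (Fin 2) (Fin 2) ℂ} (hS : S.det = 1) :
    projSnd S = !![-(S 0 1 * S 1 0), S 0 1 * S 0 0; -(S 1 1 * S 1 0), S 1 1 * S 0 0] := by
  rw [projSnd, Matrix.inv_def, hS, Ring.inverse_one, one_smul, Matrix.adjugate_fin_two]
  ext i j
  fin_cases i <;> fin_cases j <;> simp [Matrix.mul_apply, Fin.sum_univ_two]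

theorem normalized_apply_zero (β : ℝ) (ζ : ℂ) (φ : ℝ → Fin 2 → ℂ) :
    normalized β ζ φ 0 = φ 0 := by
  simp [normalized, expσ₃_zero]

/-- The first column of an eigenfunction is as smooth in the spectral parameter as the number of
moments of the potential. -/
theorem contDiffOn_of_solvesVolterra {β : ℝ} {N : ℕ} {q : ℝ → ℂ} {U : Set ℂ}
    {S : ℂ → Matrix (Fin 2) (Fin 2) ℂ} {ζ : ℂ → ℂ} {φ : ℂ → ℝ → Fin 2 → ℂ}
    (hq : ∀ X, IntegrableOn q (Iic X))
    (hN : IntegrableOn (fun x : ℝ ↦ (x : ℂ) ^ N * q x) (Iic 0))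
    (hS : ∀ k ∈ U, (S k).det = 1) (hζ : ∀ k ∈ U, 0 ≤ (ζ k).im)
    (hSs : ∀ i j, ContDiffOn ℂ N (fun k ↦ S k i j) U) (hζs : ContDiffOn ℂ N ζ U)
    (hφ : ∀ k ∈ U, SolvesVolterra (bgΦ β (S k) (ζ k)) (fun x ↦ potential (q x)) 0 (φ k)) :
    ContDiffOn ℂ N (fun k ↦ φ k 0) U := by
  have h1 : ContDiffOn ℂ N (fun k ↦ mulVecL (projFst (S k))) U := by
    refine (contDiffOn_mulVecL (M := fun k ↦ !![S k 0 0 * S k 1 1, -(S k 0 0 * S k 0 1);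
      S k 1 0 * S k 1 1, -(S k 1 0 * S k 0 1)]) fun i j ↦ ?_).congr
        fun k hk ↦ by rw [projFst_eq (hS k hk)]
    fin_cases i <;> fin_cases j
    · exact (hSs 0 0).mul (hSs 1 1)
    · exact ((hSs 0 0).mul (hSs 0 1)).neg
    · exact (hSs 1 0).mul (hSs 1 1)
    · exact ((hSs 1 0).mul (hSs 0 1)).neg
  have h2 : ContDiffOn ℂ N (fun k ↦ mulVecL (projSnd (S k))) U := by
    refine (contDiffOn_mulVecL (M := fun k ↦ !![-(S k 0 1 * S k 1 0), S k 0 1 * S k 0 0;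
      -(S k 1 1 * S k 1 0), S k 1 1 * S k 0 0]) fun i j ↦ ?_).congr
        fun k hk ↦ by rw [projSnd_eq (hS k hk)]
    fin_cases i <;> fin_cases j
    · exact ((hSs 0 1).mul (hSs 1 0)).neg
    · exact (hSs 0 1).mul (hSs 0 0)
    · exact ((hSs 1 1).mul (hSs 1 0)).neg
    · exact (hSs 1 1).mul (hSs 0 0)
  have h3 : ContDiffOn ℂ N (fun k ↦ (S k).col 0) U := contDiffOn_pi.2 fun i ↦ hSs i 0
  refine (contDiffOn_of_isVolterraSol (w := fun k ↦ normalized β (ζ k) (φ k))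
    (integrableOn_gaugedPotential (β := β) (hq 0))
    (integrableOn_weight_gaugedPotential (hq 0) hN) hζ h1 h2 hζs h3 fun k hk ↦
      (hφ k hk).isVolterraSol (hS k hk) (hζ k hk) hq 0).congr fun k _ ↦ ?_
  exact (normalized_apply_zero _ _ _).symm

end Smooth

end NLSStep

end

/-! ### The columns of the two eigenfunctions -/

noncomputable section

open Filter Topology

namespace NLSStep

section Columns

variable {α β : ℝ} {N : ℕ} {u₀ : ℝ → ℂ} {k : ℂ}

theorem mem_closedLower_iff : k ∈ closedLower α β ↔ conj k ∈ closedUpper α β := by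
  have h : ∀ c : ℝ, conj k = c ↔ k = c := fun c ↦ by
    rw [← Complex.conj_ofReal c, (starRingEnd ℂ).injective.eq_iff, Complex.conj_ofReal]
  simp [closedLower, closedUpper, h]

theorem existsUnique_solvesLeft_fst (hα : 0 < α) (hu : StepLike α β N u₀)
    (hk : k ∈ closedUpper α β) : ∃! φ, SolvesLeft α β u₀ (φb α β k) 0 φ := by
  simp only [solvesLeft_iff, φb_eq_bgΦ]
  exact existsUnique_solvesVolterra (det_sb (quartΔ_ne_zero hα hk)) (radX_im_nonneg hk)
    hu.integrableOn_sub

theorem solvesLeft_φ₁col₁ (hα : 0 < α) (hu : StepLike α β N u₀) (hk : k ∈ closedUpper α β) :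
    SolvesLeft α β u₀ (φb α β k) 0 (φ₁col₁ α β u₀ k) :=
  Classical.epsilon_spec (existsUnique_solvesLeft_fst hα hu hk).exists

theorem solvesVolterra_φ₁col₁ (hα : 0 < α) (hu : StepLike α β N u₀) (hk : k ∈ closedUpper α β) :
    SolvesVolterra (bgΦ β (sb (quartΔ α β k)) (radX α β k))
      (fun x ↦ potential (u₀ x - u₀b α β x)) 0 (φ₁col₁ α β u₀ k) :=
  solvesLeft_iff.1 (solvesLeft_φ₁col₁ hα hu hk)

theorem existsUnique_solvesLeft_snd (hα : 0 < α) (hu : StepLike α β N u₀)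
    (hk : k ∈ closedLower α β) : ∃! φ, SolvesLeft α β u₀ (φbLower α β k) 1 φ := by
  have hk' := mem_closedLower_iff.1 hk
  have hd := quartΔ_ne_zero hα hk'
  obtain ⟨φ, hφ, huniq⟩ := existsUnique_solvesLeft_fst hα hu hk'
  refine ⟨fun x ↦ flipVec (φ x), ?_, fun χ hχ ↦ ?_⟩
  · have := solvesLeft_flip hd hφ
    rwa [Complex.conj_conj] at this
  · rw [← huniq _ (solvesLeft_of_flip hd (by rwa [Complex.conj_conj]))]
    simp only [flipVec_flipVec]

/-- By uniqueness, the second column of `φ₁` is the image of the first one under the symmetry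
`k ↦ k̄`. -/
theorem φ₁col₂_eq (hα : 0 < α) (hu : StepLike α β N u₀) (hk : k ∈ closedLower α β) (x : ℝ) :
    φ₁col₂ α β u₀ k x = flipVec (φ₁col₁ α β u₀ (conj k) x) := by
  have hk' := mem_closedLower_iff.1 hk
  have h1 := solvesLeft_flip (quartΔ_ne_zero hα hk') (solvesLeft_φ₁col₁ hα hu hk')
  rw [Complex.conj_conj] at h1
  have h := existsUnique_solvesLeft_snd hα hu hk
  exact congrFun (h.unique (Classical.epsilon_spec h.exists) h1) x

theorem existsUnique_solvesRight_snd (hu : StepLike α β N u₀) (hk : 0 ≤ k.im) :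
    ∃! φ, SolvesRight u₀ k 1 φ := by
  obtain ⟨n, hn, huniq⟩ := existsUnique_solvesVolterra (β := 0) (S := 1) Matrix.det_one hk
    hu.integrableOn_reflect
  refine ⟨reflect n, solvesRight_reflect hn, fun χ hχ ↦ ?_⟩
  rw [← huniq _ hχ.reflect, reflect_reflect]

theorem solvesRight_φ₂col₂ (hu : StepLike α β N u₀) (hk : 0 ≤ k.im) :
    SolvesRight u₀ k 1 (φ₂col₂ u₀ k) :=
  Classical.epsilon_spec (existsUnique_solvesRight_snd hu hk).exists

theorem solvesVolterra_reflect_φ₂col₂ (hu : StepLike α β N u₀) (hk : 0 ≤ k.im) :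
    SolvesVolterra (bgΦ 0 1 k) (fun y ↦ potential (reflectPotential u₀ y)) 0
      (reflect (φ₂col₂ u₀ k)) :=
  (solvesRight_φ₂col₂ hu hk).reflect

theorem existsUnique_solvesRight_fst (hu : StepLike α β N u₀) (hk : k.im ≤ 0) :
    ∃! φ, SolvesRight u₀ k 0 φ := by
  obtain ⟨φ, hφ, huniq⟩ := existsUnique_solvesRight_snd (k := conj k) hu (by simpa using hk)
  refine ⟨fun x ↦ flipVec (φ x), ?_, fun χ hχ ↦ ?_⟩
  · have := solvesRight_flip hφ
    rwa [Complex.conj_conj] at this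
  · rw [← huniq _ (solvesRight_flip hχ)]
    simp only [flipVec_flipVec]

/-- By uniqueness, the first column of `φ₂` is the image of the second one under the symmetry
`k ↦ k̄`. -/
theorem φ₂col₁_eq (hu : StepLike α β N u₀) (hk : k.im ≤ 0) (x : ℝ) :
    φ₂col₁ u₀ k x = flipVec (φ₂col₂ u₀ (conj k) x) := by
  have h1 := solvesRight_flip (solvesRight_φ₂col₂ (k := conj k) hu (by simpa using hk))
  rw [Complex.conj_conj] at h1
  have h := existsUnique_solvesRight_fst hu hk
  exact congrFun (h.unique (Classical.epsilon_spec h.exists) h1) x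

/-- The value `x = 0` is enough, as the Wronskians do not depend on `x`. -/
theorem contDiffOn_φ₁col₁ (hα : 0 < α) (hu : StepLike α β N u₀) :
    ContDiffOn ℂ N (fun k ↦ φ₁col₁ α β u₀ k 0) (closedUpper α β) := by
  have hΔ := contDiffOn_quartΔ (β := β) hα N
  have hΔi := hΔ.inv fun k hk ↦ quartΔ_ne_zero hα hk
  refine contDiffOn_of_solvesVolterra hu.integrableOn_sub hu.integrableOn_moment_sub
    (fun k hk ↦ det_sb (quartΔ_ne_zero hα hk)) (fun k hk ↦ radX_im_nonneg hk) (fun i j ↦ ?_)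
    (contDiffOn_radX N) fun k hk ↦ solvesVolterra_φ₁col₁ hα hu hk
  fin_cases i <;> fin_cases j
  · exact contDiffOn_const.mul (hΔ.add hΔi)
  · exact contDiffOn_const.mul (contDiffOn_const.mul (hΔ.sub hΔi))
  · exact contDiffOn_const.mul (contDiffOn_const.mul (hΔ.sub hΔi))
  · exact contDiffOn_const.mul (hΔ.add hΔi)

theorem contDiffOn_φ₂col₂ (hu : StepLike α β N u₀) :
    ContDiffOn ℂ N (fun k ↦ φ₂col₂ u₀ k 0) {k | 0 ≤ k.im} := by
  have h := contDiffOn_of_solvesVolterra (β := 0) (S := fun _ ↦ 1) (ζ := fun k ↦ k)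
    (φ := fun k ↦ reflect (φ₂col₂ u₀ k)) (U := {k | 0 ≤ k.im})
    hu.integrableOn_reflect hu.integrableOn_moment_reflect
    (fun k _ ↦ Matrix.det_one) (fun k hk ↦ hk) (fun i j ↦ contDiffOn_const)
    contDiffOn_id fun k hk ↦ solvesVolterra_reflect_φ₂col₂ hu hk
  refine (swapL.contDiff.comp_contDiffOn h).congr fun k _ ↦ ?_
  rw [Function.comp, reflect, swapL_swapL, neg_zero]

/-- The relations that make `φᵇ` a solution of the background Dirac system. They follow from
`XΔ = (k + β - α)Δ⁻¹` and `XΔ⁻¹ = (k + β + α)Δ`. -/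
theorem radX_quartΔ_relations (hα : 0 < α) (hk : k ∈ closedUpper α β) :
    (β - radX α β k + k) * (quartΔ α β k + (quartΔ α β k)⁻¹) =
      -(α * (quartΔ α β k - (quartΔ α β k)⁻¹)) ∧
    (β + radX α β k + k) * (quartΔ α β k - (quartΔ α β k)⁻¹) =
      -(α * (quartΔ α β k + (quartΔ α β k)⁻¹)) := by
  have h0 := mul_inv_cancel₀ (quartΔ_ne_zero hα hk)
  have h1 := radX_mul_quartΔ_sq hα hk
  have h2 := radX_eq_quartΔ_sq_mul hα hk
  set Δ := quartΔ α β k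
  set X := radX α β k
  simp only [E₁, E₂] at h1 h2
  push_cast at h1 h2
  have h3 : X * Δ = (k + β - α) * Δ⁻¹ := by linear_combination Δ⁻¹ * h1 - X * Δ * h0
  have h4 : X * Δ⁻¹ = Δ * (k + β + α) := by
    linear_combination Δ⁻¹ * h2 + Δ * (k + β + α) * h0
  constructor
  · linear_combination -h3 - h4
  · linear_combination h3 - h4

/-- The first column of `φ₁` satisfies the Dirac system `φ' = (-ikσ₃ + U₀)φ`. -/
theorem isPrimitiveOf_φ₁col₁ (hα : 0 < α) (hu : StepLike α β N u₀) (hk : k ∈ closedUpper α β) :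
    IsPrimitiveOf (φ₁col₁ α β u₀ k) (fun x ↦ dirac k (u₀ x) *ᵥ φ₁col₁ α β u₀ k x) := by
  obtain ⟨h1, h2⟩ := radX_quartΔ_relations hα hk
  have hS : ∀ Δ : ℂ, sb Δ 0 0 = 1 / 2 * (Δ + Δ⁻¹) ∧ sb Δ 0 1 = 1 / 2 * (Complex.I * (Δ - Δ⁻¹)) ∧
      sb Δ 1 0 = 1 / 2 * (-Complex.I * (Δ - Δ⁻¹)) ∧ sb Δ 1 1 = 1 / 2 * (Δ + Δ⁻¹) :=
    fun Δ ↦ ⟨rfl, rfl, rfl, rfl⟩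
  obtain ⟨s00, s01, s10, s11⟩ := hS (quartΔ α β k)
  refine ((solvesVolterra_φ₁col₁ hα hu hk).isPrimitiveOf_dirac
    (det_sb (quartΔ_ne_zero hα hk)) (A := fun x ↦ dirac k (u₀b α β x))
    (isPrimitiveOf_bgΦ ?_ ?_ ?_ ?_)).congr_deriv fun x ↦ ?_
  · rw [s00, s10]; linear_combination Complex.I / 2 * h1
  · rw [s01, s11]
    linear_combination (β + radX α β k + k) * (quartΔ α β k - (quartΔ α β k)⁻¹) / 2 *
      Complex.I_mul_I - 1 / 2 * h2
  · rw [s10, s00]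
    linear_combination (β + radX α β k + k) * (quartΔ α β k - (quartΔ α β k)⁻¹) / 2 *
      Complex.I_mul_I - 1 / 2 * h2
  · rw [s11, s01]; linear_combination -Complex.I / 2 * h1
  · rw [dirac_add_potential, add_sub_cancel]

/-- The second column of `φ₂` satisfies the Dirac system `φ' = (-ikσ₃ + U₀)φ`. -/
theorem isPrimitiveOf_φ₂col₂ (hu : StepLike α β N u₀) (hk : 0 ≤ k.im) :
    IsPrimitiveOf (φ₂col₂ u₀ k) (fun x ↦ dirac k (u₀ x) *ᵥ φ₂col₂ u₀ k x) := by
  have h := (solvesVolterra_reflect_φ₂col₂ hu hk).isPrimitiveOf_dirac Matrix.det_one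
    (A := fun x ↦ dirac k (u₀b 0 0 x)) fun i j ↦ by
      have := isPrimitiveOf_bgΦ (β := 0) (c := 0) (S := 1) (ζ := k) (k := k)
        (by simp) (by simp) (by simp) (by simp) i j
      exact this
  have h' := h.neg_comp_neg
  refine isPrimitiveOf_pi fun i ↦ ?_
  have hz : ∀ x, u₀b 0 0 x = 0 := fun x ↦ by simp [u₀b]
  fin_cases i
  · refine ((h'.apply 1).congr_deriv (g' := fun x ↦ (dirac k (u₀ x) *ᵥ φ₂col₂ u₀ k x) 0)
      fun x ↦ ?_).congr_fun fun x ↦ ?_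
    · simp [potential, hz, reflectPotential, dirac, Matrix.mulVec, dotProduct,
        Fin.sum_univ_two, reflect_zero, reflect_one]
    · simp [reflect_one]
  · refine ((h'.apply 0).congr_deriv (g' := fun x ↦ (dirac k (u₀ x) *ᵥ φ₂col₂ u₀ k x) 1)
      fun x ↦ ?_).congr_fun fun x ↦ ?_
    · simp [potential, hz, reflectPotential, dirac, Matrix.mulVec, dotProduct,
        Fin.sum_univ_two, reflect_zero, reflect_one]
    · simp [reflect_zero]

end Columns

end NLSStep

end

/-! ### Scattering coefficients -/

noncomputable section

open Filter Topology

namespace NLSStep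

/-- The indefinite form `|v₀|² - |v₁|²` preserved by the symmetry group `SU(1, 1)`. -/
def energy (v : Fin 2 → ℂ) : ℝ := ‖v 0‖ ^ 2 - ‖v 1‖ ^ 2

theorem wronskian_flipVec_self (v : Fin 2 → ℂ) : wronskian v (flipVec v) = energy v := by
  simp only [wronskian, flipVec_zero, flipVec_one, energy, Complex.mul_conj']
  push_cast
  rfl

theorem wronskian_swap (u v : Fin 2 → ℂ) : wronskian u v = -wronskian v u := by
  simp only [wronskian]
  ring

/-- The Plücker relation for two vectors and their images under the symmetry. -/
theorem energy_mul_energy (u v : Fin 2 → ℂ) :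
    energy u * energy v = ‖wronskian u (flipVec v)‖ ^ 2 - ‖wronskian u v‖ ^ 2 := by
  have h : ((energy u * energy v : ℝ) : ℂ) =
      ((‖wronskian u (flipVec v)‖ ^ 2 - ‖wronskian u v‖ ^ 2 : ℝ) : ℂ) := by
    push_cast
    rw [← Complex.mul_conj', ← Complex.mul_conj', ← wronskian_flipVec_self,
      ← wronskian_flipVec_self]
    simp [wronskian]
    ring
  exact_mod_cast h

theorem energy_swapL (v : Fin 2 → ℂ) : energy (swapL v) = -energy v := by
  simp [energy]

theorem trace_dirac (k u : ℂ) : (dirac k u).trace = 0 := by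
  simp [dirac, Matrix.trace_fin_two]

theorem wronskian_eq_of_dirac {k : ℂ} {u₀ : ℝ → ℂ} {φ χ : ℝ → Fin 2 → ℂ}
    (hφ : IsPrimitiveOf φ (fun x ↦ dirac k (u₀ x) *ᵥ φ x))
    (hχ : IsPrimitiveOf χ (fun x ↦ dirac k (u₀ x) *ᵥ χ x)) (x y : ℝ) :
    wronskian (φ x) (χ x) = wronskian (φ y) (χ y) :=
  (hφ.wronskian hχ).eq_of_deriv_zero
    (fun x ↦ by rw [wronskian_mulVec_add, trace_dirac, zero_mul]) x y

theorem IsPrimitiveOf.flip {k : ℂ} {u₀ : ℝ → ℂ} {φ : ℝ → Fin 2 → ℂ}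
    (hφ : IsPrimitiveOf φ (fun x ↦ dirac k (u₀ x) *ᵥ φ x)) :
    IsPrimitiveOf (fun x ↦ flipVec (φ x))
      (fun x ↦ dirac (conj k) (u₀ x) *ᵥ flipVec (φ x)) := by
  simp only [← flipMat_dirac, flipMat_mulVec]
  refine isPrimitiveOf_pi fun i ↦ ?_
  fin_cases i
  · exact (hφ.apply 1).conj
  · exact (hφ.apply 0).conj

/-- Solutions of the Dirac system satisfy `(|φ₀|² - |φ₁|²)' = 2 Im k (|φ₀|² + |φ₁|²)`. -/
theorem energy_sub_energy {k : ℂ} {u₀ : ℝ → ℂ} {φ : ℝ → Fin 2 → ℂ}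
    (hφ : IsPrimitiveOf φ (fun x ↦ dirac k (u₀ x) *ᵥ φ x)) (x y : ℝ) :
    energy (φ y) - energy (φ x) =
      ∫ t in x..y, 2 * k.im * (‖φ t 0‖ ^ 2 + ‖φ t 1‖ ^ 2) := by
  have h := (hφ.wronskian hφ.flip).2 x y
  simp only [wronskian_flipVec_self] at h
  have hd : ∀ t, wronskian (dirac k (u₀ t) *ᵥ φ t) (flipVec (φ t)) +
      wronskian (φ t) (dirac (conj k) (u₀ t) *ᵥ flipVec (φ t)) =
        ((2 * k.im * (‖φ t 0‖ ^ 2 + ‖φ t 1‖ ^ 2) : ℝ) : ℂ) := fun t ↦ by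
    have him : Complex.I * (conj k - k) = 2 * k.im := by
      have := Complex.sub_conj k
      push_cast at this
      linear_combination (-Complex.I) * this - 2 * k.im * Complex.I_mul_I
    push_cast
    rw [← Complex.mul_conj', ← Complex.mul_conj', ← him]
    simp [wronskian, dirac, Matrix.mulVec, dotProduct, Fin.sum_univ_two]
    ring
  simp only [hd] at h
  rw [intervalIntegral.integral_ofReal] at h
  exact_mod_cast h

theorem energy_eq_of_im_eq_zero {k : ℂ} (hk : k.im = 0) {u₀ : ℝ → ℂ} {φ : ℝ → Fin 2 → ℂ}
    (hφ : IsPrimitiveOf φ (fun x ↦ dirac k (u₀ x) *ᵥ φ x)) (x y : ℝ) :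
    energy (φ x) = energy (φ y) := by
  have := energy_sub_energy hφ y x
  simp only [hk, mul_zero, zero_mul, intervalIntegral.integral_zero] at this
  linarith

theorem monotone_energy {k : ℂ} (hk : 0 ≤ k.im) {u₀ : ℝ → ℂ} {φ : ℝ → Fin 2 → ℂ}
    (hφ : IsPrimitiveOf φ (fun x ↦ dirac k (u₀ x) *ᵥ φ x)) : Monotone fun x ↦ energy (φ x) := by
  intro x y hxy
  have h1 := energy_sub_energy hφ x y
  have h2 := intervalIntegral.integral_nonneg (μ := volume)
    (f := fun t ↦ 2 * k.im * (‖φ t 0‖ ^ 2 + ‖φ t 1‖ ^ 2)) hxy fun t _ ↦ by positivity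
  simp only
  linarith

theorem energy_lt_energy {k : ℂ} (hk : 0 < k.im) {u₀ : ℝ → ℂ} {φ : ℝ → Fin 2 → ℂ}
    (hφ : IsPrimitiveOf φ (fun x ↦ dirac k (u₀ x) *ᵥ φ x)) {x y : ℝ} (hxy : x < y)
    (h0 : ∀ t < y, φ t ≠ 0) : energy (φ x) < energy (φ y) := by
  have h1 := energy_sub_energy hφ x y
  have hc := hφ.continuous
  have h2 := intervalIntegral.intervalIntegral_pos_of_pos_on
    (f := fun t ↦ 2 * k.im * (‖φ t 0‖ ^ 2 + ‖φ t 1‖ ^ 2))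
    (Continuous.intervalIntegrable (by fun_prop) x y) (fun t ht ↦ ?_) hxy
  · linarith
  · have h3 : 0 < ‖φ t 0‖ ^ 2 + ‖φ t 1‖ ^ 2 := by
      by_contra hcon
      refine h0 t ht.2 (funext fun i ↦ ?_)
      have h4 := sq_nonneg ‖φ t 0‖
      have h5 := sq_nonneg ‖φ t 1‖
      fin_cases i
      · exact norm_eq_zero.1 ((pow_eq_zero_iff two_ne_zero).1 (by linarith : ‖φ t 0‖ ^ 2 = 0))
      · exact norm_eq_zero.1 ((pow_eq_zero_iff two_ne_zero).1 (by linarith : ‖φ t 1‖ ^ 2 = 0))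
    positivity

section Asymptotics

variable {β : ℝ} {S : Matrix (Fin 2) (Fin 2) ℂ} {ζ : ℂ} {q : ℝ → ℂ} {φ : ℝ → Fin 2 → ℂ}

theorem norm_normalized_apply (β : ℝ) (ζ : ℂ) (φ : ℝ → Fin 2 → ℂ) (x : ℝ) (i : Fin 2) :
    ‖normalized β ζ φ x i‖ = Real.exp (-(ζ.im * x)) * ‖φ x i‖ := by
  fin_cases i <;>
    simp [normalized, expσ₃, dotProduct, Fin.sum_univ_two, Complex.norm_exp]

theorem SolvesVolterra.eventually_ne_zero (hS : S.det = 1) (hζ : 0 ≤ ζ.im)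
    (hq : ∀ X, IntegrableOn q (Iic X))
    (h : SolvesVolterra (bgΦ β S ζ) (fun x ↦ potential (q x)) 0 φ) :
    ∀ᶠ x in atBot, φ x ≠ 0 := by
  have h0 : S.col 0 ≠ 0 := fun h0 ↦ by
    have h1 : S 0 0 = 0 := congrFun h0 0
    have h2 : S 1 0 = 0 := congrFun h0 1
    rw [Matrix.det_fin_two, h1, h2] at hS
    simp at hS
  filter_upwards [(h.tendsto_normalized hS hζ hq).eventually_ne h0] with x hx hx'
  exact hx (by simp [normalized, hx'])

/-- The normalization is by `e^{iζx}` and a unitary diagonal matrix, so it rescales the energy by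
`e^{-2 Im ζ x}`. -/
theorem SolvesVolterra.tendsto_energy (hS : S.det = 1) (hζ : 0 ≤ ζ.im)
    (hq : ∀ X, IntegrableOn q (Iic X))
    (h : SolvesVolterra (bgΦ β S ζ) (fun x ↦ potential (q x)) 0 φ) :
    Tendsto (fun x ↦ Real.exp (-(ζ.im * x)) ^ 2 * energy (φ x)) atBot (𝓝 (energy (S.col 0))) := by
  have h1 := tendsto_pi_nhds.1 (h.tendsto_normalized hS hζ hq)
  have h2 := ((h1 0).norm.pow 2).sub ((h1 1).norm.pow 2)
  refine h2.congr fun x ↦ ?_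
  rw [norm_normalized_apply, norm_normalized_apply, energy]
  ring

theorem SolvesVolterra.tendsto_energy_of_im_eq_zero (hS : S.det = 1) (hζ : ζ.im = 0)
    (hq : ∀ X, IntegrableOn q (Iic X))
    (h : SolvesVolterra (bgΦ β S ζ) (fun x ↦ potential (q x)) 0 φ) :
    Tendsto (fun x ↦ energy (φ x)) atBot (𝓝 (energy (S.col 0))) := by
  have := h.tendsto_energy hS hζ.ge hq
  simpa [hζ] using this

theorem SolvesVolterra.tendsto_energy_of_im_pos (hS : S.det = 1) (hζ : 0 < ζ.im)
    (hq : ∀ X, IntegrableOn q (Iic X))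
    (h : SolvesVolterra (bgΦ β S ζ) (fun x ↦ potential (q x)) 0 φ) :
    Tendsto (fun x ↦ energy (φ x)) atBot (𝓝 0) := by
  have h1 := h.tendsto_energy hS hζ.le hq
  have h2 : Tendsto (fun x ↦ Real.exp (ζ.im * x) ^ 2) atBot (𝓝 0) := by
    have := (Real.tendsto_exp_atBot.comp (tendsto_id.const_mul_atBot hζ)).pow 2
    simpa using this
  have h3 := h2.mul h1
  rw [zero_mul] at h3
  refine h3.congr fun x ↦ ?_
  rw [← mul_assoc, ← mul_pow, ← Real.exp_add, add_neg_cancel, Real.exp_zero, one_pow, one_mul]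

end Asymptotics

section Scattering

variable {α β : ℝ} {N : ℕ} {u₀ : ℝ → ℂ}

/-- For real `Δ`, that is off the cut, the first column of `sᵇ` has energy `1`. -/
theorem energy_sb_col {Δ : ℂ} (h0 : Δ ≠ 0) (h : conj Δ = Δ) : energy ((sb Δ).col 0) = 1 := by
  obtain ⟨r, rfl⟩ := Complex.conj_eq_iff_real.1 h
  have hr : r ≠ 0 := by exact_mod_cast h0
  have e0 : (sb r).col 0 0 = ((1 / 2 * (r + r⁻¹) : ℝ) : ℂ) := by
    push_cast; rfl
  have e1 : (sb r).col 0 1 = -Complex.I * ((1 / 2 * (r - r⁻¹) : ℝ) : ℂ) := by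
    push_cast
    change 1 / 2 * (-Complex.I * ((r : ℂ) - (r : ℂ)⁻¹)) = _
    ring
  rw [energy, e0, e1, norm_mul, norm_neg, Complex.norm_I, one_mul, Complex.norm_real,
    Complex.norm_real, Real.norm_eq_abs, Real.norm_eq_abs, sq_abs, sq_abs]
  field_simp
  ring

/-- The coefficient `a` as a Wronskian; it makes sense on the closed upper half-plane. -/
def aExt (α β : ℝ) (u₀ : ℝ → ℂ) (k : ℂ) : ℂ :=
  wronskian (φ₁col₁ α β u₀ k 0) (φ₂col₂ u₀ k 0)

theorem aExt_eq_wronskian (hα : 0 < α) (hu : StepLike α β N u₀) {k : ℂ}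
    (hk : k ∈ closedUpper α β) (x : ℝ) :
    aExt α β u₀ k = wronskian (φ₁col₁ α β u₀ k x) (φ₂col₂ u₀ k x) :=
  wronskian_eq_of_dirac (isPrimitiveOf_φ₁col₁ hα hu hk) (isPrimitiveOf_φ₂col₂ hu hk.1) 0 x

theorem contDiffOn_wronskian {E : Type*} {𝕜 : Type*} [NontriviallyNormedField 𝕜]
    [NormedAlgebra 𝕜 ℂ] [NormedAddCommGroup E] [NormedSpace 𝕜 E]
    {u v : E → Fin 2 → ℂ} {U : Set E} (hu : ContDiffOn 𝕜 N u U) (hv : ContDiffOn 𝕜 N v U) :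
    ContDiffOn 𝕜 N (fun k ↦ wronskian (u k) (v k)) U := by
  have h1 := contDiffOn_pi.1 hu
  have h2 := contDiffOn_pi.1 hv
  exact ((h1 0).mul (h2 1)).sub ((h1 1).mul (h2 0))

theorem contDiffOn_aExt (hα : 0 < α) (hu : StepLike α β N u₀) :
    ContDiffOn ℂ N (aExt α β u₀) (closedUpper α β) :=
  contDiffOn_wronskian (contDiffOn_φ₁col₁ hα hu)
    ((contDiffOn_φ₂col₂ hu).mono sdiff_subset)

/-- For real `k` the energy is conserved, and it is that of `e^{-ikxσ₃}` at `+∞`. -/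
theorem energy_φ₂col₂ (hu : StepLike α β N u₀) {k : ℂ} (hk : k.im = 0) (x : ℝ) :
    energy (φ₂col₂ u₀ k x) = -1 := by
  have h1 := (solvesVolterra_reflect_φ₂col₂ hu hk.ge).tendsto_energy_of_im_eq_zero
    Matrix.det_one hk hu.integrableOn_reflect
  have h2 : ∀ y, -energy (φ₂col₂ u₀ k x) = energy (reflect (φ₂col₂ u₀ k) y) := fun y ↦ by
    rw [reflect, energy_swapL, energy_eq_of_im_eq_zero hk (isPrimitiveOf_φ₂col₂ hu hk.ge) x]
  have h3 : energy ((1 : Matrix (Fin 2) (Fin 2) ℂ).col 0) = 1 := by simp [energy]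
  rw [h3] at h1
  have := tendsto_nhds_unique (tendsto_const_nhds.congr h2) h1
  linarith

theorem energy_φ₁col₁_of_notMem (hα : 0 < α) (hu : StepLike α β N u₀) {k : ℝ}
    (hk : k ∉ Icc (E₁ α β) (E₂ α β)) (hk' : (k : ℂ) ∈ closedUpper α β) (x : ℝ) :
    energy (φ₁col₁ α β u₀ k x) = 1 := by
  have hd := quartΔ_ne_zero hα hk'
  have h1 := (solvesVolterra_φ₁col₁ hα hu hk').tendsto_energy_of_im_eq_zero (det_sb hd)
    (radX_im_of_notMem hα hk hk') hu.integrableOn_sub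
  rw [energy_sb_col hd (conj_quartΔ_of_notMem hα hk hk')] at h1
  exact tendsto_nhds_unique (tendsto_const_nhds.congr fun y ↦
    energy_eq_of_im_eq_zero (Complex.ofReal_im k) (isPrimitiveOf_φ₁col₁ hα hu hk') x y) h1

/-- The energy is nondecreasing. At `-∞` it tends to `0` if `Im X > 0`, and it equals `1` off the
cut. -/
theorem energy_φ₁col₁_nonneg (hα : 0 < α) (hu : StepLike α β N u₀) {k : ℂ}
    (hk : k ∈ closedUpper α β) (x : ℝ) : 0 ≤ energy (φ₁col₁ α β u₀ k x) := by
  have h0 : 0 < (radX α β k).im → 0 ≤ energy (φ₁col₁ α β u₀ k x) := fun h ↦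
    (monotone_energy hk.1 (isPrimitiveOf_φ₁col₁ hα hu hk)).le_of_tendsto
      ((solvesVolterra_φ₁col₁ hα hu hk).tendsto_energy_of_im_pos
        (det_sb (quartΔ_ne_zero hα hk)) h hu.integrableOn_sub) x
  rcases (show 0 ≤ k.im from hk.1).lt_or_eq with him | him
  · exact h0 (radX_im_pos hk him)
  · obtain ⟨r, rfl⟩ : ∃ r : ℝ, k = r := ⟨k.re, Complex.ext rfl him.symm⟩
    by_cases hr : r ∈ Icc (E₁ α β) (E₂ α β)
    · refine h0 (radX_im_pos_of_mem_cut (hr.1.lt_of_ne fun h ↦ ?_) (hr.2.lt_of_ne fun h ↦ ?_))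
      · exact hk.2 (by simp [h])
      · exact hk.2 (by simp [h])
    · rw [energy_φ₁col₁_of_notMem hα hu hr hk]
      exact zero_le_one

/-- If `v` is not isotropic, then `v` and its image under the symmetry form a basis. -/
theorem eq_zero_of_wronskian_eq_zero {u v : Fin 2 → ℂ} (h : wronskian u v = 0)
    (h' : wronskian u (flipVec v) = 0) (hv : energy v ≠ 0) : u = 0 := by
  have hv' : (energy v : ℂ) ≠ 0 := by exact_mod_cast hv
  rw [← wronskian_flipVec_self] at hv'
  simp only [wronskian] at h h' hv'
  ext i
  refine (mul_eq_zero.1 (?_ : u i * _ = 0)).resolve_right hv'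
  fin_cases i
  · change u 0 * _ = 0
    linear_combination v 0 * h' - flipVec v 0 * h
  · change u 1 * _ = 0
    linear_combination v 1 * h' - flipVec v 1 * h

theorem eventually_energy_φ₂col₂_neg (hu : StepLike α β N u₀) {k : ℂ} (hk : 0 ≤ k.im) :
    ∀ᶠ x in atTop, energy (φ₂col₂ u₀ k x) < 0 := by
  have h1 := (solvesVolterra_reflect_φ₂col₂ hu hk).tendsto_energy
    Matrix.det_one hk hu.integrableOn_reflect
  have h3 : energy ((1 : Matrix (Fin 2) (Fin 2) ℂ).col 0) = 1 := by simp [energy]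
  rw [h3] at h1
  filter_upwards [tendsto_neg_atTop_atBot.eventually (h1.eventually_const_lt zero_lt_one)]
    with x hx
  have h2 := pos_of_mul_pos_right hx (by positivity)
  rw [reflect, energy_swapL, neg_neg] at h2
  linarith

/-- If `a(k) = 0`, both columns are proportional. The energy of the first one is nonnegative, that
of the second one is negative near `+∞`; proportionality forces the first one to have energy `0`
there. For `Im k > 0` this contradicts strict monotonicity of the energy, and for real `k` both
Wronskians of the first column with the basis `φ₂` vanish, so that it is zero, contrary to its
asymptotics at `-∞`. -/
theorem aExt_ne_zero (hα : 0 < α) (hu : StepLike α β N u₀) {k : ℂ} (hk : k ∈ closedUpper α β) :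
    aExt α β u₀ k ≠ 0 := by
  intro h0
  have hp := isPrimitiveOf_φ₁col₁ hα hu hk
  have hn := energy_φ₁col₁_nonneg hα hu hk
  obtain ⟨x₁, hx₁⟩ := (eventually_energy_φ₂col₂_neg hu hk.1).exists
  obtain ⟨x₀, hx₀⟩ := eventually_atBot.1 ((solvesVolterra_φ₁col₁ hα hu hk).eventually_ne_zero
    (det_sb (quartΔ_ne_zero hα hk)) (radX_im_nonneg hk) hu.integrableOn_sub)
  have hw := fun x ↦ (aExt_eq_wronskian hα hu hk x).symm.trans h0
  -- the Plücker relation with one vanishing Wronskian makes the product of the energies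
  -- nonnegative
  have hpl := energy_mul_energy (φ₁col₁ α β u₀ k x₁) (φ₂col₂ u₀ k x₁)
  rw [hw, norm_zero, zero_pow two_ne_zero, sub_zero] at hpl
  have he : energy (φ₁col₁ α β u₀ k x₁) = 0 := by
    have h1 := sq_nonneg ‖wronskian (φ₁col₁ α β u₀ k x₁) (flipVec (φ₂col₂ u₀ k x₁))‖
    have h2 := hn x₁
    nlinarith
  rcases (show 0 ≤ k.im from hk.1).lt_or_eq with him | him
  · set m := min x₀ x₁
    have h1 := energy_lt_energy him hp (x := m - 1) (y := m) (by linarith)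
      fun t ht ↦ hx₀ t (ht.le.trans (min_le_left _ _))
    have h2 : energy (φ₁col₁ α β u₀ k m) ≤ energy (φ₁col₁ α β u₀ k x₁) :=
      monotone_energy hk.1 hp (min_le_right _ _)
    have h3 := hn (m - 1)
    linarith
  · have him' := him.symm
    have h1 : energy (φ₁col₁ α β u₀ k x₀) = 0 := (energy_eq_of_im_eq_zero him' hp _ _).trans he
    have h2 := energy_mul_energy (φ₁col₁ α β u₀ k x₀) (φ₂col₂ u₀ k x₀)
    rw [h1, hw, zero_mul, norm_zero, zero_pow two_ne_zero, sub_zero] at h2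
    refine hx₀ x₀ le_rfl (eq_zero_of_wronskian_eq_zero (hw x₀)
      (norm_eq_zero.1 ((pow_eq_zero_iff two_ne_zero).1 h2.symm)) ?_)
    rw [energy_φ₂col₂ hu him']
    norm_num

variable {k : ℝ}

theorem φ₁_eq (hα : 0 < α) (hu : StepLike α β N u₀) (hk : (k : ℂ) ∈ closedUpper α β) (x : ℝ) :
    φ₁ α β u₀ x k =
      !![φ₁col₁ α β u₀ k x 0, conj (φ₁col₁ α β u₀ k x 1);
        φ₁col₁ α β u₀ k x 1, conj (φ₁col₁ α β u₀ k x 0)] := by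
  have hk' : (k : ℂ) ∈ closedLower α β := mem_closedLower_iff.2 (by rwa [Complex.conj_ofReal])
  rw [φ₁, φ₁col₂_eq hα hu hk', Complex.conj_ofReal, flipVec_zero, flipVec_one]

theorem φ₂_eq (hu : StepLike α β N u₀) (k x : ℝ) :
    φ₂ u₀ x k = !![conj (φ₂col₂ u₀ k x 1), φ₂col₂ u₀ k x 0;
      conj (φ₂col₂ u₀ k x 0), φ₂col₂ u₀ k x 1] := by
  rw [φ₂, φ₂col₁_eq hu (Complex.ofReal_im k).le, Complex.conj_ofReal, flipVec_zero, flipVec_one]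

/-- As `det φ₂ = 1`, the entries of `φ₂⁻¹ φ₁` are Wronskians of the columns, and the symmetry
relates them in pairs. -/
theorem inv_φ₂_mul_φ₁ (hα : 0 < α) (hu : StepLike α β N u₀) (hk : (k : ℂ) ∈ closedUpper α β)
    (x : ℝ) : (φ₂ u₀ x k)⁻¹ * φ₁ α β u₀ x k =
      !![aExt α β u₀ k, -wronskian (φ₂col₂ u₀ k 0) (flipVec (φ₁col₁ α β u₀ k 0));
        -conj (wronskian (φ₂col₂ u₀ k 0) (flipVec (φ₁col₁ α β u₀ k 0))),
        conj (aExt α β u₀ k)] := by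
  have hχ := isPrimitiveOf_φ₂col₂ hu (k := k) (Complex.ofReal_im k).ge
  have hη := (isPrimitiveOf_φ₁col₁ hα hu hk).flip
  rw [Complex.conj_ofReal] at hη
  have hd : (φ₂ u₀ x k).det = 1 := by
    have h1 := energy_φ₂col₂ hu (Complex.ofReal_im k) x
    have h2 := wronskian_flipVec_self (φ₂col₂ u₀ k x)
    rw [h1] at h2
    rw [φ₂_eq hu, Matrix.det_fin_two_of]
    simp only [wronskian, flipVec_zero, flipVec_one] at h2
    push_cast at h2
    linear_combination -h2
  rw [aExt_eq_wronskian hα hu hk x, wronskian_eq_of_dirac hχ hη 0 x, Matrix.inv_def, hd,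
    Ring.inverse_one, one_smul, φ₂_eq hu, φ₁_eq hα hu hk, Matrix.adjugate_fin_two_of]
  simp only [wronskian, flipVec_zero, flipVec_one]
  ext i j
  fin_cases i <;> fin_cases j <;> simp [Matrix.mul_apply, Fin.sum_univ_two] <;> ring

theorem a_eq_aExt (hα : 0 < α) (hu : StepLike α β N u₀) (hk : (k : ℂ) ∈ closedUpper α β) :
    a α β u₀ k = aExt α β u₀ k := by
  rw [a, scat, inv_φ₂_mul_φ₁ hα hu hk]
  rfl

theorem b_eq_wronskian (hα : 0 < α) (hu : StepLike α β N u₀) (hk : (k : ℂ) ∈ closedUpper α β)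
    (x : ℝ) : b α β u₀ k = wronskian (φ₂col₂ u₀ k x) (flipVec (φ₁col₁ α β u₀ k x)) := by
  have hχ := isPrimitiveOf_φ₂col₂ hu (k := k) (Complex.ofReal_im k).ge
  have hη := (isPrimitiveOf_φ₁col₁ hα hu hk).flip
  rw [Complex.conj_ofReal] at hη
  rw [b, scat, inv_φ₂_mul_φ₁ hα hu hk, wronskian_eq_of_dirac hχ hη x 0]
  exact neg_neg _

theorem scat_eq (hα : 0 < α) (hu : StepLike α β N u₀) (hk : (k : ℂ) ∈ closedUpper α β) :
    scat α β u₀ k =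
      !![a α β u₀ k, -b α β u₀ k; -conj (b α β u₀ k), conj (a α β u₀ k)] := by
  rw [scat, inv_φ₂_mul_φ₁ hα hu hk, a_eq_aExt hα hu hk, b_eq_wronskian hα hu hk 0]

/-- The determinant relation is the Plücker relation between the two columns, whose energies are
conserved. -/
theorem norm_sq_a_sub_norm_sq_b (hα : 0 < α) (hu : StepLike α β N u₀)
    (hk : (k : ℂ) ∈ closedUpper α β) :
    ‖a α β u₀ k‖ ^ 2 - ‖b α β u₀ k‖ ^ 2 = energy (φ₁col₁ α β u₀ k 0) := by
  have h := energy_mul_energy (φ₂col₂ u₀ k 0) (φ₁col₁ α β u₀ k 0)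
  rw [energy_φ₂col₂ hu (Complex.ofReal_im k), ← b_eq_wronskian hα hu hk, wronskian_swap,
    norm_neg, ← aExt, ← a_eq_aExt hα hu hk] at h
  linarith

theorem ofReal_mem_closedUpper_of_mem_compl (hk : k ∈ ({E₁ α β, E₂ α β}ᶜ : Set ℝ)) :
    (k : ℂ) ∈ closedUpper α β := by
  simp only [mem_compl_iff, mem_insert_iff, mem_singleton_iff, not_or] at hk
  exact ofReal_mem_closedUpper hk.1 hk.2

theorem contDiffOn_comp_ofReal {E : Type*} [NormedAddCommGroup E] [NormedSpace ℂ E] {f : ℂ → E}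
    (hf : ContDiffOn ℂ N f (closedUpper α β)) :
    ContDiffOn ℝ N (fun k : ℝ ↦ f k) {E₁ α β, E₂ α β}ᶜ :=
  (hf.restrict_scalars ℝ).comp Complex.ofRealCLM.contDiff.contDiffOn
    fun _ hk ↦ ofReal_mem_closedUpper_of_mem_compl hk

theorem contDiffOn_a (hα : 0 < α) (hu : StepLike α β N u₀) :
    ContDiffOn ℝ N (a α β u₀) {E₁ α β, E₂ α β}ᶜ :=
  (contDiffOn_comp_ofReal (contDiffOn_aExt hα hu)).congr fun _ hk ↦
    a_eq_aExt hα hu (ofReal_mem_closedUpper_of_mem_compl hk)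

theorem contDiffOn_b (hα : 0 < α) (hu : StepLike α β N u₀) :
    ContDiffOn ℝ N (b α β u₀) {E₁ α β, E₂ α β}ᶜ := by
  refine (contDiffOn_wronskian
    (contDiffOn_comp_ofReal ((contDiffOn_φ₂col₂ hu).mono sdiff_subset))
    (flipVec.contDiff.comp_contDiffOn
      (contDiffOn_comp_ofReal (contDiffOn_φ₁col₁ hα hu)))).congr fun k hk ↦ ?_
  exact b_eq_wronskian hα hu (ofReal_mem_closedUpper_of_mem_compl hk) 0

theorem analyticOnNhd_aExt (hα : 0 < α) {N : ℕ} (hN : 1 ≤ N) (hu : StepLike α β N u₀) :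
    AnalyticOnNhd ℂ (aExt α β u₀) {k | 0 < k.im} := by
  refine DifferentiableOn.analyticOnNhd (fun k hk ↦ ?_)
    (isOpen_lt continuous_const Complex.continuous_im)
  have hmem : {k : ℂ | 0 < k.im} ⊆ closedUpper α β := fun z hz ↦ by
    refine ⟨le_of_lt (show 0 < z.im from hz), fun h ↦ ?_⟩
    rcases h with h | h <;>
    · rw [h] at hz
      simp at hz
  exact (((contDiffOn_aExt hα hu).differentiableOn (by exact_mod_cast (by omega : N ≠ 0)))
    k (hmem hk)).mono hmem

end Scattering

end NLSStep

end

/-! ### The scattering relations -/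

theorem proposition3p3 (α β : ℝ) (hα : 0 < α) (N₁ : ℕ) (hN₁ : 2 ≤ N₁) (u₀ : ℝ → ℂ)
    (hu₀ : NLSStep.StepLike α β N₁ u₀) :
    -- the columns of the eigenfunctions are well defined by the Volterra equations
    ((∀ k ∈ NLSStep.closedUpper α β,
        ∃! φ, NLSStep.SolvesLeft α β u₀ (NLSStep.φb α β k) 0 φ) ∧
      (∀ k ∈ NLSStep.closedLower α β,
        ∃! φ, NLSStep.SolvesLeft α β u₀ (NLSStep.φbLower α β k) 1 φ) ∧
      (∀ k : ℂ, k.im ≤ 0 → ∃! φ, NLSStep.SolvesRight u₀ k 0 φ) ∧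
      (∀ k : ℂ, 0 ≤ k.im → ∃! φ, NLSStep.SolvesRight u₀ k 1 φ)) ∧
    -- the scattering matrix does not depend on `x` and has the symmetric form
    (∀ k : ℝ, k ≠ NLSStep.E₁ α β → k ≠ NLSStep.E₂ α β →
      (∀ x : ℝ, NLSStep.scat α β u₀ k = (NLSStep.φ₂ u₀ x k)⁻¹ * NLSStep.φ₁ α β u₀ x k) ∧
      NLSStep.scat α β u₀ k =
        !![NLSStep.a α β u₀ k, -NLSStep.b α β u₀ k;
           -conj (NLSStep.b α β u₀ k), conj (NLSStep.a α β u₀ k)]) ∧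
    -- the Wronskian formulas
    (∀ k : ℝ, k ≠ NLSStep.E₁ α β → k ≠ NLSStep.E₂ α β → ∀ x : ℝ,
      NLSStep.a α β u₀ k =
        NLSStep.φ₁ α β u₀ x k 0 0 * NLSStep.φ₂ u₀ x k 1 1 -
          NLSStep.φ₁ α β u₀ x k 1 0 * NLSStep.φ₂ u₀ x k 0 1 ∧
      conj (NLSStep.a α β u₀ k) =
        NLSStep.φ₁ α β u₀ x k 1 1 * NLSStep.φ₂ u₀ x k 0 0 -
          NLSStep.φ₁ α β u₀ x k 0 1 * NLSStep.φ₂ u₀ x k 1 0 ∧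
      NLSStep.b α β u₀ k =
        NLSStep.φ₁ α β u₀ x k 1 1 * NLSStep.φ₂ u₀ x k 0 1 -
          NLSStep.φ₁ α β u₀ x k 0 1 * NLSStep.φ₂ u₀ x k 1 1 ∧
      conj (NLSStep.b α β u₀ k) =
        NLSStep.φ₁ α β u₀ x k 0 0 * NLSStep.φ₂ u₀ x k 1 0 -
          NLSStep.φ₁ α β u₀ x k 1 0 * NLSStep.φ₂ u₀ x k 0 0) ∧
    -- regularity on the real line
    ContDiffOn ℝ N₁ (NLSStep.a α β u₀) {NLSStep.E₁ α β, NLSStep.E₂ α β}ᶜ ∧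
    ContDiffOn ℝ N₁ (NLSStep.b α β u₀) {NLSStep.E₁ α β, NLSStep.E₂ α β}ᶜ ∧
    -- the extension of `a` to the closed upper half-plane
    (∃ A : ℂ → ℂ,
      (∀ k : ℝ, k ≠ NLSStep.E₁ α β → k ≠ NLSStep.E₂ α β → A k = NLSStep.a α β u₀ k) ∧
      ContDiffOn ℂ N₁ A (NLSStep.closedUpper α β) ∧
      AnalyticOnNhd ℂ A {k | 0 < k.im} ∧
      (∀ k ∈ NLSStep.closedUpper α β, A k ≠ 0) ∧
      ∀ k ∈ NLSStep.closedUpper α β, ∀ x : ℝ,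
        A k = Matrix.det
          !![NLSStep.φ₁ α β u₀ x k 0 0, NLSStep.φ₂ u₀ x k 0 1;
             NLSStep.φ₁ α β u₀ x k 1 0, NLSStep.φ₂ u₀ x k 1 1]) ∧
    -- the determinant relation off the cut
    (∀ k : ℝ, k ∉ Icc (NLSStep.E₁ α β) (NLSStep.E₂ α β) →
      (NLSStep.scat α β u₀ k).det =
        ((‖NLSStep.a α β u₀ k‖ ^ 2 - ‖NLSStep.b α β u₀ k‖ ^ 2 : ℝ) : ℂ) ∧
      ‖NLSStep.a α β u₀ k‖ ^ 2 - ‖NLSStep.b α β u₀ k‖ ^ 2 = 1 ∧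
      1 ≤ ‖NLSStep.a α β u₀ k‖ ∧
      ‖NLSStep.b α β u₀ k‖ / ‖NLSStep.a α β u₀ k‖ < 1) := by
  have hmem : ∀ k : ℝ, k ≠ NLSStep.E₁ α β → k ≠ NLSStep.E₂ α β →
      (k : ℂ) ∈ NLSStep.closedUpper α β := fun k ↦ NLSStep.ofReal_mem_closedUpper
  refine ⟨⟨fun k hk ↦ NLSStep.existsUnique_solvesLeft_fst hα hu₀ hk,
    fun k hk ↦ NLSStep.existsUnique_solvesLeft_snd hα hu₀ hk,
    fun k hk ↦ NLSStep.existsUnique_solvesRight_fst hu₀ hk,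
    fun k hk ↦ NLSStep.existsUnique_solvesRight_snd hu₀ hk⟩,
    fun k h1 h2 ↦ ⟨fun x ↦ ?_, NLSStep.scat_eq hα hu₀ (hmem k h1 h2)⟩, fun k h1 h2 x ↦ ?_,
    NLSStep.contDiffOn_a hα hu₀, NLSStep.contDiffOn_b hα hu₀,
    ⟨NLSStep.aExt α β u₀, fun k h1 h2 ↦ (NLSStep.a_eq_aExt hα hu₀ (hmem k h1 h2)).symm,
      NLSStep.contDiffOn_aExt hα hu₀, NLSStep.analyticOnNhd_aExt hα (by omega) hu₀,
      fun k hk ↦ NLSStep.aExt_ne_zero hα hu₀ hk, fun k hk x ↦ ?_⟩, fun k hk ↦ ?_⟩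
  · rw [NLSStep.scat, NLSStep.inv_φ₂_mul_φ₁ hα hu₀ (hmem k h1 h2),
      NLSStep.inv_φ₂_mul_φ₁ hα hu₀ (hmem k h1 h2)]
  · have hk := hmem k h1 h2
    have ha := (NLSStep.a_eq_aExt hα hu₀ hk).trans (NLSStep.aExt_eq_wronskian hα hu₀ hk x)
    have hb := NLSStep.b_eq_wronskian hα hu₀ hk x
    rw [ha, hb, NLSStep.φ₁_eq hα hu₀ hk, NLSStep.φ₂_eq hu₀]
    refine ⟨rfl, ?_, ?_, ?_⟩ <;> simp [NLSStep.wronskian] <;> ring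
  · rw [NLSStep.aExt_eq_wronskian hα hu₀ hk x, Matrix.det_fin_two_of]
    simp only [NLSStep.wronskian, NLSStep.φ₁, NLSStep.φ₂, Matrix.of_apply, Matrix.cons_val',
      Matrix.cons_val_zero, Matrix.cons_val_one, Matrix.cons_val_fin_one]
    ring
  · have hE : NLSStep.E₁ α β ≤ NLSStep.E₂ α β := by
      simp only [NLSStep.E₁, NLSStep.E₂]; linarith
    have hk' : (k : ℂ) ∈ NLSStep.closedUpper α β :=
      hmem k (fun h ↦ hk (by rw [h]; exact left_mem_Icc.2 hE)) 
        (fun h ↦ hk (by rw [h]; exact right_mem_Icc.2 hE))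
    have h1 : ‖NLSStep.a α β u₀ k‖ ^ 2 - ‖NLSStep.b α β u₀ k‖ ^ 2 = 1 := by
      rw [NLSStep.norm_sq_a_sub_norm_sq_b hα hu₀ hk',
        NLSStep.energy_φ₁col₁_of_notMem hα hu₀ hk hk']
    have ha : 1 ≤ ‖NLSStep.a α β u₀ k‖ := by
      nlinarith [sq_nonneg ‖NLSStep.b α β u₀ k‖, norm_nonneg (NLSStep.a α β u₀ k)]
    refine ⟨?_, h1, ha, ?_⟩
    · rw [NLSStep.scat_eq hα hu₀ hk', Matrix.det_fin_two_of]
      push_cast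
      rw [← Complex.mul_conj', ← Complex.mul_conj']
      ring
    · rw [div_lt_one (by linarith)]
      exact lt_of_pow_lt_pow_left₀ 2 (norm_nonneg _) (by linarith)
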